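/- **Setting.** Let $\mathbb R^d$ be divided by finitely many distinct hyperplanes $\mathcal H_1,\dots,\mathcal H_q$ which form at most two families of parallel hyperplanes, hyperplanes of different families being perpendicular. Let $\Gamma=\bigcup_j\mathcal H_j$ and let the cells $\Omega_1,\dots,\Omega_m$ be pairwise disjoint with **(H1)** $\mathbb R^d=\Gamma\cup\bigcup_i\Omega_i$, $\ \Gamma\cap\Omega_i=\emptyset$, $\ \Omega_i$ open and connected. The set $\Gamma$ is the disjoint union of the relatively open faces $\Gamma_k$ of the hyperplane arrangement that it contains. The subdomains $\mathcal M_k$ are the cells $\Omega_i$ and the faces $\Gamma_k$. Let $\mathscr A\subset\mathbb R^n$ be compact, let $f:\mathbb R^d\times\mathscr A\to\mathbb R^d$ and $\ell:\mathbb R^d\times\mathscr A\to\mathbb R$ be Borel measurable, and put $F(x)=f(x,\mathscr A)$, $L(x)=\ell(x,\mathscr A)$. Assume: **(HF)** $F$ is upper semicontinuous with nonempty compact values; on each $\Omega_i$ it is locally Lipschitz for the Hausdorff distance up to $\overline{\Omega}_i$ (each point of $\overline\Omega_i$ has a neighbourhood $U$ such that $F$ is Lipschitz on $U\cap\Omega_i$);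 on each $\Gamma_k$ it has an extension by continuity to $\overline{\Gamma}_k$ with nonempty compact values; and there is $c_f>0$ with $|p|\le c_f(1+|x|)$ for all $p\in F(x)$. **(HL)** $L$ is upper semicontinuous with nonempty compact values; on each $\Omega_i$ it is locally Lipschitz for the Hausdorff distance up to $\overline\Omega_i$; and there are $c_l>0$, $\lambda_l\ge1$ with $0\le c\le c_l(1+|x|^{\lambda_l})$ for all $c\in L(x)$. **(HG)** The augmented dynamics $G(x)=\{(f(x,a),-\ell(x,a)-r): a\in\mathscr A,\ 0\le r\le c_l(1+|x|^{\lambda_l})-\ell(x,a)\}$ is upper semicontinuous with convex compact values. For $x\in\overline{\mathcal M}_k$ let $F^{\rm ext}_k$ be the extension by continuity of $F|_{\mathcal M_k}$ to $\overline{\mathcal M}_k$, and let $F^E_{\mathcal M_k}(x)=F_k^{\rm ext}(x)\cap\mathcal T_{\overline{\mathcal M}_k}(x)$, where $\mathcal T_C(x)=\{v:\liminf_{t\to0^+}d(x+tv,C)/t=0\}$. Let $A^E(x)$ be the set of $a\in\mathscr A$ such that $f(x,a)\in F^E_{\mathcal M_k}(x)$ for some $k$ with $x\in\overline{\mathcal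 M}_k$. Put $$H_F(x,p)=\sup_{a\in\mathscr A}\{-p\cdot f(x,a)-\ell(x,a)\},\qquad H^E(x,p)=\sup_{a\in A^E(x)}\{-p\cdot f(x,a)-\ell(x,a)\}.$$ Let $T>0$ and let $u:(0,T]\times\mathbb R^d\to\mathbb R$ be lower semicontinuous. For $H\in\{H^E,H_F\}$, $u$ is a supersolution for $H$ if for all $(t_0,x_0)\in(0,T)\times\mathbb R^d$ and all $\phi\in C^1((0,T)\times\mathbb R^d)$ such that $u-\phi$ has a local minimum at $(t_0,x_0)$ one has $-\phi_t(t_0,x_0)+H(x_0,D\phi(t_0,x_0))\ge0$. We say that $u$ satisfies super-optimality at $(t,x)$ if there are a control $\alpha\in L^\infty(0,T;\mathscr A)$ and an absolutely continuous $y$ with $\dot y(s)=f(y(s),\alpha(s))$ for a.e. $s\in(t,T)$, $y(t)=x$, and $$u(t,x)\ \ge\ u(t+h,y(t+h))+\int_t^{t+h}\ell(y(s),\alpha(s))\,ds\qquad\text{for all }h\in[0,T-t].$$ **Theorem.** Without any controllability assumption, the following are equivalent: (i) $u$ satisfies super-optimality at every $(t,x)\in(0,T]\times\mathbb R^d$;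 (ii) $u$ is a supersolution for the essential Hamiltonian $H^E$; (iii) $u$ is a supersolution for $H_F$. If moreover $u$ is also given at $t=0$, with $u(0,x)\ge\liminf_{(s,y)\to(0,x),\,s>0}u(s,y)$ for all $x$, then (i) may be replaced by super-optimality at every $(t,x)\in[0,T]\times\mathbb R^d$. -/

import Mathlib

open Set Filter Topology MeasureTheory

noncomputable section

/-- The Euclidean space `ℝ^d`. -/
abbrev Vec (d : ℕ) := EuclideanSpace ℝ (Fin d)

/-! ### The multi-domain -/

/-- The data of a multi-domain: `q` hyperplanes `{x | ⟪normal j, x⟫ = offset j}` and `m` cells. -/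
structure MultiDomain (d : ℕ) where
  q : ℕ
  m : ℕ
  normal : Fin q → Vec d
  offset : Fin q → ℝ
  cell : Fin m → Set (Vec d)

namespace MultiDomain

variable {d : ℕ} (P : MultiDomain d)

/-- The `j`-th separating hyperplane. -/
def hyperplane (j : Fin P.q) : Set (Vec d) :=
  {x | inner ℝ (P.normal j) x = P.offset j}

/-- The union of all the hyperplanes. -/
def interface : Set (Vec d) := ⋃ j, P.hyperplane j

/-- The relatively open face through `z` of the hyperplane arrangement: the points lying, with
respect to every hyperplane, on the same side as `z` (on it, if `z` is on it). -/
def face (z : Vec d) : Set (Vec d) :=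
  {x | ∀ j, SignType.sign (inner ℝ (P.normal j) x - P.offset j)
    = SignType.sign (inner ℝ (P.normal j) z - P.offset j)}

/-- `M` is one of the pairwise disjoint pieces into which the interface is divided. -/
def IsInterfacePiece (M : Set (Vec d)) : Prop := ∃ z ∈ P.interface, M = P.face z

/-- `M` is one of the subdomains: a cell or a piece of the interface. -/
def IsSubdomain (M : Set (Vec d)) : Prop := (∃ i, M = P.cell i) ∨ P.IsInterfacePiece M

/-- Standing assumptions on the multi-domain. The hyperplanes are distinct, form (at most) two
families of parallel hyperplanes, and hyperplanes of different families are perpendicular;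
the cells are disjoint, open, connected, do not meet the interface and fill its complement. -/
structure H1 : Prop where
  unit_normal : ∀ j, ‖P.normal j‖ = 1
  hyperplane_injective : Function.Injective P.hyperplane
  parallel_or_perp : ∀ i j,
    (P.normal i = P.normal j ∨ P.normal i = -P.normal j) ∨ inner ℝ (P.normal i) (P.normal j) = 0
  two_families : ∃ fam : Fin P.q → Bool, ∀ i j, fam i = fam j →
    (P.normal i = P.normal j ∨ P.normal i = -P.normal j)
  cover : P.interface ∪ (⋃ i, P.cell i) = univ
  interface_inter_cell : ∀ i, P.interface ∩ P.cell i = ∅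
  cell_isOpen : ∀ i, IsOpen (P.cell i)
  cell_isConnected : ∀ i, IsConnected (P.cell i)
  cell_disjoint : Pairwise fun i j => Disjoint (P.cell i) (P.cell j)

end MultiDomain

/-! ### Multifunctions -/

/-- On `M`, the multifunction `Φ` is locally Lipschitz for the Hausdorff distance, up to the
closure of `M`: every point of the closure has a neighbourhood `U` on which there is a Lipschitz
constant valid on `U ∩ M`. -/
def LocallyLipschitzUpTo {d : ℕ} {E : Type*} [PseudoMetricSpace E]
    (Φ : Vec d → Set E) (M : Set (Vec d)) : Prop :=
  ∀ x ∈ closure M, ∃ K : ℝ, ∃ U ∈ 𝓝 x, ∀ y ∈ U ∩ M, ∀ z ∈ U ∩ M,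
    Metric.hausdorffDist (Φ y) (Φ z) ≤ K * dist y z

/-- The restriction of `Φ` to `M` has an extension by continuity, with nonempty compact values and
for the Hausdorff distance, to the closure of `M`. -/
def ExtendsByContinuity {d : ℕ} {E : Type*} [PseudoMetricSpace E]
    (Φ : Vec d → Set E) (M : Set (Vec d)) : Prop :=
  ∀ x ∈ closure M, ∃ C : Set E, C.Nonempty ∧ IsCompact C ∧
    Tendsto (fun y => Metric.hausdorffDist (Φ y) C) (𝓝[M] x) (𝓝 0)

/-- The value at `x` of the extension by continuity of `Φ` restricted to `M`: the limits of
`v n ∈ Φ (z n)` with `z n ∈ M`, `z n → x`. When the Hausdorff limit of `Φ z` as `z → x` in `M`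
exists among nonempty compact sets, this set is that limit. -/
def contExt {d : ℕ} {E : Type*} [TopologicalSpace E]
    (Φ : Vec d → Set E) (M : Set (Vec d)) (x : Vec d) : Set E :=
  {p | ∃ (z : ℕ → Vec d) (v : ℕ → E), (∀ n, z n ∈ M) ∧ (∀ n, v n ∈ Φ (z n)) ∧
    Tendsto z atTop (𝓝 x) ∧ Tendsto v atTop (𝓝 p)}

/-- The tangent cone to `C` at `x`. -/
def tangentConeOf {d : ℕ} (C : Set (Vec d)) (x : Vec d) : Set (Vec d) :=
  {v | liminf (fun t : ℝ => Metric.infDist (x + t • v) C / t) (𝓝[>] 0) = 0}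

/-! ### The control problem -/

/-- The data of a control problem: the set of control values, the dynamics, the running cost. -/
structure ControlProblem (d n : ℕ) where
  A : Set (Vec n)
  f : Vec d → Vec n → Vec d
  ℓ : Vec d → Vec n → ℝ

namespace ControlProblem

variable {d n : ℕ} (S : ControlProblem d n)

/-- The set of velocities. -/
def F (x : Vec d) : Set (Vec d) := S.f x '' S.A

/-- The set of running costs. -/
def L (x : Vec d) : Set ℝ := S.ℓ x '' S.A

/-- The augmented dynamics, `cl` and `lam` being the constants in the growth bound of the cost. -/
def G (cl lam : ℝ) (x : Vec d) : Set (Vec d × ℝ) :=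
  {w | ∃ a ∈ S.A, ∃ r : ℝ, 0 ≤ r ∧ r ≤ cl * (1 + ‖x‖ ^ lam) - S.ℓ x a ∧
    w = (S.f x a, -S.ℓ x a - r)}

/-- The control set is compact, and the dynamics and the cost are Borel measurable. -/
structure Regular : Prop where
  isCompact_A : IsCompact S.A
  measurable_f : Measurable fun z : Vec d × S.A => S.f z.1 z.2
  measurable_ℓ : Measurable fun z : Vec d × S.A => S.ℓ z.1 z.2

/-- Assumptions on the velocities. The field `extends_interface` says that the extension by continuity which
enters the essential dynamics makes sense on the pieces of the interface too. -/
structure HF (P : MultiDomain d) : Prop where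
  nonempty : ∀ x, (S.F x).Nonempty
  isCompact : ∀ x, IsCompact (S.F x)
  usc : UpperHemicontinuous S.F
  lipschitz : ∀ i, LocallyLipschitzUpTo S.F (P.cell i)
  extends_interface : ∀ M, P.IsInterfacePiece M → ExtendsByContinuity S.F M
  growth : ∃ cf : ℝ, 0 < cf ∧ ∀ x, ∀ p ∈ S.F x, ‖p‖ ≤ cf * (1 + ‖x‖)

/-- Assumptions on the running cost. -/
structure HL (P : MultiDomain d) (cl lam : ℝ) : Prop where
  nonempty : ∀ x, (S.L x).Nonempty
  isCompact : ∀ x, IsCompact (S.L x)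
  usc : UpperHemicontinuous S.L
  lipschitz : ∀ i, LocallyLipschitzUpTo S.L (P.cell i)
  cl_pos : 0 < cl
  one_le_lam : 1 ≤ lam
  growth : ∀ x, ∀ c ∈ S.L x, 0 ≤ c ∧ c ≤ cl * (1 + ‖x‖ ^ lam)

/-- Assumptions on the augmented dynamics: it is upper semicontinuous with convex compact
values. -/
structure HG (cl lam : ℝ) : Prop where
  convex : ∀ x, Convex ℝ (S.G cl lam x)
  isCompact : ∀ x, IsCompact (S.G cl lam x)
  usc : UpperHemicontinuous (S.G cl lam)

/-- The essential velocities at `x` relative to the subdomain `M`. -/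
def FE (M : Set (Vec d)) (x : Vec d) : Set (Vec d) :=
  contExt S.F M x ∩ tangentConeOf (closure M) x

/-- The controls at `x` whose velocity is essential relative to some subdomain having `x` in its
closure. -/
def AE (P : MultiDomain d) (x : Vec d) : Set (Vec n) :=
  {a | a ∈ S.A ∧ ∃ M, P.IsSubdomain M ∧ x ∈ closure M ∧ S.f x a ∈ S.FE M x}

/-- The supremum of `-p · f(x,a) - ℓ(x,a)` over the controls `a ∈ B`, in the extended reals. -/
def hamiltonian (B : Set (Vec n)) (x p : Vec d) : EReal :=
  ⨆ a ∈ B, ((-inner ℝ p (S.f x a) - S.ℓ x a : ℝ) : EReal)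

/-- The Hamiltonian over all controls. -/
def HamF (x p : Vec d) : EReal := S.hamiltonian S.A x p

/-- The essential Hamiltonian. -/
def HamE (P : MultiDomain d) (x p : Vec d) : EReal := S.hamiltonian (S.AE P x) x p

/-- `α` is a control on `(0,T)`: (a representative of) an element of `L^∞(0,T;A)`. -/
def IsControl (T : ℝ) (α : ℝ → Vec n) : Prop :=
  AEMeasurable α (volume.restrict (Ioo 0 T)) ∧ ∀ᵐ s ∂(volume.restrict (Ioo 0 T)), α s ∈ S.A

/-- `(y, α)` is a trajectory-control pair on `[t,T]` starting from `x`: `y` is the absolutely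
continuous solution of `y' = f(y,α)` a.e. on `(t,T)`, `y(t) = x`, written in integral form. -/
def IsTrajectory (T t : ℝ) (x : Vec d) (y : ℝ → Vec d) (α : ℝ → Vec n) : Prop :=
  S.IsControl T α ∧ IntervalIntegrable (fun s => S.f (y s) (α s)) volume t T ∧
    ∀ s ∈ Icc t T, y s = x + ∫ r in t..s, S.f (y r) (α r)

/-- The super-optimality principle for `u` on `[0,T] × ℝ^d`, for the starting times in `I`. -/
def SuperOptimal (T : ℝ) (I : Set ℝ) (u : ℝ → Vec d → ℝ) : Prop :=
  ∀ t ∈ I, ∀ x : Vec d, ∃ (y : ℝ → Vec d) (α : ℝ → Vec n),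
    S.IsTrajectory T t x y α ∧
    IntervalIntegrable (fun s => S.ℓ (y s) (α s)) volume t T ∧
    ∀ h ∈ Icc 0 (T - t),
      u t x ≥ u (t + h) (y (t + h)) + ∫ s in t..(t + h), S.ℓ (y s) (α s)

end ControlProblem

/-- `u` is a viscosity supersolution of `-∂ₜu + H(x, Du) = 0` on `(0,T) × ℝ^d`. -/
def IsSupersolution {d : ℕ} (T : ℝ) (H : Vec d → Vec d → EReal) (u : ℝ → Vec d → ℝ) : Prop :=
  LowerSemicontinuousOn (fun z : ℝ × Vec d => u z.1 z.2) (Ioc 0 T ×ˢ univ) ∧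
  ∀ t₀ ∈ Ioo 0 T, ∀ x₀ : Vec d, ∀ φ : ℝ × Vec d → ℝ,
    ContDiffOn ℝ 1 φ (Ioo 0 T ×ˢ univ) →
    IsLocalMin (fun z : ℝ × Vec d => u z.1 z.2 - φ z) (t₀, x₀) →
    0 ≤ ((-deriv (fun t => φ (t, x₀)) t₀ : ℝ) : EReal) + H x₀ (gradient (fun x => φ (t₀, x)) x₀)

/-- At the initial time `u` is not below its values at positive times:
`u(0,x) ≥ liminf u(s,y)` as `(s,y) → (0,x)` with `0 < s`. -/
def InitialTimeRegular {d : ℕ} (u : ℝ → Vec d → ℝ) : Prop :=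
  ∀ x : Vec d, ∀ ε > 0, ∃ᶠ z : ℝ × Vec d in 𝓝[Ioi 0 ×ˢ univ] (0, x), u z.1 z.2 < u 0 x + ε

end

/-! For a supersolution `u` of `H_F`, the points that realise an inf-convolution of `u` are points
where a parabola touches `u` from below, so that some velocity of the dynamics makes the
inf-convolution decrease, over a short time step, by almost the running cost. Concatenating such
steps gives Euler polygons of the augmented dynamics `G`; as `G` is upper semicontinuous with convex
compact values, their limits are trajectories of `G`, and measurable selection recovers the control.

Conversely, let a test function `φ` violate the inequality for `H^E` at `(t, x)`, so that the
functional `φ_t + ⟪Dφ, f⟫ + ℓ` is positive on the essential velocities at `x`. Near `x` the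
subdomains are the sign patterns of at most two orthonormal coordinates, and the tangent cones of
their closures are closed orthants in these coordinates. For each sign pattern, convex separation
yields a linear form that is nonnegative on the orthant and lies below the functional near `x`, by a
positive margin. If an optimal trajectory starts at `x`, the integral of the functional along it is
too small, so that the planar curve of the two coordinates decreases the linear form of each sign
pattern while it matches that pattern; no continuous curve starting at the origin does so. -/

/-! ### Measurable selection -/

lemma exists_measure_iUnion_le_add {Y : Type*} [MeasurableSpace Y] {μ : Measure Y} {s : ℕ → Set Y}
    (hs : Monotone s) (hfin : μ (⋃ m, s m) ≠ ⊤) {ε : ENNReal} (hε : ε ≠ 0) :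
    ∃ m, μ (⋃ m, s m) ≤ μ (s m) + ε := by
  have hlim : Tendsto (fun m => μ (s m) + ε) atTop (𝓝 (μ (⋃ m, s m) + ε)) :=
    (tendsto_measure_iUnion_atTop hs).add_const ε
  exact (hlim.eventually_const_le (ENNReal.lt_add_right hfin hε)).exists

lemma nullMeasurableSet_of_measurable_inner_approx {Y : Type*} [MeasurableSpace Y] {μ : Measure Y}
    {s : Set Y} (hfin : μ s ≠ ⊤)
    (h : ∀ ε : ENNReal, ε ≠ 0 → ∃ t ⊆ s, MeasurableSet t ∧ μ s ≤ μ t + ε) :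
    NullMeasurableSet s μ := by
  choose t hts ht hμ using fun n : ℕ => h (n : ENNReal)⁻¹ (by simp)
  have hsub : ⋃ n, t n ⊆ s := iUnion_subset hts
  have hmeas : MeasurableSet (⋃ n, t n) := .iUnion ht
  have hle : μ s ≤ μ (⋃ n, t n) := by
    have hlim : Tendsto (fun n : ℕ => μ (⋃ n, t n) + (n : ENNReal)⁻¹) atTop
        (𝓝 (μ (⋃ n, t n))) := by
      simpa using tendsto_const_nhds.add ENNReal.tendsto_inv_nat_nhds_zero
    refine ge_of_tendsto' hlim fun n => (hμ n).trans ?_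
    gcongr
    exact subset_iUnion t n
  exact hmeas.nullMeasurableSet.congr
    (ae_eq_of_subset_of_measure_ge hsub hle hmeas.nullMeasurableSet hfin)

/-- The sequences of natural numbers whose first `k` terms are bounded by those of `b`. -/
def prefixBox (b : ℕ → ℕ) (k : ℕ) : Set (ℕ → ℕ) := {σ | ∀ i < k, σ i ≤ b i}

lemma prefixBox_congr {b b' : ℕ → ℕ} {k : ℕ} (h : ∀ i < k, b i = b' i) :
    prefixBox b k = prefixBox b' k := by
  ext σ
  exact forall₂_congr fun i hi => by rw [h i hi]

lemma antitone_prefixBox (b : ℕ → ℕ) : Antitone (prefixBox b) :=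
  fun _ _ hkl _ hσ i hi => hσ i (hi.trans_le hkl)

lemma monotone_prefixBox_update (b : ℕ → ℕ) (k : ℕ) :
    Monotone fun m => prefixBox (Function.update b k m) (k + 1) :=
  fun _ _ hmm' _ hσ i hi => (hσ i hi).trans (Function.update_mono hmm' i)

lemma iUnion_prefixBox_update (b : ℕ → ℕ) (k : ℕ) :
    ⋃ m, prefixBox (Function.update b k m) (k + 1) = prefixBox b k := by
  ext σ
  simp only [prefixBox, mem_iUnion, mem_ofPred_eq, Nat.forall_lt_succ_right,
    Function.update_self]
  have hprefix (m : ℕ) : (∀ i < k, σ i ≤ Function.update b k m i) ↔ ∀ i < k, σ i ≤ b i :=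
    forall₂_congr fun i hi => by rw [Function.update_of_ne hi.ne]
  simp only [hprefix]
  exact ⟨fun ⟨_, h, _⟩ => h, fun h => ⟨σ k, h, le_rfl⟩⟩

lemma isCompact_Iic_baire (b : ℕ → ℕ) : IsCompact (Iic b) :=
  Icc_bot (a := b) ▸ isCompact_Icc

lemma exists_prefixBox_subset {U : Set (ℕ → ℕ)} (hU : IsOpen U) {b : ℕ → ℕ} (hb : Iic b ⊆ U) :
    ∃ k, prefixBox b k ⊆ U := by
  let _ := PiNat.metricSpaceNatNat
  obtain ⟨δ, hδ, hδU⟩ := (isCompact_Iic_baire b).exists_thickening_subset_open hU hb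
  obtain ⟨k, hk⟩ := exists_pow_lt_of_lt_one hδ (by norm_num : (1 / 2 : ℝ) < 1)
  refine ⟨k, fun σ hσ => hδU (Metric.mem_thickening_iff.2 ⟨σ ⊓ b, mem_Iic.2 inf_le_right, ?_⟩)⟩
  have hcyl : σ ∈ PiNat.cylinder (σ ⊓ b) k := fun i hi => (inf_eq_left.2 (hσ i hi)).symm
  exact (PiNat.mem_cylinder_iff_dist_le.1 hcyl).trans_lt hk

lemma iInter_closure_image_prefixBox_subset {Y : Type*} [TopologicalSpace Y] [T2Space Y]
    {h : (ℕ → ℕ) → Y} (hh : Continuous h) (b : ℕ → ℕ) :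
    ⋂ k, closure (h '' prefixBox b k) ⊆ h '' Iic b := by
  intro y hy
  by_contra hyb
  obtain ⟨V, W, hV, hW, hbV, hyW, hVW⟩ := SeparatedNhds.of_isCompact_isCompact
    ((isCompact_Iic_baire b).image hh) (isCompact_singleton (x := y))
    (disjoint_singleton_right.2 hyb)
  obtain ⟨k, hk⟩ := exists_prefixBox_subset (hV.preimage hh) (image_subset_iff.1 hbV)
  obtain ⟨z, hzW, hz⟩ := mem_closure_iff.1 (mem_iInter.1 hy k) W hW (hyW rfl)
  exact disjoint_left.1 hVW (image_subset_iff.2 hk hz) hzW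

lemma exists_forall_of_forall_exists_update {Q : ℕ → (ℕ → ℕ) → Prop}
    (hQ : ∀ k b b', (∀ i ≤ k, b i = b' i) → Q k b → Q k b')
    (hstep : ∀ k b, ∃ m, Q k (Function.update b k m)) : ∃ b, ∀ k, Q k b := by
  choose g hg using hstep
  let B : ℕ → ℕ → ℕ := fun k => Nat.rec 0 (fun k b => Function.update b k (g k b)) k
  have hB : ∀ k, B (k + 1) = Function.update (B k) k (g k (B k)) := fun _ => rfl
  have hdiag : ∀ k, ∀ i < k, B k i = B (i + 1) i := by
    intro k
    induction k with
    | zero => simp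
    | succ k ih =>
      intro i hi
      rcases Nat.lt_succ_iff_lt_or_eq.1 hi with hik | rfl
      · rw [hB, Function.update_of_ne hik.ne, ih i hik]
      · rfl
  exact ⟨fun i => B (i + 1) i, fun k =>
    hQ k _ _ (fun i hi => hdiag (k + 1) i (Nat.lt_succ_iff.2 hi)) (hg k (B k))⟩

section

variable {Y : Type*} [MeasurableSpace Y] (μ : Measure Y) [IsFiniteMeasure μ] {h : (ℕ → ℕ) → Y}

lemma exists_measure_range_le_measure_image_prefixBox_add (h : (ℕ → ℕ) → Y) {ε : ENNReal}
    (hε : ε ≠ 0) : ∃ b, ∀ k, μ (range h) ≤ μ (h '' prefixBox b k) + ε := by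
  obtain ⟨δ, hδ, hsum⟩ := ENNReal.exists_pos_sum_of_countable hε ℕ
  obtain ⟨b, hb⟩ : ∃ b, ∀ k, μ (h '' prefixBox b k) ≤ μ (h '' prefixBox b (k + 1)) + δ k := by
    refine exists_forall_of_forall_exists_update (fun k b b' hbb' => ?_) fun k b => ?_
    · rw [prefixBox_congr fun i hi => hbb' i (Nat.le_of_lt hi),
        prefixBox_congr fun i hi => hbb' i (Nat.le_of_lt_succ hi)]
      exact id
    · have hunion : h '' prefixBox b k =
          ⋃ m, h '' prefixBox (Function.update b k m) (k + 1) := by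
        rw [← image_iUnion, iUnion_prefixBox_update]
      obtain ⟨m, hm⟩ := exists_measure_iUnion_le_add (μ := μ)
        (fun _ _ hmm' => image_mono (monotone_prefixBox_update b k hmm')) (measure_ne_top _ _)
        (ENNReal.coe_ne_zero.2 (hδ k).ne')
      refine ⟨m, ?_⟩
      rwa [prefixBox_congr fun i hi => Function.update_of_ne hi.ne m b, hunion]
  have hpartial : ∀ k, μ (range h) ≤
      μ (h '' prefixBox b k) + ∑ i ∈ Finset.range k, (δ i : ENNReal) := by
    intro k
    induction k with
    | zero => simp [prefixBox]
    | succ k ih =>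
      rw [Finset.sum_range_succ, add_comm (∑ i ∈ Finset.range k, _), ← add_assoc]
      exact ih.trans (by gcongr; exact hb k)
  refine ⟨b, fun k => (hpartial k).trans ?_⟩
  gcongr
  exact (ENNReal.sum_le_tsum _).trans hsum.le

variable [TopologicalSpace Y] [T2Space Y] [BorelSpace Y]

lemma exists_measure_range_le_measure_image_Iic_add (hh : Continuous h) {ε : ENNReal}
    (hε : ε ≠ 0) : ∃ b, μ (range h) ≤ μ (h '' Iic b) + ε := by
  obtain ⟨b, hb⟩ := exists_measure_range_le_measure_image_prefixBox_add μ h hε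
  have hanti : Antitone fun k => closure (h '' prefixBox b k) :=
    fun _ _ hkl => closure_mono (image_mono (antitone_prefixBox b hkl))
  refine ⟨b, tsub_le_iff_right.1 ?_⟩
  calc μ (range h) - ε ≤ ⨅ k, μ (closure (h '' prefixBox b k)) :=
        le_iInf fun k => tsub_le_iff_right.2 ((hb k).trans (by gcongr; exact subset_closure))
    _ = μ (⋂ k, closure (h '' prefixBox b k)) :=
        (hanti.measure_iInter (fun _ => isClosed_closure.nullMeasurableSet)
          ⟨0, measure_ne_top _ _⟩).symm
    _ ≤ μ (h '' Iic b) := measure_mono (iInter_closure_image_prefixBox_subset hh b)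

lemma nullMeasurableSet_of_analyticSet {s : Set Y} (hs : AnalyticSet s) :
    NullMeasurableSet s μ := by
  rw [AnalyticSet] at hs
  rcases hs with rfl | ⟨h, hh, rfl⟩
  · exact nullMeasurableSet_empty
  refine nullMeasurableSet_of_measurable_inner_approx (measure_ne_top _ _) fun ε hε => ?_
  obtain ⟨b, hb⟩ := exists_measure_range_le_measure_image_Iic_add μ hh hε
  exact ⟨h '' Iic b, image_subset_range _ _,
    ((isCompact_Iic_baire b).image hh).isClosed.measurableSet, hb⟩

end

/-- The lexicographically least element of the fibre of `h` over `y`. When the fibre is not closed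
it may lie outside the fibre; when the fibre is empty it is the zero sequence. -/
noncomputable def leftmostBranch {Y : Type*} (h : (ℕ → ℕ) → Y) (y : Y) (k : ℕ) : ℕ :=
  sInf {n | ∃ τ, h τ = y ∧ (∀ i : Fin k, τ i = leftmostBranch h y i) ∧ τ k = n}
termination_by k
decreasing_by exact i.2

lemma exists_mem_cylinder_leftmostBranch {Y : Type*} {h : (ℕ → ℕ) → Y} {y : Y} (hy : y ∈ range h)
    (k : ℕ) : ∃ τ ∈ PiNat.cylinder (leftmostBranch h y) k, h τ = y := by
  induction k with
  | zero => simpa using hy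
  | succ k ih =>
    obtain ⟨τ, hτ, hτy⟩ := ih
    obtain ⟨ρ, hρy, hρ, hρk⟩ := Nat.sInf_mem
      (s := {n | ∃ τ, h τ = y ∧ (∀ i : Fin k, τ i = leftmostBranch h y i) ∧ τ k = n})
      ⟨τ k, τ, hτy, fun i => hτ i i.2, rfl⟩
    refine ⟨ρ, fun i hi => ?_, hρy⟩
    rcases Nat.lt_succ_iff_lt_or_eq.1 hi with hi | rfl
    · exact hρ ⟨i, hi⟩
    · rw [hρk, leftmostBranch]

lemma apply_leftmostBranch {Y : Type*} [TopologicalSpace Y] [T2Space Y] {h : (ℕ → ℕ) → Y}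
    (hh : Continuous h) {y : Y} (hy : y ∈ range h) : h (leftmostBranch h y) = y := by
  choose τ hτ hτy using exists_mem_cylinder_leftmostBranch hy
  have hlim : Tendsto τ atTop (𝓝 (leftmostBranch h y)) :=
    tendsto_pi_nhds.2 fun i => tendsto_const_nhds.congr' <|
      (eventually_gt_atTop i).mono fun k hk => (hτ k i hk).symm
  exact tendsto_nhds_unique ((hh.tendsto _).comp hlim) (by simp [Function.comp_def, hτy])

lemma nullMeasurableSet_setOf_sInf_eq {Y : Type*} [MeasurableSpace Y] {μ : Measure Y}
    {N : Y → Set ℕ} (hN : ∀ n, NullMeasurableSet {y | n ∈ N y} μ) (m : ℕ) :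
    NullMeasurableSet {y | sInf (N y) = m} μ := by
  have hset : {y | sInf (N y) = m} =
      ({y | m ∈ N y} ∩ ⋂ j ∈ Finset.range m, {y | j ∈ N y}ᶜ) ∪
        ((⋂ j, {y | j ∈ N y}ᶜ) ∩ {_y | m = 0}) := by
    ext y
    simp only [mem_ofPred_eq, mem_union, mem_inter_iff, mem_iInter, mem_compl_iff,
      Finset.mem_range]
    constructor
    · rintro rfl
      rcases (N y).eq_empty_or_nonempty with h | h
      · exact .inr (by simp [h])
      · exact .inl ⟨Nat.sInf_mem h, fun j hj => Nat.notMem_of_lt_sInf hj⟩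
    · rintro (⟨hm, hlt⟩ | ⟨hempty, rfl⟩)
      · exact (Nat.sInf_le hm).antisymm (not_lt.1 fun h => hlt _ h (Nat.sInf_mem ⟨m, hm⟩))
      · rw [eq_empty_of_forall_notMem hempty, Nat.sInf_empty]
  rw [hset]
  exact ((hN m).inter (.biInter (Finset.range m).countable_toSet fun j _ => (hN j).compl)).union
    ((NullMeasurableSet.iInter fun j => (hN j).compl).inter
      (MeasurableSet.const _).nullMeasurableSet)

section

variable {Y : Type*} [TopologicalSpace Y] [T2Space Y] [MeasurableSpace Y] [BorelSpace Y]
  (μ : Measure Y) [IsFiniteMeasure μ] {h : (ℕ → ℕ) → Y}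

lemma nullMeasurableSet_leftmostBranch_mem_cylinder (hh : Continuous h) (w : ℕ → ℕ) (k : ℕ) :
    NullMeasurableSet {y | leftmostBranch h y ∈ PiNat.cylinder w k} μ := by
  induction k with
  | zero => simp
  | succ k ih =>
    have hsucc : {y | leftmostBranch h y ∈ PiNat.cylinder w (k + 1)} =
        {y | leftmostBranch h y ∈ PiNat.cylinder w k} ∩
          {y | sInf {n | y ∈ h '' (PiNat.cylinder w k ∩ {τ | τ k = n})} = w k} := by
      ext y
      simp only [mem_inter_iff, mem_ofPred_eq, PiNat.mem_cylinder_iff,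
        Nat.forall_lt_succ_right]
      refine and_congr_right fun hk => ?_
      rw [leftmostBranch]
      have hw : ∀ i : Fin k, leftmostBranch h y i = w i := fun i => hk i i.2
      simp only [hw, mem_image, mem_inter_iff, PiNat.mem_cylinder_iff, mem_ofPred_eq,
        Fin.forall_iff, and_comm]
    rw [hsucc]
    refine ih.inter (nullMeasurableSet_setOf_sInf_eq (fun n => ?_) _)
    have hopen : IsOpen (PiNat.cylinder w k ∩ {τ : ℕ → ℕ | τ k = n}) :=
      (PiNat.isOpen_cylinder _ w k).inter
        ((isOpen_discrete {n}).preimage (continuous_apply (A := fun _ : ℕ => ℕ) k))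
    exact nullMeasurableSet_of_analyticSet μ (hopen.analyticSet_image hh)

lemma aemeasurable_leftmostBranch (hh : Continuous h) : AEMeasurable (leftmostBranch h) μ := by
  refine NullMeasurable.aemeasurable ?_
  have hgen : (MeasurableSpace.pi : MeasurableSpace (ℕ → ℕ)) =
      .generateFrom {s | ∃ (w : ℕ → ℕ) (k : ℕ), s = PiNat.cylinder w k} := by
    rw [BorelSpace.measurable_eq (α := ℕ → ℕ)]
    exact (PiNat.isTopologicalBasis_cylinders fun _ => ℕ).borel_eq_generateFrom
  have hmeas : Measurable (leftmostBranch h : NullMeasurableSpace Y μ → ℕ → ℕ) := by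
    rw [hgen]
    refine measurable_generateFrom ?_
    rintro _ ⟨w, k, rfl⟩
    exact nullMeasurableSet_leftmostBranch_mem_cylinder μ hh w k
  exact fun s hs => hmeas hs

end

lemma exists_measurable_surjective_continuous_comp {B Y : Type*} [t : TopologicalSpace B]
    [PolishSpace B] [MeasurableSpace B] [BorelSpace B] [Nonempty B] [TopologicalSpace Y]
    [SecondCountableTopology Y] [MeasurableSpace Y] [OpensMeasurableSpace Y] {f : B → Y}
    (hf : Measurable f) :
    ∃ p : (ℕ → ℕ) → B, Measurable p ∧ Function.Surjective p ∧ Continuous fun σ => f (p σ) := by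
  obtain ⟨t', ht', hcont, hpol⟩ := hf.exists_continuous
  obtain ⟨p, hp, hps⟩ := @PolishSpace.exists_nat_nat_continuous_surjective B t' hpol _
  have hp' : Continuous[_, t] p := continuous_le_rng ht' hp
  exact ⟨p, @Continuous.measurable _ _ _ _ _ t _ _ p hp', hps,
    @Continuous.comp _ _ _ _ t' _ _ _ hcont hp⟩

/-- The almost everywhere form of the Jankov–von Neumann theorem. -/
theorem exists_aemeasurable_selection {Y X : Type*} [MeasurableSpace Y] [StandardBorelSpace Y]
    [MeasurableSpace X] [StandardBorelSpace X] [Nonempty X] (μ : Measure Y) [IsFiniteMeasure μ]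
    {B : Set (Y × X)} (hB : MeasurableSet B) (hne : ∀ᵐ y ∂μ, ∃ x, (y, x) ∈ B) :
    ∃ g : Y → X, AEMeasurable g μ ∧ ∀ᵐ y ∂μ, (y, g y) ∈ B := by
  let _ := upgradeStandardBorel Y
  rcases B.eq_empty_or_nonempty with rfl | hBne
  · exact ⟨fun _ => Classical.arbitrary X, aemeasurable_const, by simpa using hne⟩
  have : StandardBorelSpace B := hB.standardBorel
  let _ := upgradeStandardBorel B
  have : Nonempty B := hBne.to_subtype
  obtain ⟨p, hp, hps, hcont⟩ := exists_measurable_surjective_continuous_comp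
    (f := fun z : B => z.1.1) (measurable_fst.comp measurable_subtype_coe)
  let branch := leftmostBranch fun σ => (p σ).1.1
  refine ⟨fun y => (p (branch y)).1.2, ?_, ?_⟩
  · exact (measurable_snd.comp (measurable_subtype_coe.comp hp)).comp_aemeasurable
      (aemeasurable_leftmostBranch μ hcont)
  · filter_upwards [hne] with y ⟨x, hx⟩
    obtain ⟨σ, hσ⟩ := hps ⟨(y, x), hx⟩
    have hfst : (p (branch y)).1.1 = y := apply_leftmostBranch hcont ⟨σ, by simp [hσ]⟩
    exact (Prod.ext hfst.symm rfl : (y, (p (branch y)).1.2) = (p (branch y)).1) ▸ (p (branch y)).2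

/-! ### Lipschitz curves and limits of polygons -/

section LipschitzCurve

variable {E : Type*} [NormedAddCommGroup E] [NormedSpace ℝ E] [FiniteDimensional ℝ E]
  {K : NNReal} {Y : ℝ → E}

lemma intervalIntegrable_deriv_of_lipschitzWith (hY : LipschitzWith K Y) (a b : ℝ) :
    IntervalIntegrable (deriv Y) volume a b := by
  have : CompleteSpace E := FiniteDimensional.complete ℝ E
  borelize E
  exact (intervalIntegrable_const (c := (K : ℝ))).mono_fun
    (stronglyMeasurable_deriv Y).aestronglyMeasurable
    (Eventually.of_forall fun x => (norm_deriv_le_of_lipschitz hY).trans (le_abs_self _))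

lemma intervalIntegral_deriv_of_lipschitzWith (hY : LipschitzWith K Y) (a b : ℝ) :
    ∫ x in a..b, deriv Y x = Y b - Y a := by
  have : CompleteSpace E := FiniteDimensional.complete ℝ E
  refine (SeparatingDual.eq_iff_forall_dual_eq (R := ℝ)).2 fun φ => ?_
  have hcomp : ∀ᵐ x, φ (deriv Y x) = deriv (φ ∘ Y) x := by
    filter_upwards [hY.ae_differentiableAt_real] with x hx
    exact (φ.hasFDerivAt.comp_hasDerivAt x hx.hasDerivAt).deriv.symm
  calc φ (∫ x in a..b, deriv Y x) = ∫ x in a..b, φ (deriv Y x) :=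
        (φ.intervalIntegral_comp_comm (intervalIntegrable_deriv_of_lipschitzWith hY a b)).symm
    _ = ∫ x in a..b, deriv (φ ∘ Y) x :=
        intervalIntegral.integral_congr_ae (hcomp.mono fun x hx _ => hx)
    _ = φ (Y b) - φ (Y a) :=
        (φ.lipschitz.comp hY).lipschitzOnWith.absolutelyContinuousOnInterval.integral_deriv_eq_sub
    _ = φ (Y b - Y a) := (map_sub φ _ _).symm

end LipschitzCurve

lemma inv_card_smul_sum_mem_of_convex {ι E : Type*} [AddCommGroup E] [Module ℝ E] {C : Set E}
    (hC : Convex ℝ C) {s : Finset ι} (hs : s.Nonempty) {V : ι → E} (hV : ∀ i ∈ s, V i ∈ C) :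
    (s.card : ℝ)⁻¹ • ∑ i ∈ s, V i ∈ C := by
  have hcard : (s.card : ℝ) ≠ 0 := by exact_mod_cast hs.card_pos.ne'
  rw [Finset.smul_sum]
  exact hC.sum_mem (fun i _ => by positivity) (by simp [hcard]) hV

/-- The index of the last point of the grid `t + ℕ h` that is not after `s`; it is `0` for
`s < t`. -/
noncomputable def gridIndex (t h s : ℝ) : ℕ := ⌊(s - t) / h⌋₊

section GridIndex

variable {t h s r : ℝ}

lemma gridIndex_of_le (hh : 0 < h) (hs : s ≤ t) : gridIndex t h s = 0 :=
  Nat.floor_of_nonpos (div_nonpos_of_nonpos_of_nonneg (sub_nonpos.2 hs) hh.le)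

lemma gridIndex_mul_le (hh : 0 < h) (hs : t ≤ s) : gridIndex t h s * h ≤ s - t :=
  (le_div_iff₀ hh).1 (Nat.floor_le (div_nonneg (sub_nonneg.2 hs) hh.le))

lemma lt_gridIndex_add_one_mul (hh : 0 < h) : s - t < (gridIndex t h s + 1) * h :=
  (div_lt_iff₀ hh).1 (Nat.lt_floor_add_one _)

lemma gridIndex_le_gridIndex (hh : 0 < h) (hsr : s ≤ r) : gridIndex t h s ≤ gridIndex t h r :=
  Nat.floor_mono (by gcongr)

lemma gridIndex_add_mul (hh : 0 < h) (i : ℕ) : gridIndex t h (t + i * h) = i := by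
  rw [gridIndex, add_sub_cancel_left, mul_div_cancel_right₀ _ hh.ne', Nat.floor_natCast]

lemma gridIndex_sub_gridIndex_mul_le (hh : 0 < h) (hsr : s ≤ r) :
    ((gridIndex t h r : ℝ) - gridIndex t h s) * h ≤ r - s + h := by
  rcases le_total t r with hr | hr
  · have hlow := lt_gridIndex_add_one_mul (t := t) (s := s) hh
    have hup := gridIndex_mul_le hh hr
    linarith
  · rw [gridIndex_of_le hh hr, gridIndex_of_le hh (hsr.trans hr)]
    simp only [sub_self, zero_mul]
    linarith

lemma tendsto_mul_gridIndex {ι : Type*} {l : Filter ι} {t h : ι → ℝ} {t₀ s : ℝ}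
    (hh : ∀ N, 0 < h N) (hh0 : Tendsto h l (𝓝 0)) (ht : Tendsto t l (𝓝 t₀)) (hs : t₀ < s) :
    Tendsto (fun N => h N * gridIndex (t N) (h N) s) l (𝓝 (s - t₀)) := by
  have hupper : Tendsto (fun N => s - t N) l (𝓝 (s - t₀)) := tendsto_const_nhds.sub ht
  have hlower : Tendsto (fun N => s - t N - h N) l (𝓝 (s - t₀)) := by simpa using hupper.sub hh0
  refine tendsto_of_tendsto_of_tendsto_of_le_of_le' hlower hupper (Eventually.of_forall fun N => ?_)
    ((ht.eventually_lt_const hs).mono fun N hN => ?_)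
  · linarith [lt_gridIndex_add_one_mul (t := t N) (s := s) (hh N)]
  · linarith [gridIndex_mul_le (hh N) hN.le]

end GridIndex

section PolygonLimit

variable {E : Type*} [NormedAddCommGroup E] [NormedSpace ℝ E]

/-- The vertices of the polygon with step `h`, velocities `V` and starting point `y`. -/
noncomputable def polygon (y : E) (h : ℝ) (V : ℕ → E) (i : ℕ) : E :=
  y + h • ∑ j ∈ Finset.range i, V j

/-- The step function in time that takes the value `polygon y h V i` on `[t + i h, t + (i + 1) h)`.
It is constant before the time `t`. -/
noncomputable def polygonPath (t h : ℝ) (y : E) (V : ℕ → E) (s : ℝ) : E :=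
  polygon y h V (gridIndex t h s)

lemma polygon_zero (y : E) (h : ℝ) (V : ℕ → E) : polygon y h V 0 = y := by simp [polygon]

lemma polygon_succ (y : E) (h : ℝ) (V : ℕ → E) (i : ℕ) :
    polygon y h V (i + 1) = polygon y h V i + h • V i := by
  simp only [polygon, Finset.sum_range_succ, smul_add, add_assoc]

lemma polygon_sub {y : E} {h : ℝ} {V : ℕ → E} {i j : ℕ} (hij : i ≤ j) :
    polygon y h V j - polygon y h V i = h • ∑ l ∈ Finset.Ico i j, V l := by
  simp only [polygon]
  rw [add_sub_add_left_eq_sub, ← smul_sub, Finset.sum_Ico_eq_sub _ hij]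

lemma polygonPath_of_le {t h s : ℝ} {y : E} {V : ℕ → E} (hh : 0 < h) (hs : s ≤ t) :
    polygonPath t h y V s = y := by
  rw [polygonPath, gridIndex_of_le hh hs, polygon_zero]

lemma polygonPath_add_mul {t h : ℝ} {y : E} {V : ℕ → E} (hh : 0 < h) (i : ℕ) :
    polygonPath t h y V (t + i * h) = polygon y h V i := by
  rw [polygonPath, gridIndex_add_mul hh]

lemma exists_forall_eq_polygon (y : E) (h : ℝ) (v : ℕ → E → E) :
    ∃ V : ℕ → E, ∀ i, V i = v i (polygon y h V i) := by
  let p : ℕ → E := fun i => Nat.rec y (fun i p => p + h • v i p) i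
  have hp : ∀ i, polygon y h (fun j => v j (p j)) i = p i := by
    intro i
    induction i with
    | zero => exact polygon_zero _ _ _
    | succ i ih => rw [polygon_succ, ih]
  exact ⟨fun i => v i (p i), fun i => by rw [hp]⟩

lemma norm_polygonPath_sub_le {t h : ℝ} {y : E} {V : ℕ → E} {M : ℝ} (hh : 0 < h)
    (hV : ∀ i, ‖V i‖ ≤ M) {s r : ℝ} (hsr : s ≤ r) :
    ‖polygonPath t h y V r - polygonPath t h y V s‖ ≤ M * (r - s + h) := by
  have hM : 0 ≤ M := (norm_nonneg _).trans (hV 0)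
  have hle := gridIndex_le_gridIndex (t := t) hh hsr
  have hsum : ‖∑ l ∈ Finset.Ico (gridIndex t h s) (gridIndex t h r), V l‖ ≤
      ((gridIndex t h r : ℝ) - gridIndex t h s) * M := by
    refine (norm_sum_le_of_le _ fun i _ => hV i).trans (le_of_eq ?_)
    simp [Nat.cast_sub hle]
  rw [polygonPath, polygonPath, polygon_sub hle, norm_smul, Real.norm_of_nonneg hh.le]
  calc h * _ ≤ h * (((gridIndex t h r : ℝ) - gridIndex t h s) * M) := by gcongr
    _ = M * (((gridIndex t h r : ℝ) - gridIndex t h s) * h) := by ring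
    _ ≤ _ := by gcongr; exact gridIndex_sub_gridIndex_mul_le hh hsr

lemma dist_polygonPath_le {t h : ℝ} {y : E} {V : ℕ → E} {M : ℝ} (hh : 0 < h)
    (hV : ∀ i, ‖V i‖ ≤ M) (r s : ℝ) :
    dist (polygonPath t h y V r) (polygonPath t h y V s) ≤ M * (|r - s| + h) := by
  wlog hsr : s ≤ r generalizing r s
  · rw [dist_comm, abs_sub_comm]
    exact this s r (le_of_not_ge hsr)
  rw [dist_eq_norm, abs_of_nonneg (sub_nonneg.2 hsr)]
  exact norm_polygonPath_sub_le hh hV hsr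

lemma norm_polygonPath_le {t h b : ℝ} {y : E} {V : ℕ → E} {M : ℝ} (hh : 0 < h) (hhb : h ≤ b)
    (htb : |t| ≤ b) (hyb : ‖y‖ ≤ b) (hV : ∀ i, ‖V i‖ ≤ M) (s : ℝ) :
    ‖polygonPath t h y V s‖ ≤ M * (|s| + b + b) + b := by
  have hM : 0 ≤ M := (norm_nonneg _).trans (hV 0)
  have hstep := norm_polygonPath_sub_le (t := t) (y := y) hh hV (min_le_left s t)
  rw [polygonPath_of_le hh (min_le_right s t)] at hstep
  have hlen : s - min s t ≤ |s| + b := by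
    rcases min_choice s t with hmin | hmin <;> rw [hmin] <;>
      linarith [le_abs_self s, neg_abs_le t, abs_nonneg s, abs_nonneg t]
  calc ‖polygonPath t h y V s‖ ≤ ‖y‖ + ‖polygonPath t h y V s - y‖ :=
        norm_le_norm_add_norm_sub' _ _
    _ ≤ b + M * (s - min s t + h) := by gcongr
    _ ≤ b + M * (|s| + b + b) := by gcongr
    _ = _ := add_comm _ _

variable {ι : Type*} {t h : ι → ℝ} {y : ι → E} {V : ι → ℕ → E} {t₀ M : ℝ} {Y : ℝ → E}
  {l : Filter ι}

lemma lipschitzWith_of_polygonPath_tendsto [l.NeBot] (hh : ∀ N, 0 < h N)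
    (hh0 : Tendsto h l (𝓝 0)) (hV : ∀ N i, ‖V N i‖ ≤ M)
    (hY : ∀ s, Tendsto (fun N => polygonPath (t N) (h N) (y N) (V N) s) l (𝓝 (Y s))) :
    LipschitzWith M.toNNReal Y := by
  refine LipschitzWith.of_dist_le' fun r s => ?_
  have hlim : Tendsto (fun N => M * (|r - s| + h N)) l (𝓝 (M * (|r - s| + 0))) :=
    (hh0.const_add _).const_mul _
  rw [Real.dist_eq, ← add_zero |r - s|]
  exact le_of_tendsto_of_tendsto' ((hY r).dist (hY s)) hlim
    fun N => dist_polygonPath_le (hh N) (hV N) r s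

lemma abs_add_mul_sub_le_of_mem_Ico_gridIndex {t h s r ρ : ℝ} {i : ℕ} (hh : 0 < h) (hhρ : h ≤ ρ)
    (ht : t ≤ s) (hsr : s ≤ r) (hr : r ≤ s + ρ)
    (hi : i ∈ Finset.Ico (gridIndex t h s) (gridIndex t h r)) : |t + i * h - s| ≤ ρ := by
  rw [Finset.mem_Ico] at hi
  have hlow : (gridIndex t h s : ℝ) * h ≤ i * h := by gcongr; exact hi.1
  have hup : (i : ℝ) * h ≤ gridIndex t h r * h := by gcongr; exact hi.2.le
  have hs := lt_gridIndex_add_one_mul (t := t) (s := s) hh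
  have hr' := gridIndex_mul_le hh (ht.trans hsr)
  rw [abs_le]
  constructor <;> linarith

lemma inv_smul_polygonPath_sub_mem {t h s r ρ : ℝ} {y : E} {V : ℕ → E} {C : Set E}
    (hC : Convex ℝ C) (hh : 0 < h) (hhρ : h ≤ ρ) (ht : t ≤ s) (hsr : s ≤ r) (hr : r ≤ s + ρ)
    (hlt : gridIndex t h s < gridIndex t h r) (hV : ∀ i : ℕ, |t + i * h - s| ≤ ρ → V i ∈ C) :
    (h * gridIndex t h r - h * gridIndex t h s)⁻¹ •
      (polygonPath t h y V r - polygonPath t h y V s) ∈ C := by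
  have hcoef : (h * gridIndex t h r - h * gridIndex t h s)⁻¹ * h =
      ((Finset.Ico (gridIndex t h s) (gridIndex t h r)).card : ℝ)⁻¹ := by
    rw [Nat.card_Ico, Nat.cast_sub hlt.le, ← mul_sub, mul_inv]
    field_simp
  rw [polygonPath, polygonPath, polygon_sub hlt.le, smul_smul, hcoef]
  exact inv_card_smul_sum_mem_of_convex hC (by simpa using hlt) fun i hi =>
    hV i (abs_add_mul_sub_le_of_mem_Ico_gridIndex hh hhρ ht hsr hr hi)

lemma deriv_mem_of_polygonPath_tendsto [l.NeBot] (hh : ∀ N, 0 < h N) (hh0 : Tendsto h l (𝓝 0))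
    (ht : Tendsto t l (𝓝 t₀))
    (hY : ∀ s, Tendsto (fun N => polygonPath (t N) (h N) (y N) (V N) s) l (𝓝 (Y s)))
    {C : Set E} (hC : Convex ℝ C) (hCc : IsClosed C) {s ρ : ℝ} (hs : t₀ < s) (hρ : 0 < ρ)
    (hmem : ∀ᶠ N in l, ∀ i : ℕ, |t N + i * h N - s| ≤ ρ → V N i ∈ C)
    (hd : DifferentiableAt ℝ Y s) : deriv Y s ∈ C := by
  have hslope : Tendsto (slope Y s) (𝓝[>] s) (𝓝 (deriv Y s)) :=
    (hasDerivAt_iff_tendsto_slope.1 hd.hasDerivAt).mono_left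
      (nhdsWithin_mono _ fun x hx => ne_of_gt hx)
  refine hCc.mem_of_tendsto hslope ?_
  filter_upwards [Ioo_mem_nhdsGT (lt_add_of_pos_right s hρ)] with r hr
  have hrs : 0 < r - s := sub_pos.2 hr.1
  have hgrid : Tendsto (fun N => h N * gridIndex (t N) (h N) r - h N * gridIndex (t N) (h N) s) l
      (𝓝 (r - s)) := by
    simpa using (tendsto_mul_gridIndex hh hh0 ht (hs.trans hr.1)).sub
      (tendsto_mul_gridIndex hh hh0 ht hs)
  have hlim : Tendsto (fun N => (h N * gridIndex (t N) (h N) r - h N * gridIndex (t N) (h N) s)⁻¹ •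
      (polygonPath (t N) (h N) (y N) (V N) r - polygonPath (t N) (h N) (y N) (V N) s)) l
      (𝓝 (slope Y s r)) := by
    rw [slope_def_module]
    exact (hgrid.inv₀ hrs.ne').smul ((hY r).sub (hY s))
  refine hCc.mem_of_tendsto hlim ?_
  filter_upwards [hmem, hgrid.eventually_const_lt hrs, hh0.eventually_lt_const hρ,
    ht.eventually_lt_const hs] with N hmemN hgridN hhN htN
  have hlt : gridIndex (t N) (h N) s < gridIndex (t N) (h N) r := by
    rw [← mul_sub, mul_pos_iff_of_pos_left (hh N), sub_pos] at hgridN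
    exact_mod_cast hgridN
  exact inv_smul_polygonPath_sub_mem hC (hh N) hhN.le htN.le hr.1.le hr.2.le hlt hmemN

lemma exists_polygonPath_tendsto [ProperSpace E] (U : Ultrafilter ι) {b : ℝ} (hh : ∀ N, 0 < h N)
    (hhb : ∀ N, h N ≤ b) (htb : ∀ N, |t N| ≤ b) (hyb : ∀ N, ‖y N‖ ≤ b) (hV : ∀ N i, ‖V N i‖ ≤ M)
    (s : ℝ) : ∃ Y : E, Tendsto (fun N => polygonPath (t N) (h N) (y N) (V N) s) U (𝓝 Y) := by
  have hmem : ∀ N, polygonPath (t N) (h N) (y N) (V N) s ∈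
      Metric.closedBall 0 (M * (|s| + b + b) + b) := fun N =>
    mem_closedBall_zero_iff.2 (norm_polygonPath_le (hh N) (hhb N) (htb N) (hyb N) (hV N) s)
  obtain ⟨Y, -, hY⟩ := (isCompact_closedBall (0 : E) _).ultrafilter_le_nhds'
    (U.map fun N => polygonPath (t N) (h N) (y N) (V N) s)
    (Ultrafilter.mem_map.2 (Filter.univ_mem' hmem))
  exact ⟨Y, hY⟩

end PolygonLimit

/-! ### Inf-convolutions of a supersolution -/

section QuadPenalty

variable {d : ℕ} {ε t s : ℝ} {x z : Vec d}

/-- The quadratic penalty of the inf-convolution with parameter `ε`. -/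
noncomputable def quadPenalty (ε t : ℝ) (x : Vec d) (s : ℝ) (z : Vec d) : ℝ :=
  (‖z - x‖ ^ 2 + (s - t) ^ 2) / (2 * ε)

lemma quadPenalty_nonneg (hε : 0 < ε) : 0 ≤ quadPenalty ε t x s z := by
  unfold quadPenalty
  positivity

lemma quadPenalty_self : quadPenalty ε t x t x = 0 := by simp [quadPenalty]

lemma norm_sub_sq_le_quadPenalty (hε : 0 < ε) : ‖z - x‖ ^ 2 ≤ quadPenalty ε t x s z * (2 * ε) := by
  rw [quadPenalty, div_mul_cancel₀ _ (by positivity)]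
  linarith [sq_nonneg (s - t)]

lemma sq_sub_le_quadPenalty (hε : 0 < ε) : (s - t) ^ 2 ≤ quadPenalty ε t x s z * (2 * ε) := by
  rw [quadPenalty, div_mul_cancel₀ _ (by positivity)]
  linarith [sq_nonneg ‖z - x‖]

lemma contDiff_quadPenalty :
    ContDiff ℝ 1 fun w : ℝ × Vec d => quadPenalty ε t x w.1 w.2 :=
  (((contDiff_snd.sub contDiff_const).norm_sq ℝ).add
    ((contDiff_fst.sub contDiff_const).pow 2)).div_const _

lemma hasDerivAt_quadPenalty : HasDerivAt (fun r => quadPenalty ε t x r z) ((s - t) / ε) s := by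
  have hsq : HasDerivAt (fun r : ℝ => (r - t) ^ 2) (2 * (s - t)) s := by
    simpa using ((hasDerivAt_id s).sub_const t).fun_pow 2
  rw [← mul_div_mul_left (s - t) ε two_ne_zero]
  exact (hsq.const_add _).div_const (2 * ε)

lemma hasGradientAt_quadPenalty :
    HasGradientAt (quadPenalty ε t x s) (ε⁻¹ • (z - x)) z := by
  have hsq : HasFDerivAt (fun y : Vec d => ‖y - x‖ ^ 2) (2 • innerSL ℝ (z - x)) z := by
    simpa [Function.comp_def] using
      (hasStrictFDerivAt_norm_sq (z - x)).hasFDerivAt.comp z ((hasFDerivAt_id z).sub_const x)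
  have hscaled := (hsq.add_const ((s - t) ^ 2)).mul_const (2 * ε)⁻¹
  simp only [← div_eq_mul_inv] at hscaled
  refine hasGradientAt_iff_hasFDerivAt.2 (hscaled.congr_fderiv ?_)
  ext v
  simp
  field_simp

lemma quadPenalty_add (hε : ε ≠ 0) (h : ℝ) (v : Vec d) :
    quadPenalty ε (t + h) (x + h • v) s z = quadPenalty ε t x s z
      - h * ((s - t) / ε + inner ℝ (z - x) v / ε) + h * (h * (‖v‖ ^ 2 + 1) / (2 * ε)) := by
  have hsq : ‖z - (x + h • v)‖ ^ 2 =
      ‖z - x‖ ^ 2 - 2 * h * inner ℝ (z - x) v + h ^ 2 * ‖v‖ ^ 2 := by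
    rw [← sub_sub, norm_sub_sq_real, real_inner_smul_right, norm_smul, mul_pow, Real.norm_eq_abs,
      sq_abs]
    ring
  rw [quadPenalty, quadPenalty, hsq]
  field_simp
  ring

lemma quadPenalty_add_le {v : Vec d} {M η c h : ℝ} (hε : 0 < ε) (hv : ‖v‖ ≤ M)
    (hc : -(η / 2) ≤ (s - t) / ε + inner ℝ (z - x) v / ε - c)
    (hh : h ∈ Ioc 0 (ε * η / (M ^ 2 + 1))) :
    quadPenalty ε (t + h) (x + h • v) s z ≤ quadPenalty ε t x s z - h * c + h * η := by
  have hquad : h * (‖v‖ ^ 2 + 1) / (2 * ε) ≤ η / 2 := by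
    have hle : h * (M ^ 2 + 1) ≤ ε * η := (le_div_iff₀ (by positivity)).1 hh.2
    have hvM : h * (‖v‖ ^ 2 + 1) ≤ h * (M ^ 2 + 1) := by have := hh.1; gcongr
    rw [div_le_iff₀ (by positivity)]
    linarith
  rw [quadPenalty_add hε.ne']
  linarith [mul_le_mul_of_nonneg_left hquad hh.1.le, mul_le_mul_of_nonneg_left hc hh.1.le]

end QuadPenalty

lemma ControlProblem.exists_control_of_nonneg_add_hamiltonian {d n : ℕ} {S : ControlProblem d n}
    {B : Set (Vec n)} {x p : Vec d} {τ η : ℝ} (hη : 0 < η)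
    (h : 0 ≤ (τ : EReal) + S.hamiltonian B x p) :
    ∃ α ∈ B, -η ≤ τ - inner ℝ p (S.f x α) - S.ℓ x α := by
  have hlt : ((-τ - η : ℝ) : EReal) < S.hamiltonian B x p := by
    by_contra! hle
    have hneg : (0 : EReal) ≤ (τ : EReal) + ((-τ - η : ℝ) : EReal) :=
      h.trans (by gcongr)
    rw [← EReal.coe_add] at hneg
    linarith [EReal.coe_nonneg.1 hneg]
  obtain ⟨α, hα⟩ := lt_iSup_iff.1 hlt
  obtain ⟨hαB, hα⟩ := lt_iSup_iff.1 hα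
  exact ⟨α, hαB, by linarith [EReal.coe_lt_coe_iff.1 hα]⟩

section InfConv

variable {d n : ℕ} {S : ControlProblem d n} {T a R ε t b : ℝ} {x : Vec d} {u : ℝ → Vec d → ℝ}

/-- The inf-convolution of `u` with parameter `ε`, taken over `[a, T] × B(0, R)`, is at most `b` at
`(t, x)`. -/
def InfConvLE (u : ℝ → Vec d → ℝ) (a T R ε t : ℝ) (x : Vec d) (b : ℝ) : Prop :=
  ∃ w ∈ Icc a T ×ˢ Metric.closedBall (0 : Vec d) R, u w.1 w.2 + quadPenalty ε t x w.1 w.2 ≤ b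

lemma isCompact_Icc_prod_closedBall : IsCompact (Icc a T ×ˢ Metric.closedBall (0 : Vec d) R) :=
  isCompact_Icc.prod (isCompact_closedBall _ _)

lemma Icc_prod_subset_Ioc_prod_univ (ha : 0 < a) {s : Set (Vec d)} :
    Icc a T ×ˢ s ⊆ Ioc 0 T ×ˢ univ :=
  prod_mono (Icc_subset_Ioc ha le_rfl) (subset_univ s)

lemma exists_lowerBound_of_lowerSemicontinuousOn (ha : 0 < a)
    (hu : LowerSemicontinuousOn (fun z : ℝ × Vec d => u z.1 z.2) (Ioc 0 T ×ˢ univ)) :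
    ∃ m : ℝ, ∀ w ∈ Icc a T ×ˢ Metric.closedBall (0 : Vec d) R, m ≤ u w.1 w.2 :=
  (hu.mono (Icc_prod_subset_Ioc_prod_univ ha)).bddBelow_of_isCompact
    isCompact_Icc_prod_closedBall |>.imp fun _ hm _ hw => hm (mem_image_of_mem _ hw)

lemma InfConvLE.exists_isMinOn (ha : 0 < a)
    (hu : LowerSemicontinuousOn (fun z : ℝ × Vec d => u z.1 z.2) (Ioc 0 T ×ˢ univ))
    (h : InfConvLE u a T R ε t x b) :
    ∃ w ∈ Icc a T ×ˢ Metric.closedBall (0 : Vec d) R,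
      u w.1 w.2 + quadPenalty ε t x w.1 w.2 ≤ b ∧
      IsMinOn (fun w => u w.1 w.2 + quadPenalty ε t x w.1 w.2)
        (Icc a T ×ˢ Metric.closedBall (0 : Vec d) R) w := by
  obtain ⟨w₀, hw₀, hb⟩ := h
  have hlsc := (hu.mono (Icc_prod_subset_Ioc_prod_univ ha)).add
    ((contDiff_quadPenalty (ε := ε) (t := t) (x := x)).continuous.lowerSemicontinuous
      |>.lowerSemicontinuousOn (Icc a T ×ˢ Metric.closedBall (0 : Vec d) R))
  obtain ⟨w, hw, hmin⟩ := hlsc.exists_isMinOn ⟨w₀, hw₀⟩ isCompact_Icc_prod_closedBall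
  exact ⟨w, hw, (hmin hw₀).trans hb, hmin⟩

lemma exists_quadPenalty_localizing (ha : 0 < a)
    (hu : LowerSemicontinuousOn (fun z : ℝ × Vec d => u z.1 z.2) (Ioc 0 T ×ˢ univ)) (B : ℝ) {ρ : ℝ}
    (hρ : 0 < ρ) :
    ∃ ε > 0, ∀ t x, ∀ w ∈ Icc a T ×ˢ Metric.closedBall (0 : Vec d) R,
      u w.1 w.2 + quadPenalty ε t x w.1 w.2 ≤ B → |w.1 - t| < ρ ∧ ‖w.2 - x‖ < ρ := by
  obtain ⟨m, hm⟩ := exists_lowerBound_of_lowerSemicontinuousOn (R := R) ha hu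
  let ε : ℝ := ρ ^ 2 / (2 * (|B - m| + 1))
  have hε : 0 < ε := by positivity
  have hερ : |B - m| * (2 * ε) < ρ ^ 2 := by
    calc |B - m| * (2 * ε) < (|B - m| + 1) * (2 * ε) := by gcongr; linarith
      _ = ρ ^ 2 := by simp only [ε]; field_simp
  refine ⟨ε, hε, fun t x w hw hB => ?_⟩
  have hpen : quadPenalty ε t x w.1 w.2 * (2 * ε) < ρ ^ 2 := by
    refine lt_of_le_of_lt ?_ hερ
    gcongr
    linarith [hm w hw, le_abs_self (B - m)]
  exact ⟨abs_lt_of_sq_lt_sq ((sq_sub_le_quadPenalty hε).trans_lt hpen) hρ.le,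
    lt_of_pow_lt_pow_left₀ 2 hρ.le ((norm_sub_sq_le_quadPenalty hε).trans_lt hpen)⟩

lemma exists_control_of_isMinOn_add_quadPenalty (hsup : IsSupersolution T S.HamF u) (ha : 0 < a)
    {s : ℝ} {z : Vec d} (hs : s ∈ Ioo a T) (hz : ‖z‖ < R)
    (hmin : IsMinOn (fun w : ℝ × Vec d => u w.1 w.2 + quadPenalty ε t x w.1 w.2)
      (Icc a T ×ˢ Metric.closedBall (0 : Vec d) R) (s, z)) {η : ℝ} (hη : 0 < η) :
    ∃ α ∈ S.A, -η ≤ (s - t) / ε + inner ℝ (z - x) (S.f z α) / ε - S.ℓ z α := by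
  have hnhds : Icc a T ×ˢ Metric.closedBall (0 : Vec d) R ∈ 𝓝 (s, z) :=
    prod_mem_nhds (Icc_mem_nhds hs.1 hs.2) (Metric.closedBall_mem_nhds_of_mem (by simpa using hz))
  have hloc : IsLocalMin (fun w : ℝ × Vec d => u w.1 w.2 - -quadPenalty ε t x w.1 w.2) (s, z) := by
    simpa only [sub_neg_eq_add] using hmin.isLocalMin hnhds
  have hHam := hsup.2 s ⟨ha.trans hs.1, hs.2⟩ z (fun w => -quadPenalty ε t x w.1 w.2)
    contDiff_quadPenalty.neg.contDiffOn hloc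
  have hgrad : gradient (fun y => -quadPenalty ε t x s y) z = -(ε⁻¹ • (z - x)) := by
    refine HasGradientAt.gradient ?_
    rw [hasGradientAt_iff_hasFDerivAt, map_neg]
    exact hasGradientAt_quadPenalty.hasFDerivAt.neg
  rw [hasDerivAt_quadPenalty.fun_neg.deriv, neg_neg, hgrad] at hHam
  obtain ⟨α, hα, hle⟩ := S.exists_control_of_nonneg_add_hamiltonian hη hHam
  refine ⟨α, hα, ?_⟩
  rw [inner_neg_left, real_inner_smul_left, inv_mul_eq_div] at hle
  linarith

/-- With parameter `ε`, steps of length at most `h₀` and tolerance `η`, the inf-convolution over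
`[a / 2, T] × B(0, R + 1)` is realised near the points of `[a, T - η] × B(0, R)` where it is at most
`B`, and some velocity taken near each such point makes it decrease at the rate of its cost. -/
def InfConvStep (S : ControlProblem d n) (u : ℝ → Vec d → ℝ) (a T R B η ε h₀ : ℝ) : Prop :=
  ∀ t ∈ Icc a (T - η), ∀ x : Vec d, ‖x‖ ≤ R → ∀ b ≤ B, InfConvLE u (a / 2) T (R + 1) ε t x b →
    (∃ s ∈ Icc (a / 2) T, ∃ z : Vec d, |s - t| ≤ η ∧ ‖z - x‖ ≤ η ∧ u s z ≤ b) ∧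
    ∃ z : Vec d, ∃ α ∈ S.A, ‖z - x‖ ≤ η ∧ ∀ h ∈ Ioc 0 h₀,
      InfConvLE u (a / 2) T (R + 1) ε (t + h) (x + h • S.f z α) (b - h * S.ℓ z α + h * η)

lemma exists_infConvStep (hsup : IsSupersolution T S.HamF u) {M B η : ℝ} (ha : 0 < a)
    (hη : 0 < η) (hM : ∀ z : Vec d, ‖z‖ ≤ R + 1 → ∀ α ∈ S.A, ‖S.f z α‖ ≤ M) :
    ∃ ε > 0, ∃ h₀ > 0, InfConvStep S u a T R B η ε h₀ := by
  let ρ : ℝ := min (min η (a / 2)) 1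
  have hρη : ρ ≤ η := (min_le_left _ _).trans (min_le_left _ _)
  have hρa : ρ ≤ a / 2 := (min_le_left _ _).trans (min_le_right _ _)
  have hρ1 : ρ ≤ 1 := min_le_right _ _
  obtain ⟨ε, hε, hnear⟩ := exists_quadPenalty_localizing (R := R + 1) (half_pos ha) hsup.1 B
    (ρ := ρ) (by positivity)
  refine ⟨ε, hε, ε * η / (M ^ 2 + 1), by positivity, fun t ht x hx b hb hInf => ?_⟩
  obtain ⟨⟨s, z⟩, hw, hval, hmin⟩ := hInf.exists_isMinOn (half_pos ha) hsup.1
  obtain ⟨hst, hzx⟩ := hnear t x (s, z) hw (hval.trans hb)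
  dsimp only at hval hst hzx
  have hs : s ∈ Ioo (a / 2) T := by
    constructor <;> linarith [abs_lt.1 hst, ht.1, ht.2]
  have hz : ‖z‖ < R + 1 := by linarith [norm_le_norm_add_norm_sub' z x]
  refine ⟨⟨s, hw.1, z, by linarith, by linarith, ?_⟩, ?_⟩
  · linarith [quadPenalty_nonneg (t := t) (x := x) (s := s) (z := z) hε]
  obtain ⟨α, hα, hαη⟩ :=
    exists_control_of_isMinOn_add_quadPenalty hsup (half_pos ha) hs hz hmin (half_pos hη)
  refine ⟨z, α, hα, by linarith, fun h hh => ⟨(s, z), hw, ?_⟩⟩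
  linarith [quadPenalty_add_le hε (hM z hz.le α hα) hαη hh]

end InfConv

/-! ### Euler polygons of the augmented dynamics -/

namespace ControlProblem

variable {d n : ℕ} {P : MultiDomain d} {S : ControlProblem d n} {cl lam : ℝ} {x : Vec d} {α : Vec n}

/-- The velocity of the augmented system, in which the second component accumulates minus the
cost. -/
def augVelocity (S : ControlProblem d n) (z : Vec d) (α : Vec n) : Vec d × ℝ := (S.f z α, -S.ℓ z α)

lemma HF.nonempty_A (hF : S.HF P) : S.A.Nonempty := (hF.nonempty 0).of_image

lemma HL.ℓ_nonneg (hL : S.HL P cl lam) (hα : α ∈ S.A) : 0 ≤ S.ℓ x α :=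
  (hL.growth x _ (mem_image_of_mem _ hα)).1

lemma HL.ℓ_le (hL : S.HL P cl lam) (hα : α ∈ S.A) : S.ℓ x α ≤ cl * (1 + ‖x‖ ^ lam) :=
  (hL.growth x _ (mem_image_of_mem _ hα)).2

lemma HL.augVelocity_mem (hL : S.HL P cl lam) (hα : α ∈ S.A) :
    S.augVelocity x α ∈ S.G cl lam x :=
  ⟨α, hα, 0, le_rfl, sub_nonneg.2 (hL.ℓ_le hα), by rw [sub_zero, augVelocity]⟩

lemma HL.norm_augVelocity_le (hL : S.HL P cl lam) {M r : ℝ} (hf : ‖S.f x α‖ ≤ M) (hα : α ∈ S.A)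
    (hx : ‖x‖ ≤ r) : ‖S.augVelocity x α‖ ≤ max M (cl * (1 + r ^ lam)) := by
  refine norm_prod_le_iff.2 ⟨le_max_of_le_left hf, le_max_of_le_right ?_⟩
  have hcl := hL.cl_pos
  have hlam : 0 ≤ lam := zero_le_one.trans hL.one_le_lam
  rw [augVelocity, norm_neg, Real.norm_of_nonneg (hL.ℓ_nonneg hα)]
  exact (hL.ℓ_le hα).trans (by gcongr)

end ControlProblem

lemma eventually_subset_thickening_of_upperHemicontinuous {X E : Type*} [TopologicalSpace X]
    [PseudoMetricSpace E] {Φ : X → Set E} (h : UpperHemicontinuous Φ) (x : X) {ε : ℝ} (hε : 0 < ε) :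
    ∀ᶠ z in 𝓝 x, Φ z ⊆ Metric.thickening ε (Φ x) :=
  (h x _ (Metric.isOpen_thickening.mem_nhdsSet.2 (Metric.self_subset_thickening hε (Φ x)))).mono
    fun _ hz => subset_of_mem_nhdsSet hz

lemma norm_add_smul_add_two_le {E : Type*} [NormedAddCommGroup E] [NormedSpace ℝ E] {p v : E}
    {C c h : ℝ} {i : ℕ} (hh : 0 ≤ h) (hv : ‖v‖ ≤ c * (2 + ‖p‖))
    (hp : ‖p‖ + 2 ≤ C * Real.exp (c * (i * h))) :
    ‖p + h • v‖ + 2 ≤ C * Real.exp (c * ((i + 1 : ℕ) * h)) := by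
  have hexp : Real.exp (c * ((i + 1 : ℕ) * h)) = Real.exp (c * (i * h)) * Real.exp (c * h) := by
    rw [← Real.exp_add]
    push_cast
    ring_nf
  calc ‖p + h • v‖ + 2 ≤ ‖p‖ + h * (c * (2 + ‖p‖)) + 2 := by
        grw [norm_add_le, norm_smul, Real.norm_of_nonneg hh, hv]
    _ = (‖p‖ + 2) * (c * h + 1) := by ring
    _ ≤ (‖p‖ + 2) * Real.exp (c * h) := by gcongr; exact Real.add_one_le_exp _
    _ ≤ C * Real.exp (c * (i * h)) * Real.exp (c * h) := by gcongr
    _ = _ := by rw [hexp, mul_assoc]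

section Euler

variable {d n : ℕ} {P : MultiDomain d} {S : ControlProblem d n} {T cl lam cf C ε h h₀ η t b : ℝ}
  {u : ℝ → Vec d → ℝ}

/-- The invariant of the Euler scheme started at time `t`: after `i` steps of length `h`, the state
`p.1` obeys the Gronwall bound, the accumulated cost `-p.2` is nonnegative, and the inf-convolution
of `u` plus the cost exceeds the initial value `b` by at most `i h η`. -/
structure EulerInvariant (u : ℝ → Vec d → ℝ) (T cf C ε h η t b : ℝ) (i : ℕ) (p : Vec d × ℝ) :
    Prop where
  norm_le : ‖p.1‖ + 2 ≤ C * Real.exp (cf * (i * h))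
  cost_nonpos : p.2 ≤ 0
  infConvLE : InfConvLE u (t / 2) T (C * Real.exp (cf * T) + 1) ε (t + i * h) p.1
    (b + p.2 + i * h * η)

lemma EulerInvariant.norm_le_exp_mul {i : ℕ} {p : Vec d × ℝ}
    (hp : EulerInvariant u T cf C ε h η t b i p) (hC : 0 ≤ C) (hcf : 0 < cf) (hi : i * h ≤ T) :
    ‖p.1‖ ≤ C * Real.exp (cf * T) := by
  have hexp : C * Real.exp (cf * (i * h)) ≤ C * Real.exp (cf * T) := by gcongr
  linarith [hp.norm_le]

lemma EulerInvariant.exists_step {i : ℕ} {p : Vec d × ℝ}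
    (hp : EulerInvariant u T cf C ε h η t b i p) (hL : S.HL P cl lam) (hcf : 0 < cf)
    (hf : ∀ x, ∀ α ∈ S.A, ‖S.f x α‖ ≤ cf * (1 + ‖x‖))
    (hstep : InfConvStep S u t T (C * Real.exp (cf * T)) (b + T * η) η ε h₀) (hC : 0 ≤ C)
    (ht : 0 ≤ t) (hη : η ∈ Ioc 0 1) (hh : h ∈ Ioc 0 h₀) (hi : t + i * h ≤ T - η) :
    ∃ z : Vec d, ∃ α ∈ S.A, ‖z - p.1‖ ≤ η ∧
      EulerInvariant u T cf C ε h η t b (i + 1) (p + h • S.augVelocity z α) := by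
  have hη0 := hη.1
  have hh0 := hh.1
  have hih : 0 ≤ i * h := by positivity
  have hihη : i * h * η ≤ T * η := by gcongr; linarith
  obtain ⟨-, z, α, hα, hz, hdec⟩ := hstep (t + i * h) ⟨by linarith, hi⟩ p.1
    (hp.norm_le_exp_mul hC hcf (by linarith)) (b + p.2 + i * h * η) (by linarith [hp.cost_nonpos])
    hp.infConvLE
  have hnorm : 1 + ‖z‖ ≤ 2 + ‖p.1‖ := by linarith [norm_le_norm_add_norm_sub' z p.1, hη.2]
  have hspeed : ‖S.f z α‖ ≤ cf * (2 + ‖p.1‖) :=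
    (hf z α hα).trans (mul_le_mul_of_nonneg_left hnorm hcf.le)
  refine ⟨z, α, hα, hz, norm_add_smul_add_two_le hh.1.le hspeed hp.norm_le, ?_, ?_⟩
  · have hcost : 0 ≤ h * S.ℓ z α := mul_nonneg hh.1.le (hL.ℓ_nonneg hα)
    simp only [ControlProblem.augVelocity, Prod.snd_add, Prod.smul_snd, smul_eq_mul]
    linarith [hp.cost_nonpos]
  · convert hdec h hh using 1
    · push_cast; ring
    · rfl
    · simp only [ControlProblem.augVelocity, Prod.snd_add, Prod.smul_snd, smul_eq_mul]
      push_cast; ring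

/-- The polygon with step `h` and velocities `V`, started at `(x, 0)` at time `t`, is an Euler
polygon of the augmented dynamics with tolerance `η`, and `u` plus the cost does not increase along
it, up to the tolerance. -/
structure IsEulerPolygon (S : ControlProblem d n) (cl lam T : ℝ) (u : ℝ → Vec d → ℝ)
    (M η t h : ℝ) (x : Vec d) (V : ℕ → Vec d × ℝ) : Prop where
  step_pos : 0 < h
  step_le : h ≤ η
  norm_le : ∀ i, ‖V i‖ ≤ M
  velocity_mem : ∀ i : ℕ, t + i * h ≤ T - η →
    ∃ z, dist z (polygon (x, (0 : ℝ)) h V i).1 ≤ η ∧ V i ∈ S.G cl lam z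
  value_le : ∀ i : ℕ, t + i * h ≤ T - η → ∃ w : ℝ × Vec d, w.1 ∈ Ioc 0 T ∧
    dist w.1 (t + i * h) ≤ η ∧ dist w.2 (polygon (x, (0 : ℝ)) h V i).1 ≤ η ∧
    u w.1 w.2 ≤ u t x + (polygon (x, (0 : ℝ)) h V i).2 + T * η

lemma EulerInvariant.zero {x : Vec d} (hC : ‖x‖ + 2 ≤ C) (hcf : 0 < cf) (ht : t ∈ Ioo 0 T) :
    EulerInvariant u T cf C ε h η t (u t x) 0 (x, 0) := by
  have hC0 : 0 ≤ C := by linarith [norm_nonneg x]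
  have hexp : C ≤ C * Real.exp (cf * T) :=
    le_mul_of_one_le_right hC0 (Real.one_le_exp (mul_nonneg hcf.le (ht.1.trans ht.2).le))
  exact ⟨by simpa using hC, le_rfl, (t, x), ⟨⟨by linarith [ht.1], ht.2.le⟩,
    mem_closedBall_zero_iff.2 (by linarith)⟩, by simp [quadPenalty_self]⟩

lemma exists_eulerInvariant_polygon {M : ℝ} {x : Vec d} (hL : S.HL P cl lam) (hcf : 0 < cf)
    (hf : ∀ x, ∀ α ∈ S.A, ‖S.f x α‖ ≤ cf * (1 + ‖x‖)) (hC : ‖x‖ + 2 ≤ C) (ht : t ∈ Ioo 0 T)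
    (hη : η ∈ Ioc 0 1) (hh : h ∈ Ioc 0 h₀)
    (hstep : InfConvStep S u t T (C * Real.exp (cf * T)) (u t x + T * η) η ε h₀)
    (hM : ∀ z : Vec d, ‖z‖ ≤ C * Real.exp (cf * T) + 1 → ∀ α ∈ S.A, ‖S.augVelocity z α‖ ≤ M)
    (hM0 : 0 ≤ M) :
    ∃ V, (∀ i, ‖V i‖ ≤ M) ∧ ∀ i : ℕ, t + i * h ≤ T - η →
      (∃ z, dist z (polygon (x, (0 : ℝ)) h V i).1 ≤ η ∧ V i ∈ S.G cl lam z) ∧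
      EulerInvariant u T cf C ε h η t (u t x) i (polygon (x, (0 : ℝ)) h V i) := by
  have hC0 : 0 ≤ C := by linarith [norm_nonneg x]
  have hh0 := hh.1
  let Inv : ℕ → Vec d × ℝ → Prop := EulerInvariant u T cf C ε h η t (u t x)
  have hexists : ∀ (i : ℕ) (p : Vec d × ℝ), ∃ v, ‖v‖ ≤ M ∧ (t + i * h ≤ T - η → Inv i p →
      (∃ z, dist z p.1 ≤ η ∧ v ∈ S.G cl lam z) ∧ Inv (i + 1) (p + h • v)) := by
    intro i p
    by_cases hgood : t + i * h ≤ T - η ∧ Inv i p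
    · obtain ⟨hi, hp⟩ := hgood
      obtain ⟨z, α, hα, hz, hnext⟩ := hp.exists_step hL hcf hf hstep hC0 ht.1.le hη hh hi
      have hzR : ‖z‖ ≤ C * Real.exp (cf * T) + 1 := by
        linarith [norm_le_norm_add_norm_sub' z p.1, hη.2, ht.1, hη.1,
          hp.norm_le_exp_mul hC0 hcf (by linarith [ht.1, hη.1])]
      exact ⟨S.augVelocity z α, hM z hzR α hα, fun _ _ =>
        ⟨⟨z, by rwa [dist_eq_norm], hL.augVelocity_mem hα⟩, hnext⟩⟩
    · exact ⟨0, by simpa using hM0, fun hi hp => absurd ⟨hi, hp⟩ hgood⟩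
  choose v hvM hv using hexists
  obtain ⟨V, hV⟩ := exists_forall_eq_polygon (x, (0 : ℝ)) h v
  have hinv : ∀ i : ℕ, t + i * h ≤ T - η → Inv i (polygon (x, (0 : ℝ)) h V i) := by
    intro i
    induction i with
    | zero =>
      intro _
      rw [polygon_zero]
      exact EulerInvariant.zero hC hcf ht
    | succ i ih =>
      intro hi
      have hi' : t + i * h ≤ T - η := by push_cast at hi; linarith
      rw [polygon_succ, hV]
      exact (hv i _ hi' (ih hi')).2
  exact ⟨V, fun i => hV i ▸ hvM i _, fun i hi => ⟨hV i ▸ (hv i _ hi (hinv i hi)).1, hinv i hi⟩⟩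

lemma EulerInvariant.exists_value_le {i : ℕ} {p : Vec d × ℝ}
    (hp : EulerInvariant u T cf C ε h η t b i p) (hC : 0 ≤ C) (hcf : 0 < cf) (ht : 0 < t)
    (hη : 0 < η) (hh : 0 < h)
    (hstep : InfConvStep S u t T (C * Real.exp (cf * T)) (b + T * η) η ε h₀)
    (hi : t + i * h ≤ T - η) :
    ∃ w : ℝ × Vec d, w.1 ∈ Ioc 0 T ∧ dist w.1 (t + i * h) ≤ η ∧ dist w.2 p.1 ≤ η ∧
      u w.1 w.2 ≤ b + p.2 + T * η := by
  have hih : 0 ≤ i * h := by positivity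
  have hihη : i * h * η ≤ T * η := by gcongr; linarith
  obtain ⟨⟨s, hs, z, hst, hz, hval⟩, -⟩ := hstep (t + i * h) ⟨by linarith, hi⟩ _
    (hp.norm_le_exp_mul hC hcf (by linarith)) _ (by linarith [hp.cost_nonpos]) hp.infConvLE
  exact ⟨(s, z), ⟨(half_pos ht).trans_le hs.1, hs.2⟩, by rwa [Real.dist_eq],
    by rwa [dist_eq_norm], by linarith⟩

lemma exists_isEulerPolygon (hF : S.HF P) (hL : S.HL P cl lam) (hsup : IsSupersolution T S.HamF u)
    {ρ : ℝ} (hρ : 0 ≤ ρ) :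
    ∃ M, ∀ η ∈ Ioc (0 : ℝ) 1, ∀ t ∈ Ioo 0 T, ∀ x : Vec d, ‖x‖ ≤ ρ →
      ∃ h V, IsEulerPolygon S cl lam T u M η t h x V := by
  obtain ⟨cf, hcf, hgrowth⟩ := hF.growth
  have hf : ∀ x, ∀ α ∈ S.A, ‖S.f x α‖ ≤ cf * (1 + ‖x‖) := fun x α hα =>
    hgrowth x _ (mem_image_of_mem _ hα)
  let R : ℝ := (ρ + 2) * Real.exp (cf * T)
  have hfR : ∀ z : Vec d, ‖z‖ ≤ R + 1 → ∀ α ∈ S.A, ‖S.f z α‖ ≤ cf * (1 + (R + 1)) :=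
    fun z hz α hα => (hf z α hα).trans (by gcongr)
  refine ⟨max (cf * (1 + (R + 1))) (cl * (1 + (R + 1) ^ lam)), fun η hη t ht x hx => ?_⟩
  obtain ⟨ε, -, h₀, hh₀, hstep⟩ :=
    exists_infConvStep (R := R) (B := u t x + T * η) hsup ht.1 hη.1 hfR
  have hh : min h₀ η ∈ Ioc 0 h₀ := ⟨lt_min hh₀ hη.1, min_le_left _ _⟩
  obtain ⟨V, hVM, hV⟩ := exists_eulerInvariant_polygon hL hcf hf (by linarith) ht hη hh hstep
    (fun z hz α hα => hL.norm_augVelocity_le (hfR z hz α hα) hα hz)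
    (le_max_of_le_left (by positivity))
  exact ⟨_, V, hh.1, min_le_right _ _, hVM, fun i hi => (hV i hi).1, fun i hi =>
    (hV i hi).2.exists_value_le (by linarith) hcf ht.1 hη.1 hh.1 hstep hi⟩

end Euler

/-! ### Limits of Euler polygons -/

lemma le_of_tendsto_of_lowerSemicontinuousWithinAt {X ι : Type*} [TopologicalSpace X]
    {l : Filter ι} [l.NeBot] {g : X → ℝ} {s : Set X} {x : X} {w : ι → X} {r : ι → ℝ} {c : ℝ}
    (hg : LowerSemicontinuousWithinAt g s x) (hw : Tendsto w l (𝓝[s] x)) (hr : Tendsto r l (𝓝 c))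
    (hle : ∀ᶠ N in l, g (w N) ≤ r N) : g x ≤ c := by
  refine le_of_forall_lt fun a ha => ?_
  obtain ⟨b, hab, hb⟩ := exists_between ha
  refine hab.trans_le (ge_of_tendsto hr ?_)
  filter_upwards [hw.eventually (hg b hb), hle] with N hN hNr
  exact hN.le.trans hNr

section LimitTrajectory

variable {d n : ℕ} {P : MultiDomain d} {S : ControlProblem d n} {T cl lam M t₀ u₀ s : ℝ}
  {u : ℝ → Vec d → ℝ} {ι : Type*} {l : Filter ι} {η t h : ι → ℝ} {x : ι → Vec d}
  {V : ι → ℕ → Vec d × ℝ} {Y : ℝ → Vec d × ℝ}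

lemma IsEulerPolygon.exists_dist_polygonPath_le {η t h : ℝ} {x : Vec d} {V : ℕ → Vec d × ℝ}
    (hE : IsEulerPolygon S cl lam T u M η t h x V) {i : ℕ} (hi : t + i * h ≤ T - η) (s : ℝ) :
    ∃ z, dist z (polygonPath t h (x, (0 : ℝ)) V s).1 ≤ η + M * (|t + i * h - s| + h) ∧
      V i ∈ S.G cl lam z := by
  obtain ⟨z, hz, hVz⟩ := hE.velocity_mem i hi
  refine ⟨z, (dist_triangle _ _ _).trans (add_le_add hz ?_), hVz⟩
  rw [← polygonPath_add_mul (t := t) hE.step_pos]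
  exact (le_max_left _ _).trans (dist_polygonPath_le hE.step_pos hE.norm_le _ s)

lemma eventually_velocity_mem_cthickening (hG : S.HG cl lam)
    (hE : ∀ N, IsEulerPolygon S cl lam T u M (η N) (t N) (h N) (x N) (V N))
    (hη : Tendsto η l (𝓝 0))
    (hY : Tendsto (fun N => polygonPath (t N) (h N) (x N, 0) (V N) s) l (𝓝 (Y s)))
    (hs : s < T) {ε : ℝ} (hε : 0 < ε) :
    ∃ ρ > 0, ∀ᶠ N in l, ∀ i : ℕ, |t N + i * h N - s| ≤ ρ →
      V N i ∈ Metric.cthickening ε (S.G cl lam (Y s).1) := by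
  obtain ⟨δ, hδ, hδG⟩ := Metric.eventually_nhds_iff.1
    (eventually_subset_thickening_of_upperHemicontinuous hG.usc (Y s).1 hε)
  let ρ : ℝ := min (δ / (4 * (|M| + 1))) ((T - s) / 2)
  have hρ : 0 < ρ := lt_min (by positivity) (half_pos (sub_pos.2 hs))
  have hρδ : |M| * (ρ + ρ) ≤ δ / 2 := by
    have hle : ρ ≤ δ / (4 * (|M| + 1)) := min_le_left _ _
    rw [le_div_iff₀ (by positivity)] at hle
    linarith
  refine ⟨ρ, hρ, ?_⟩
  filter_upwards [hY.eventually (Metric.ball_mem_nhds _ (by positivity : 0 < δ / 4)),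
    hη.eventually_lt_const (by positivity : 0 < δ / 4), hη.eventually_lt_const hρ,
    hη.eventually_lt_const (half_pos (sub_pos.2 hs))] with N hYN hηδ hηρ hηT i hi
  have hiT : t N + i * h N ≤ T - η N := by
    linarith [(abs_le.1 hi).2, min_le_right (δ / (4 * (|M| + 1))) ((T - s) / 2)]
  obtain ⟨z, hz, hVz⟩ := (hE N).exists_dist_polygonPath_le hiT s
  refine Metric.thickening_subset_cthickening _ _ (hδG ?_ hVz)
  have hM : 0 ≤ M := (norm_nonneg _).trans ((hE N).norm_le 0)
  calc dist z (Y s).1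
      ≤ η N + M * (|t N + i * h N - s| + h N) +
        dist (polygonPath (t N) (h N) (x N, (0 : ℝ)) (V N) s) (Y s) :=
        (dist_triangle _ _ _).trans (add_le_add hz (le_max_left _ _))
    _ ≤ η N + |M| * (ρ + ρ) + dist (polygonPath (t N) (h N) (x N, (0 : ℝ)) (V N) s) (Y s) := by
      rw [abs_of_nonneg hM]
      gcongr
      exact (hE N).step_le.trans hηρ.le
    _ < δ / 4 + δ / 2 + δ / 4 := by linarith [Metric.mem_ball.1 hYN]
    _ = δ := by ring

lemma deriv_mem_augmentedDynamics [l.NeBot] (hG : S.HG cl lam)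
    (hE : ∀ N, IsEulerPolygon S cl lam T u M (η N) (t N) (h N) (x N) (V N))
    (hη : Tendsto η l (𝓝 0)) (ht : Tendsto t l (𝓝 t₀))
    (hY : ∀ s, Tendsto (fun N => polygonPath (t N) (h N) (x N, 0) (V N) s) l (𝓝 (Y s)))
    (hs : s ∈ Ioo t₀ T) (hd : DifferentiableAt ℝ Y s) : deriv Y s ∈ S.G cl lam (Y s).1 := by
  have hh0 : Tendsto h l (𝓝 0) :=
    squeeze_zero (fun N => (hE N).step_pos.le) (fun N => (hE N).step_le) hη
  rw [← (hG.isCompact (Y s).1).isClosed.closure_eq, Metric.closure_eq_iInter_cthickening]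
  refine mem_iInter₂.2 fun ε hε => ?_
  obtain ⟨ρ, hρ, hmem⟩ := eventually_velocity_mem_cthickening hG hE hη (hY s) hs.2 hε
  exact deriv_mem_of_polygonPath_tendsto (fun N => (hE N).step_pos) hh0 ht hY
    ((hG.convex _).cthickening ε) Metric.isClosed_cthickening hs.1 hρ hmem hd

lemma value_le_of_polygonPath_tendsto [l.NeBot]
    (hlsc : LowerSemicontinuousOn (fun z : ℝ × Vec d => u z.1 z.2) (Ioc 0 T ×ˢ univ))
    (hE : ∀ N, IsEulerPolygon S cl lam T u M (η N) (t N) (h N) (x N) (V N))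
    (hη : Tendsto η l (𝓝 0)) (ht : Tendsto t l (𝓝 t₀)) (hu : ∀ N, u (t N) (x N) ≤ u₀ + η N)
    (hY : Tendsto (fun N => polygonPath (t N) (h N) (x N, 0) (V N) s) l (𝓝 (Y s)))
    (ht₀ : 0 ≤ t₀) (hs : s ∈ Ioo t₀ T) : u s (Y s).1 ≤ u₀ + (Y s).2 := by
  have hh0 : Tendsto h l (𝓝 0) :=
    squeeze_zero (fun N => (hE N).step_pos.le) (fun N => (hE N).step_le) hη
  let p : ι → Vec d × ℝ := fun N => polygonPath (t N) (h N) (x N, 0) (V N) s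
  let r : ι → ℝ := fun N => t N + gridIndex (t N) (h N) s * h N
  have hr : Tendsto r l (𝓝 s) := by
    simpa only [r, mul_comm, add_sub_cancel] using
      ht.add (tendsto_mul_gridIndex (fun N => (hE N).step_pos) hh0 ht hs.1)
  have hgrid : ∀ᶠ N in l, r N ≤ T - η N := by
    filter_upwards [ht.eventually_lt_const hs.1, hη.eventually_lt_const (sub_pos.2 hs.2)]
      with N htN hηN
    linarith [gridIndex_mul_le (hE N).step_pos htN.le]
  obtain ⟨w, hw⟩ := (hgrid.mono fun N hN => (hE N).value_le _ hN).choice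
  have hw_fst : Tendsto (fun N => (w N).1) l (𝓝 s) := hr.congr_dist <|
    squeeze_zero' (Eventually.of_forall fun _ => dist_nonneg)
      (hw.mono fun N hN => (dist_comm _ _).trans_le hN.2.1) hη
  have hw_snd : Tendsto (fun N => (w N).2) l (𝓝 (Y s).1) := hY.fst_nhds.congr_dist <|
    squeeze_zero' (Eventually.of_forall fun _ => dist_nonneg)
      (hw.mono fun N hN => (dist_comm _ _).trans_le hN.2.2.1) hη
  have hbound : Tendsto (fun N => u₀ + η N + (p N).2 + T * η N) l (𝓝 (u₀ + (Y s).2)) := by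
    simpa using ((hη.const_add u₀).add hY.snd_nhds).add (hη.const_mul T)
  refine le_of_tendsto_of_lowerSemicontinuousWithinAt (w := w)
    (hlsc (s, (Y s).1) ⟨⟨ht₀.trans_lt hs.1, hs.2.le⟩, mem_univ _⟩)
    (tendsto_nhdsWithin_iff.2 ⟨hw_fst.prodMk_nhds hw_snd, hw.mono fun N hN => ⟨hN.1, mem_univ _⟩⟩)
    hbound (hw.mono fun N hN => hN.2.2.2.trans ?_)
  simp only [p, polygonPath]
  gcongr
  exact hu N

lemma exists_limit_trajectory (hF : S.HF P) (hL : S.HL P cl lam) (hG : S.HG cl lam)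
    (hsup : IsSupersolution T S.HamF u) (ht₀ : 0 ≤ t₀) {x₀ : Vec d}
    (hstart : ∀ ε > 0, ∃ t x, 0 < t ∧ t ∈ Ico t₀ T ∧ t - t₀ ≤ ε ∧ ‖x - x₀‖ ≤ ε ∧
      u t x ≤ u₀ + ε) :
    ∃ (K : NNReal) (Y : ℝ → Vec d × ℝ), LipschitzWith K Y ∧ Y t₀ = (x₀, 0) ∧
      (∀ s ∈ Ioo t₀ T, DifferentiableAt ℝ Y s → deriv Y s ∈ S.G cl lam (Y s).1) ∧
      ∀ s ∈ Ioo t₀ T, u s (Y s).1 ≤ u₀ + (Y s).2 := by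
  let η : ℕ → ℝ := fun N => 1 / ((N : ℝ) + 1)
  have hη : ∀ N, η N ∈ Ioc 0 1 := fun N =>
    ⟨Nat.one_div_pos_of_nat, div_le_one_of_le₀ (by simp) (by positivity)⟩
  choose t x htpos ht htη hxη hu using fun N => hstart (η N) (hη N).1
  have hx : ∀ N, ‖x N‖ ≤ ‖x₀‖ + 1 := fun N => by
    linarith [norm_le_norm_add_norm_sub' (x N) x₀, hxη N, (hη N).2]
  obtain ⟨M, hM⟩ := exists_isEulerPolygon hF hL hsup (by positivity : 0 ≤ ‖x₀‖ + 1)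
  choose h V hE using fun N => hM (η N) (hη N) (t N) ⟨htpos N, (ht N).2⟩ (x N) (hx N)
  let U : Ultrafilter ℕ := hyperfilter ℕ
  have hηU : Tendsto η U (𝓝 0) :=
    tendsto_one_div_add_atTop_nhds_zero_nat.mono_left Nat.hyperfilter_le_atTop
  have htU : Tendsto t U (𝓝 t₀) := tendsto_iff_dist_tendsto_zero.2 <|
    squeeze_zero (fun _ => dist_nonneg)
      (fun N => by rw [Real.dist_eq, abs_of_nonneg (sub_nonneg.2 (ht N).1)]; exact htη N) hηU
  have hxU : Tendsto x U (𝓝 x₀) := tendsto_iff_norm_sub_tendsto_zero.2 <|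
    squeeze_zero (fun _ => norm_nonneg _) hxη hηU
  have hpath (s : ℝ) := exists_polygonPath_tendsto U (b := max (max 1 T) (‖x₀‖ + 1)) (s := s)
    (y := fun N => (x N, (0 : ℝ))) (fun N => (hE N).step_pos)
    (fun N => (hE N).step_le.trans ((hη N).2.trans (by simp)))
    (fun N => by rw [abs_of_pos (htpos N)]; exact (ht N).2.le.trans (by simp))
    (fun N => (norm_prod_le_iff.2 ⟨hx N, by rw [norm_zero]; positivity⟩).trans (le_max_right _ _))
    (fun N => (hE N).norm_le)
  choose Y hY using hpath
  have hh0 : Tendsto h U (𝓝 0) :=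
    squeeze_zero (fun N => (hE N).step_pos.le) (fun N => (hE N).step_le) hηU
  refine ⟨M.toNNReal, Y, lipschitzWith_of_polygonPath_tendsto (fun N => (hE N).step_pos) hh0
      (fun N => (hE N).norm_le) hY, tendsto_nhds_unique (hY t₀) ?_,
    fun s hs hd => deriv_mem_augmentedDynamics hG hE hηU htU hY hs hd,
    fun s hs => value_le_of_polygonPath_tendsto hsup.1 hE hηU htU hu (hY s) ht₀ hs⟩
  simp only [polygonPath_of_le (hE _).step_pos (ht _).1]
  exact hxU.prodMk_nhds tendsto_const_nhds

end LimitTrajectory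

/-! ### Super-optimality of supersolutions -/

section SuperOptimality

variable {d n : ℕ} {P : MultiDomain d} {S : ControlProblem d n} {T cl lam t₀ u₀ : ℝ}
  {u : ℝ → Vec d → ℝ} {K : NNReal} {Y : ℝ → Vec d × ℝ} {α : ℝ → S.A}

lemma exists_control_of_deriv_mem (hS : S.Regular) (hA : S.A.Nonempty) (hY : Continuous Y)
    (hd : ∀ᵐ s ∂volume.restrict (Ioo t₀ T), deriv Y s ∈ S.G cl lam (Y s).1) :
    ∃ α : ℝ → S.A, Measurable α ∧ ∀ᵐ s ∂volume.restrict (Ioo t₀ T),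
      S.f (Y s).1 (α s) = (deriv Y s).1 ∧ S.ℓ (Y s).1 (α s) ≤ -(deriv Y s).2 := by
  have : StandardBorelSpace S.A := hS.isCompact_A.isClosed.measurableSet.standardBorel
  have : Nonempty S.A := hA.to_subtype
  have hd_meas : Measurable fun z : ℝ × S.A => deriv Y z.1 :=
    (measurable_deriv Y).comp measurable_fst
  have hpair : Measurable fun z : ℝ × S.A => ((Y z.1).1, z.2) :=
    ((measurable_fst.comp hY.measurable).comp measurable_fst).prodMk measurable_snd
  have hB : MeasurableSet {z : ℝ × S.A | S.f (Y z.1).1 z.2 = (deriv Y z.1).1 ∧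
      S.ℓ (Y z.1).1 z.2 ≤ -(deriv Y z.1).2} :=
    (measurableSet_eq_fun (hS.measurable_f.comp hpair) hd_meas.fst).inter
      (measurableSet_le (hS.measurable_ℓ.comp hpair) hd_meas.snd.neg)
  obtain ⟨g, hg, hgB⟩ := exists_aemeasurable_selection (volume.restrict (Ioo t₀ T)) hB (by
    filter_upwards [hd] with s ⟨a, ha, r, hr, _, heq⟩
    exact ⟨⟨a, ha⟩, by simp [heq], by simp [heq, hr]⟩)
  refine ⟨hg.mk, hg.measurable_mk, ?_⟩
  filter_upwards [hgB, hg.ae_eq_mk] with s hs heq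
  rwa [← heq]

lemma ae_restrict_uIoc_of_ae_restrict_Ioo {p : ℝ → Prop} {s : ℝ}
    (hp : ∀ᵐ r ∂volume.restrict (Ioo t₀ T), p r) (hs : s ∈ Icc t₀ T) :
    ∀ᵐ r ∂volume.restrict (uIoc t₀ s), p r := by
  rw [uIoc_of_le hs.1, ← restrict_Ioo_eq_restrict_Ioc]
  exact ae_restrict_of_ae_restrict_of_subset (Ioo_subset_Ioo_right hs.2) hp

lemma isTrajectory_of_deriv_fst_eq (hY : LipschitzWith K Y) (hT : t₀ ≤ T) (hα : Measurable α)
    (hd : ∀ᵐ s ∂volume.restrict (Ioo t₀ T), S.f (Y s).1 (α s) = (deriv Y s).1) :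
    S.IsTrajectory T t₀ (Y t₀).1 (fun s => (Y s).1) (fun s => α s) := by
  let φ := ContinuousLinearMap.fst ℝ (Vec d) ℝ
  have hderiv (s : ℝ) := intervalIntegrable_deriv_of_lipschitzWith hY t₀ s
  have hcongr := fun s (hs : s ∈ Icc t₀ T) => ae_restrict_uIoc_of_ae_restrict_Ioo hd hs
  refine ⟨⟨(measurable_subtype_coe.comp hα).aemeasurable, Eventually.of_forall fun s => (α s).2⟩,
    ?_, fun s hs => ?_⟩
  · exact (show IntervalIntegrable (fun s => φ (deriv Y s)) volume t₀ T from
      ⟨φ.integrable_comp (hderiv T).1, φ.integrable_comp (hderiv T).2⟩).congr_ae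
      ((hcongr T ⟨hT, le_rfl⟩).mono fun r hr => hr.symm)
  · rw [intervalIntegral.integral_congr_ae_restrict (hcongr s hs)]
    have hint := φ.intervalIntegral_comp_comm (hderiv s)
    rw [intervalIntegral_deriv_of_lipschitzWith hY] at hint
    exact eq_add_of_sub_eq' hint.symm

lemma intervalIntegrable_cost (hY : LipschitzWith K Y) (hS : S.Regular) (hL : S.HL P cl lam)
    (hα : Measurable α)
    (hd : ∀ᵐ s ∂volume.restrict (Ioo t₀ T), S.ℓ (Y s).1 (α s) ≤ -(deriv Y s).2) {s : ℝ}
    (hs : s ∈ Icc t₀ T) : IntervalIntegrable (fun r => S.ℓ (Y r).1 (α r)) volume t₀ s := by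
  refine (intervalIntegrable_deriv_of_lipschitzWith hY t₀ s).mono_fun
    (hS.measurable_ℓ.comp (hY.continuous.measurable.fst.prodMk hα)).aestronglyMeasurable ?_
  filter_upwards [ae_restrict_uIoc_of_ae_restrict_Ioo hd hs] with r hr
  rw [Real.norm_of_nonneg (hL.ℓ_nonneg (α r).2)]
  exact hr.trans ((neg_le_abs _).trans (norm_snd_le (deriv Y r)))

lemma integral_cost_le (hY : LipschitzWith K Y) (hS : S.Regular) (hL : S.HL P cl lam)
    (hα : Measurable α)
    (hd : ∀ᵐ s ∂volume.restrict (Ioo t₀ T), S.ℓ (Y s).1 (α s) ≤ -(deriv Y s).2) {s : ℝ}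
    (hs : s ∈ Icc t₀ T) : ∫ r in t₀..s, S.ℓ (Y r).1 (α r) ≤ (Y t₀).2 - (Y s).2 := by
  let φ := -ContinuousLinearMap.snd ℝ (Vec d) ℝ
  have hderiv := intervalIntegrable_deriv_of_lipschitzWith hY t₀ s
  have hφ : IntervalIntegrable (fun r => φ (deriv Y r)) volume t₀ s :=
    ⟨φ.integrable_comp hderiv.1, φ.integrable_comp hderiv.2⟩
  calc ∫ r in t₀..s, S.ℓ (Y r).1 (α r) ≤ ∫ r in t₀..s, φ (deriv Y r) := by
        refine intervalIntegral.integral_mono_ae_restrict hs.1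
          (intervalIntegrable_cost hY hS hL hα hd hs) hφ ?_
        rw [← Measure.restrict_congr_set Ioc_ae_eq_Icc, ← uIoc_of_le hs.1]
        exact ae_restrict_uIoc_of_ae_restrict_Ioo hd hs
    _ = φ (Y s - Y t₀) := by
        rw [φ.intervalIntegral_comp_comm hderiv, intervalIntegral_deriv_of_lipschitzWith hY]
    _ = (Y t₀).2 - (Y s).2 := neg_sub _ _

lemma value_le_of_forall_Ioo
    (hlsc : LowerSemicontinuousOn (fun z : ℝ × Vec d => u z.1 z.2) (Ioc 0 T ×ˢ univ))
    (hY : Continuous Y) (ht₀ : 0 ≤ t₀) (hu : ∀ s ∈ Ioo t₀ T, u s (Y s).1 ≤ u₀ + (Y s).2) {s : ℝ}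
    (hs : s ∈ Ioc t₀ T) : u s (Y s).1 ≤ u₀ + (Y s).2 := by
  have hpos : 0 < s := ht₀.trans_lt hs.1
  have hIoo : ∀ᶠ r in 𝓝[<] s, r ∈ Ioo t₀ s := Ioo_mem_nhdsLT hs.1
  have hcurve : Tendsto (fun r : ℝ => (r, (Y r).1)) (𝓝[<] s) (𝓝[Ioc 0 T ×ˢ univ] (s, (Y s).1)) :=
    tendsto_nhdsWithin_iff.2
      ⟨((continuous_id.prodMk hY.fst).tendsto s).mono_left nhdsWithin_le_nhds,
        hIoo.mono fun r hr => ⟨⟨ht₀.trans_lt hr.1, hr.2.le.trans hs.2⟩, mem_univ _⟩⟩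
  exact le_of_tendsto_of_lowerSemicontinuousWithinAt (g := fun z : ℝ × Vec d => u z.1 z.2)
    (hlsc (s, (Y s).1) ⟨⟨hpos, hs.2⟩, mem_univ _⟩) hcurve
    (((hY.snd.const_add u₀).tendsto s).mono_left nhdsWithin_le_nhds)
    (hIoo.mono fun r hr => hu r ⟨hr.1, hr.2.trans_le hs.2⟩)

lemma exists_superOptimal_trajectory (hS : S.Regular) (hF : S.HF P) (hL : S.HL P cl lam)
    (hG : S.HG cl lam) (hsup : IsSupersolution T S.HamF u) (ht₀ : t₀ ∈ Ico 0 T) {x₀ : Vec d}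
    (hstart : ∀ ε > 0, ∃ t x, 0 < t ∧ t ∈ Ico t₀ T ∧ t - t₀ ≤ ε ∧ ‖x - x₀‖ ≤ ε ∧
      u t x ≤ u t₀ x₀ + ε) :
    ∃ (y : ℝ → Vec d) (α : ℝ → Vec n), S.IsTrajectory T t₀ x₀ y α ∧
      IntervalIntegrable (fun s => S.ℓ (y s) (α s)) volume t₀ T ∧
      ∀ h ∈ Icc 0 (T - t₀),
        u t₀ x₀ ≥ u (t₀ + h) (y (t₀ + h)) + ∫ s in t₀..(t₀ + h), S.ℓ (y s) (α s) := by
  obtain ⟨K, Y, hY, hY₀, hYd, hYu⟩ := exists_limit_trajectory hF hL hG hsup ht₀.1 hstart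
  have hderiv : ∀ᵐ s ∂volume.restrict (Ioo t₀ T), deriv Y s ∈ S.G cl lam (Y s).1 := by
    rw [ae_restrict_iff' measurableSet_Ioo]
    filter_upwards [hY.ae_differentiableAt_real] with s hs hsI
    exact hYd s hsI hs
  obtain ⟨α, hα, hαY⟩ := exists_control_of_deriv_mem hS hF.nonempty_A hY.continuous hderiv
  have hℓ := hαY.mono fun _ hr => hr.2
  have htraj := isTrajectory_of_deriv_fst_eq hY ht₀.2.le hα (hαY.mono fun _ hr => hr.1)
  rw [hY₀] at htraj
  refine ⟨fun s => (Y s).1, fun s => α s, htraj,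
    intervalIntegrable_cost hY hS hL hα hℓ ⟨ht₀.2.le, le_rfl⟩, fun h hh => ?_⟩
  rcases hh.1.eq_or_lt with rfl | hpos
  · simp [hY₀]
  · have hs : t₀ + h ∈ Ioc t₀ T := ⟨by linarith, by linarith [hh.2]⟩
    have hvalue := value_le_of_forall_Ioo hsup.1 hY.continuous ht₀.1 hYu hs
    have hcost := integral_cost_le hY hS hL hα hℓ ⟨hs.1.le, hs.2⟩
    rw [hY₀] at hcost
    simp only [ge_iff_le]
    linarith

lemma superOptimal_singleton_right (hA : S.A.Nonempty) : S.SuperOptimal T {T} u := by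
  rintro _ rfl x₀
  obtain ⟨a, ha⟩ := hA
  refine ⟨fun _ => x₀, fun _ => a, ⟨⟨aemeasurable_const, Eventually.of_forall fun _ => ha⟩,
    IntervalIntegrable.refl, fun s hs => ?_⟩, IntervalIntegrable.refl, fun h hh => ?_⟩
  · rw [le_antisymm hs.2 hs.1, intervalIntegral.integral_same, add_zero]
  · rw [sub_self, Icc_self, mem_singleton_iff] at hh
    simp [hh]

lemma superOptimal_Ioc_of_isSupersolution (hS : S.Regular) (hF : S.HF P) (hL : S.HL P cl lam)
    (hG : S.HG cl lam) (hsup : IsSupersolution T S.HamF u) : S.SuperOptimal T (Ioc 0 T) u := by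
  intro t₀ ht₀ x₀
  rcases ht₀.2.lt_or_eq with hlt | rfl
  · refine exists_superOptimal_trajectory hS hF hL hG hsup ⟨ht₀.1.le, hlt⟩ fun ε hε => ?_
    exact ⟨t₀, x₀, ht₀.1, ⟨le_rfl, hlt⟩, by simpa using hε.le, by simpa using hε.le,
      by simpa using hε.le⟩
  · exact superOptimal_singleton_right hF.nonempty_A t₀ rfl x₀

lemma InitialTimeRegular.exists_le (hu : InitialTimeRegular u) (hT : 0 < T) (x₀ : Vec d) {ε : ℝ}
    (hε : 0 < ε) : ∃ t x, 0 < t ∧ t ∈ Ico 0 T ∧ t - 0 ≤ ε ∧ ‖x - x₀‖ ≤ ε ∧ u t x ≤ u 0 x₀ + ε := by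
  have hnear : ∀ᶠ z in 𝓝[Ioi 0 ×ˢ univ] ((0 : ℝ), x₀),
      dist z (0, x₀) < min T ε ∧ z ∈ Ioi (0 : ℝ) ×ˢ (univ : Set (Vec d)) :=
    (eventually_nhdsWithin_of_eventually_nhds (Metric.ball_mem_nhds _ (lt_min hT hε))).and
      self_mem_nhdsWithin
  obtain ⟨⟨t, x⟩, hux, hdist, ht, -⟩ := ((hu x₀ ε hε).and_eventually hnear).exists
  rw [Prod.dist_eq, max_lt_iff, Real.dist_eq, sub_zero, abs_of_pos ht, dist_eq_norm] at hdist
  exact ⟨t, x, ht, ⟨ht.le, hdist.1.trans_le (min_le_left _ _)⟩,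
    by linarith [min_le_right T ε], hdist.2.le.trans (min_le_right _ _), hux.le⟩

lemma superOptimal_Icc_of_isSupersolution (hT : 0 < T) (hS : S.Regular) (hF : S.HF P)
    (hL : S.HL P cl lam) (hG : S.HG cl lam) (hsup : IsSupersolution T S.HamF u)
    (hinit : InitialTimeRegular u) : S.SuperOptimal T (Icc 0 T) u := by
  intro t₀ ht₀ x₀
  rcases ht₀.1.lt_or_eq with hpos | rfl
  · exact superOptimal_Ioc_of_isSupersolution hS hF hL hG hsup t₀ ⟨hpos, ht₀.2⟩ x₀
  · exact exists_superOptimal_trajectory hS hF hL hG hsup ⟨le_rfl, hT⟩ fun ε hε =>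
      hinit.exists_le hT x₀ hε

lemma IsSupersolution.mono {H H' : Vec d → Vec d → EReal} (hH : ∀ x p, H x p ≤ H' x p)
    (hu : IsSupersolution T H u) : IsSupersolution T H' u :=
  ⟨hu.1, fun t ht x φ hφ hmin => (hu.2 t ht x φ hφ hmin).trans (by gcongr; exact hH _ _)⟩

lemma ControlProblem.HamE_le_HamF (x p : Vec d) : S.HamE P x p ≤ S.HamF x p :=
  biSup_mono fun _ ha => ha.1

lemma ControlProblem.SuperOptimal.mono {I J : Set ℝ} (hIJ : I ⊆ J) (hu : S.SuperOptimal T J u) :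
    S.SuperOptimal T I u := fun t ht x => hu t (hIJ ht) x

end SuperOptimality

/-! ### Planar curves with controlled increments -/

section PlanarCurves

lemma exists_left_forall_pos_of_continuousOn {y : ℝ → ℝ} {h₀ τ : ℝ}
    (hy : ContinuousOn y (Icc 0 h₀)) (hτ : τ ∈ Ioc 0 h₀) (hpos : 0 < y τ) :
    ∃ s ∈ Ico 0 τ, ∀ r ∈ Icc s τ, 0 < y r := by
  have hev : ∀ᶠ r in 𝓝[Icc 0 h₀] τ, 0 < y r :=
    (hy τ ⟨hτ.1.le, hτ.2⟩).eventually (lt_mem_nhds hpos)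
  obtain ⟨δ, hδ, hball⟩ := Metric.mem_nhdsWithin_iff.1 hev
  refine ⟨max 0 (τ - δ / 2), ⟨le_max_left _ _, max_lt hτ.1 (by linarith)⟩, fun r hr => ?_⟩
  have hr0 := (le_max_left 0 (τ - δ / 2)).trans hr.1
  have hrδ := (le_max_right 0 (τ - δ / 2)).trans hr.1
  refine hball ⟨?_, hr0, hr.2.trans hτ.2⟩
  rw [Metric.mem_ball, Real.dist_eq, abs_lt]
  constructor <;> linarith [hr.2]

lemma pos_or_neg_of_continuousOn_of_ne_zero {y : ℝ → ℝ} {I : Set ℝ} (hy : ContinuousOn y I)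
    (hI : IsPreconnected I) (hne : ∀ r ∈ I, y r ≠ 0) :
    (∀ r ∈ I, 0 < y r) ∨ ∀ r ∈ I, y r < 0 := by
  by_contra! h
  obtain ⟨⟨a, ha, hya⟩, b, hb, hyb⟩ := h
  obtain ⟨r, hr, hr0⟩ := hI.intermediate_value ha hb hy ⟨hya, hyb⟩
  exact hne r hr hr0

lemma exists_last_zero {y : ℝ → ℝ} {t : ℝ} (hy : ContinuousOn y (Icc 0 t)) (ht : 0 ≤ t)
    (hy0 : y 0 = 0) (hyt : 0 < y t) : ∃ σ ∈ Ico 0 t, y σ = 0 ∧ ∀ r ∈ Ioo σ t, 0 < y r := by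
  have hclosed : IsClosed (Icc 0 t ∩ y ⁻¹' {0}) :=
    hy.preimage_isClosed_of_isClosed isClosed_Icc isClosed_singleton
  obtain ⟨σ, ⟨hσ, hyσ : y σ = 0⟩, hlast⟩ :=
    (isCompact_Icc.of_isClosed_subset hclosed inter_subset_left).exists_isGreatest
      ⟨0, ⟨le_rfl, ht⟩, hy0⟩
  have hσt : σ < t := hσ.2.lt_of_ne fun h => hyt.ne' (h ▸ hyσ)
  have hne : ∀ r ∈ Ioc σ t, y r ≠ 0 := fun r hr h0 =>
    (hlast ⟨⟨hσ.1.trans hr.1.le, hr.2⟩, h0⟩).not_gt hr.1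
  have hpos : ∀ r ∈ Ioc σ t, 0 < y r :=
    (pos_or_neg_of_continuousOn_of_ne_zero
      (hy.mono (Ioc_subset_Icc_self.trans (Icc_subset_Icc_left hσ.1))) isPreconnected_Ioc
      hne).resolve_right fun h => (h t ⟨hσt, le_rfl⟩).not_gt hyt
  exact ⟨σ, ⟨hσ.1, hσt⟩, hyσ, fun r hr => hpos r ⟨hr.1, hr.2.le⟩⟩

lemma apply_zero_le_of_forall_exists_left {W : ℝ → ℝ} {h₀ : ℝ} (hW : ContinuousOn W (Icc 0 h₀))
    (hleft : ∀ τ ∈ Ioc 0 h₀, ∃ s ∈ Ico 0 τ, W s ≤ W τ) {s : ℝ} (hs : s ∈ Icc 0 h₀) :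
    W 0 ≤ W s := by
  obtain ⟨m, hm, hmin⟩ := isCompact_Icc.exists_isMinOn ⟨s, hs⟩ hW
  have hclosed : IsClosed (Icc 0 h₀ ∩ W ⁻¹' {W m}) :=
    hW.preimage_isClosed_of_isClosed isClosed_Icc isClosed_singleton
  obtain ⟨τ, ⟨hτ, hτm : W τ = W m⟩, hfirst⟩ :=
    (isCompact_Icc.of_isClosed_subset hclosed inter_subset_left).exists_isLeast ⟨m, hm, rfl⟩
  obtain rfl | hτ0 := hτ.1.eq_or_lt
  · exact hτm.trans_le (hmin hs)
  · obtain ⟨r, hr, hrτ⟩ := hleft τ ⟨hτ0, hτ.2⟩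
    have hrI : r ∈ Icc 0 h₀ := ⟨hr.1, hr.2.le.trans hτ.2⟩
    have hrm : W r = W m := le_antisymm (hrτ.trans hτm.le) (hmin hrI)
    exact absurd (hfirst ⟨hrI, hrm⟩) (not_le.2 hr.2)

/-- Over every subinterval of `[0, h]` in the interior of which `P` holds, the increment of `Φ` is
at most that of `Ψ`. -/
def IncrementsLE (h : ℝ) (P : ℝ → Prop) (Φ Ψ : ℝ → ℝ) : Prop :=
  ∀ ⦃s t⦄, 0 ≤ s → s ≤ t → t ≤ h → (∀ r ∈ Ioo s t, P r) → Φ t - Φ s ≤ Ψ t - Ψ s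

variable {P Q : ℝ → Prop} {Φ Ψ y₁ y₂ : ℝ → ℝ} {h₀ : ℝ}

lemma IncrementsLE.mono (hPQ : ∀ r, Q r → P r) (h : IncrementsLE h₀ P Φ Ψ) :
    IncrementsLE h₀ Q Φ Ψ :=
  fun _ _ hs hst ht hQ => h hs hst ht fun r hr => hPQ r (hQ r hr)

lemma IncrementsLE.apply_le (h : IncrementsLE h₀ P Φ Ψ) (hΦ : Φ 0 = 0) (hΨ : Ψ 0 = 0) {s : ℝ}
    (hs : s ∈ Icc 0 h₀) (hP : ∀ r ∈ Ioo 0 s, P r) : Φ s ≤ Ψ s := by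
  simpa only [hΦ, hΨ, sub_zero] using h le_rfl hs.1 hs.2 hP

lemma IncrementsLE.convex_combination {p₁ c₁ p₂ c₂ a b : ℝ}
    (h₁ : IncrementsLE h₀ P (fun r => p₁ * y₁ r + c₁ * y₂ r) Ψ)
    (h₂ : IncrementsLE h₀ P (fun r => p₂ * y₁ r + c₂ * y₂ r) Ψ) (ha : 0 ≤ a) (hb : 0 ≤ b)
    (hab : a + b = 1) :
    IncrementsLE h₀ P (fun r => (a * p₁ + b * p₂) * y₁ r + (a * c₁ + b * c₂) * y₂ r) Ψ := by
  intro s t hs hst ht hP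
  have hΨ : a * (Ψ t - Ψ s) + b * (Ψ t - Ψ s) = Ψ t - Ψ s := by rw [← add_mul, hab, one_mul]
  have hle₁ := mul_le_mul_of_nonneg_left (h₁ hs hst ht hP) ha
  have hle₂ := mul_le_mul_of_nonneg_left (h₂ hs hst ht hP) hb
  linarith

lemma apply_zero_le_of_monotone_pieces {W : ℝ → ℝ} (hW : ContinuousOn W (Icc 0 h₀))
    (hy₁ : ContinuousOn y₁ (Icc 0 h₀)) (hy₂ : ContinuousOn y₂ (Icc 0 h₀))
    (hpos : ∀ s ∈ Ioc 0 h₀, y₁ s ≤ 0 → 0 < y₂ s)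
    (hW₁ : ∀ s t, 0 ≤ s → s ≤ t → t ≤ h₀ → (∀ r ∈ Ioo s t, 0 < y₁ r) →
      0 ≤ y₁ s → 0 ≤ y₁ t → W s ≤ W t)
    (hW₂ : ∀ s t, 0 ≤ s → s ≤ t → t ≤ h₀ → (∀ r ∈ Ioo s t, 0 < y₂ r) →
      y₁ s ≤ 0 → y₁ t ≤ 0 → W s ≤ W t)
    {s : ℝ} (hs : s ∈ Icc 0 h₀) : W 0 ≤ W s := by
  refine apply_zero_le_of_forall_exists_left hW (fun τ hτ => ?_) hs
  obtain hyτ | hyτ := lt_or_ge 0 (y₁ τ)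
  · obtain ⟨a, ha, hay⟩ := exists_left_forall_pos_of_continuousOn hy₁ hτ hyτ
    exact ⟨a, ha, hW₁ a τ ha.1 ha.2.le hτ.2 (fun r hr => hay r ⟨hr.1.le, hr.2.le⟩)
      (hay a ⟨le_rfl, ha.2.le⟩).le hyτ.le⟩
  obtain ⟨a, ha, hay⟩ := exists_left_forall_pos_of_continuousOn hy₂ hτ (hpos τ hτ hyτ)
  by_cases hex : ∃ r ∈ Ico a τ, y₁ r ≤ 0
  · obtain ⟨r, hr, hyr⟩ := hex
    exact ⟨r, ⟨ha.1.trans hr.1, hr.2⟩, hW₂ r τ (ha.1.trans hr.1) hr.2.le hτ.2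
      (fun r' hr' => hay r' ⟨hr.1.trans hr'.1.le, hr'.2.le⟩) hyr hyτ⟩
  · push Not at hex
    have hyτ0 : 0 ≤ y₁ τ := by
      by_contra! hneg
      obtain ⟨b, hb, hby⟩ := exists_left_forall_pos_of_continuousOn hy₁.neg hτ (neg_pos.2 hneg)
      exact (neg_pos.1 (hby (max a b) ⟨le_max_right _ _, max_le ha.2.le hb.2.le⟩)).not_gt
        (hex (max a b) ⟨le_max_left _ _, max_lt ha.2 hb.2⟩)
    exact ⟨a, ha, hW₁ a τ ha.1 ha.2.le hτ.2 (fun r hr => hex r ⟨hr.1.le, hr.2⟩)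
      (hex a ⟨le_rfl, ha.2⟩).le hyτ0⟩

lemma piecewise_linear_le_of_incrementsLE (hy₁ : ContinuousOn y₁ (Icc 0 h₀))
    (hy₂ : ContinuousOn y₂ (Icc 0 h₀)) (hΨ : ContinuousOn Ψ (Icc 0 h₀)) (hy₁0 : y₁ 0 = 0)
    (hy₂0 : y₂ 0 = 0) (hΨ0 : Ψ 0 = 0) (hpos : ∀ s ∈ Ioc 0 h₀, y₁ s ≤ 0 → 0 < y₂ s) {p q c : ℝ}
    (hp : IncrementsLE h₀ (fun r => 0 < y₁ r) (fun r => p * y₁ r + c * y₂ r) Ψ)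
    (hq : IncrementsLE h₀ (fun r => 0 < y₂ r) (fun r => q * y₁ r + c * y₂ r) Ψ)
    {s : ℝ} (hs : s ∈ Icc 0 h₀) :
    p * max (y₁ s) 0 + q * min (y₁ s) 0 + c * y₂ s ≤ Ψ s := by
  let W : ℝ → ℝ := fun s => Ψ s - (p * max (y₁ s) 0 + q * min (y₁ s) 0 + c * y₂ s)
  have hW : ContinuousOn W (Icc 0 h₀) :=
    hΨ.sub (((continuousOn_const.mul (hy₁.sup continuousOn_const)).add
      (continuousOn_const.mul (hy₁.inf continuousOn_const))).add (continuousOn_const.mul hy₂))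
  have hW_nonneg : ∀ s, 0 ≤ y₁ s → W s = Ψ s - (p * y₁ s + c * y₂ s) := fun s hs => by
    simp only [W, max_eq_left hs, min_eq_right hs, mul_zero, add_zero]
  have hW_nonpos : ∀ s, y₁ s ≤ 0 → W s = Ψ s - (q * y₁ s + c * y₂ s) := fun s hs => by
    simp only [W, max_eq_right hs, min_eq_left hs, mul_zero, zero_add]
  have hW_mono : W 0 ≤ W s := by
    refine apply_zero_le_of_monotone_pieces hW hy₁ hy₂ hpos (fun s t h0 hst ht h hs ht' => ?_)
      (fun s t h0 hst ht h hs ht' => ?_) hs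
    · rw [hW_nonneg s hs, hW_nonneg t ht']
      linarith [hp h0 hst ht h]
    · rw [hW_nonpos s hs, hW_nonpos t ht']
      linarith [hq h0 hst ht h]
  have hW0 : W 0 = 0 := by simp [W, hy₁0, hy₂0, hΨ0]
  rw [hW0] at hW_mono
  exact sub_nonneg.1 hW_mono

lemma false_of_planar_incrementsLE (hy₁ : ContinuousOn y₁ (Icc 0 h₀))
    (hy₂ : ContinuousOn y₂ (Icc 0 h₀)) (hΨ : ContinuousOn Ψ (Icc 0 h₀)) (hy₁0 : y₁ 0 = 0)
    (hy₂0 : y₂ 0 = 0) (hΨ0 : Ψ 0 = 0) (hneg : ∀ s ∈ Ioc 0 h₀, Ψ s < 0) {e₁ e₂ j₁ j₂ k₁ k₂ : ℝ}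
    (he₁ : 0 < e₁) (he₂ : 0 < e₂) (hj₁ : 0 ≤ j₁) (hk₂ : 0 ≤ k₂)
    (he : IncrementsLE h₀ (fun _ => True) (fun r => -e₁ * y₁ r + -e₂ * y₂ r) Ψ)
    (hj : IncrementsLE h₀ (fun r => 0 < y₁ r) (fun r => j₁ * y₁ r + j₂ * y₂ r) Ψ)
    (hk : IncrementsLE h₀ (fun r => 0 < y₂ r) (fun r => k₁ * y₁ r + k₂ * y₂ r) Ψ)
    {s₁ s₂ : ℝ} (hs₁ : s₁ ∈ Ioc 0 h₀) (hs₁0 : y₂ s₁ = 0) (hs₂ : s₂ ∈ Ioc 0 h₀)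
    (hs₂0 : y₁ s₂ = 0) : False := by
  have hlow : ∀ s ∈ Ioc 0 h₀, -e₁ * y₁ s + -e₂ * y₂ s ≤ Ψ s := fun s hs =>
    he.apply_le (by simp [hy₁0, hy₂0]) hΨ0 ⟨hs.1.le, hs.2⟩ fun _ _ => trivial
  have hpos : ∀ s ∈ Ioc 0 h₀, y₁ s ≤ 0 → 0 < y₂ s := fun s hs hy => by
    by_contra! hy₂s
    nlinarith [hlow s hs, hneg s hs]
  have hy₁s₁ : 0 < y₁ s₁ := lt_of_not_ge fun h => (hpos s₁ hs₁ h).ne' hs₁0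
  have hj₁s₁ : 0 ≤ j₁ * y₁ s₁ := mul_nonneg hj₁ hy₁s₁.le
  obtain hj₂ | hj₂ := le_total j₂ (-e₂)
  · obtain ⟨σ, hσ, hσ0, hσpos⟩ :=
      exists_last_zero (hy₁.mono (Icc_subset_Icc_right hs₁.2)) hs₁.1.le hy₁0 hy₁s₁
    have hinc := hj hσ.1 hσ.2.le hs₁.2 hσpos
    simp only [hσ0, hs₁0, mul_zero, add_zero, zero_add] at hinc
    obtain rfl | hσ' := hσ.1.eq_or_lt
    · simp only [hy₂0, hΨ0] at hinc
      linarith [hneg s₁ hs₁]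
    · have hσI : σ ∈ Ioc 0 h₀ := ⟨hσ', hσ.2.le.trans hs₁.2⟩
      have hlowσ := hlow σ hσI
      simp only [hσ0, mul_zero, zero_add] at hlowσ
      nlinarith [hpos σ hσI hσ0.le, hneg s₁ hs₁]
  -- A convex combination of two of the forms has the `y₂`-coefficient of the third one, so that the
  -- two glue along `y₁ = 0` to a continuous piecewise linear minorant of `Ψ`.
  obtain hjk | hjk := le_total j₂ k₂
  · obtain ⟨a, b, ha, hb, hab, rfl⟩ := Icc_subset_segment (𝕜 := ℝ) ⟨hj₂, hjk⟩
    have hle := piecewise_linear_le_of_incrementsLE hy₁ hy₂ hΨ hy₁0 hy₂0 hΨ0 hpos hj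
      ((he.mono fun _ _ => trivial).convex_combination hk ha hb hab) ⟨hs₁.1.le, hs₁.2⟩
    rw [max_eq_left hy₁s₁.le, min_eq_right hy₁s₁.le, hs₁0] at hle
    linarith [hneg s₁ hs₁]
  · obtain ⟨a, b, ha, hb, hab, rfl⟩ :=
      Icc_subset_segment (𝕜 := ℝ) ⟨(neg_nonpos.2 he₂.le).trans hk₂, hjk⟩
    have hle := piecewise_linear_le_of_incrementsLE hy₁ hy₂ hΨ hy₁0 hy₂0 hΨ0 hpos
      ((he.mono fun _ _ => trivial).convex_combination hj ha hb hab) hk ⟨hs₂.1.le, hs₂.2⟩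
    rw [hs₂0, max_self, min_self, mul_zero, mul_zero, zero_add, zero_add] at hle
    have hk₂s₂ := mul_nonneg hk₂ (hpos s₂ hs₂ hs₂0.le).le
    simp only [smul_eq_mul] at hk₂s₂
    linarith [hneg s₂ hs₂]

lemma sign_eq_of_coe_mul_pos {ε : SignType} {x : ℝ} (h : 0 < (ε : ℝ) * x) :
    SignType.sign x = ε := by
  cases ε
  · simp at h
  · simpa [sign_eq_neg_one_iff] using h
  · simpa [sign_eq_one_iff] using h

lemma mul_coe_signType_mul_coe_mul {ε : SignType} (hε : ε ≠ 0) (c r : ℝ) :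
    c * ε * (ε * r) = c * r := by
  cases ε
  · exact absurd rfl hε
  · simp
  · simp

lemma neg_abs_mul_sign_neg_mul (x r : ℝ) : -|x| * (SignType.sign (-x) * r) = x * r := by
  have hx := sign_mul_abs (-x)
  rw [abs_neg] at hx
  linear_combination -r * hx

/-- The nonzero entries of `σ` are the signs of the corresponding coordinates of the curve `y` at
time `r`; a zero entry imposes no condition. -/
def MatchesSigns {ι : Type*} (σ : ι → SignType) (y : ι → ℝ → ℝ) (r : ℝ) : Prop :=
  ∀ b, σ b ≠ 0 → SignType.sign (y b r) = σ b

lemma not_forall_matchesSigns_of_incrementsLE {ι : Type*} [Fintype ι] {y : ι → ℝ → ℝ}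
    (hy0 : ∀ b, y b 0 = 0) (hΨ0 : Ψ 0 = 0) {s : ℝ} (hs : s ∈ Icc 0 h₀) (hneg : Ψ s < 0)
    {k : ι → ℝ} (hk : ∀ b, 0 ≤ (SignType.sign (y b s) : ℝ) * k b)
    (hinc : IncrementsLE h₀ (MatchesSigns (fun b => SignType.sign (y b s)) y)
      (fun r => ∑ b, k b * y b r) Ψ) :
    ¬ ∀ r ∈ Ioo 0 s, MatchesSigns (fun b => SignType.sign (y b s)) y r := by
  intro hmatch
  have hle := hinc.apply_le (by simp [hy0]) hΨ0 hs hmatch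
  have hnonneg : 0 ≤ ∑ b, k b * y b s := by
    refine Finset.sum_nonneg fun b _ => ?_
    rw [← sign_mul_abs (y b s), ← mul_assoc, mul_comm (k b)]
    exact mul_nonneg (hk b) (abs_nonneg _)
  linarith

lemma exists_time_sign_eq {y : ℝ → ℝ} (hh₀ : 0 < h₀) (hy : ContinuousOn y (Icc 0 h₀)) :
    ∃ s ∈ Ioc 0 h₀, y s ≠ 0 → ∀ r ∈ Ioc 0 h₀, SignType.sign (y r) = SignType.sign (y s) := by
  by_cases hzero : ∃ s ∈ Ioc 0 h₀, y s = 0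
  · obtain ⟨s, hs, hys⟩ := hzero
    exact ⟨s, hs, fun h => absurd hys h⟩
  · push Not at hzero
    have hh₀' : h₀ ∈ Ioc 0 h₀ := ⟨hh₀, le_rfl⟩
    refine ⟨h₀, hh₀', fun _ r hr => ?_⟩
    obtain h | h := pos_or_neg_of_continuousOn_of_ne_zero (hy.mono Ioc_subset_Icc_self)
      isPreconnected_Ioc hzero
    · rw [sign_pos (h r hr), sign_pos (h h₀ hh₀')]
    · rw [sign_neg (h r hr), sign_neg (h h₀ hh₀')]

section SignPatterns

variable {y : Bool → ℝ → ℝ} {k : (Bool → SignType) → Bool → ℝ}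

lemma exists_pos_apply_eq_zero_of_incrementsLE (hh₀ : 0 < h₀)
    (hy : ∀ b, ContinuousOn (y b) (Icc 0 h₀)) (hy0 : ∀ b, y b 0 = 0) (hΨ0 : Ψ 0 = 0)
    (hneg : ∀ s ∈ Ioc 0 h₀, Ψ s < 0) (hk : ∀ σ b, 0 ≤ (σ b : ℝ) * k σ b)
    (hinc : ∀ σ, IncrementsLE h₀ (MatchesSigns σ y) (fun r => ∑ b, k σ b * y b r) Ψ) (b : Bool) :
    ∃ s ∈ Ioc 0 h₀, y b s = 0 := by
  by_contra! hne
  obtain ⟨s, hs, hsign⟩ := exists_time_sign_eq hh₀ (hy !b)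
  obtain ⟨t, ht, hsignb⟩ := exists_time_sign_eq hh₀ (hy b)
  have hb : ∀ r ∈ Ioc 0 h₀, SignType.sign (y b r) = SignType.sign (y b s) := fun r hr =>
    (hsignb (hne t ht) r hr).trans (hsignb (hne t ht) s hs).symm
  refine not_forall_matchesSigns_of_incrementsLE hy0 hΨ0 ⟨hs.1.le, hs.2⟩ (hneg s hs)
    (hk fun b => SignType.sign (y b s)) (hinc _) fun r hr b' hb' => ?_
  have hrI : r ∈ Ioc 0 h₀ := ⟨hr.1, hr.2.le.trans hs.2⟩
  obtain rfl | rfl := b'.eq_or_eq_not b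
  · exact hb r hrI
  · exact hsign (sign_ne_zero.1 hb') r hrI

lemma apply_zero_ne_zero_of_incrementsLE (hy0 : ∀ b, y b 0 = 0) (hΨ0 : Ψ 0 = 0) {s : ℝ}
    (hs : s ∈ Ioc 0 h₀) (hneg : Ψ s < 0)
    (hinc : IncrementsLE h₀ (fun _ => True) (fun r => ∑ b, k 0 b * y b r) Ψ) {b : Bool}
    (hys : y (!b) s = 0) : k 0 b ≠ 0 := by
  intro h0
  have hle := hinc.apply_le (by simp [hy0]) hΨ0 ⟨hs.1.le, hs.2⟩ fun _ _ => trivial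
  have hsum : ∑ b, k 0 b * y b s = 0 := Finset.sum_eq_zero fun b' _ => by
    obtain rfl | rfl := b'.eq_or_eq_not b
    · rw [h0, zero_mul]
    · rw [hys, mul_zero]
  linarith

lemma false_of_sign_pattern_incrementsLE (hh₀ : 0 < h₀)
    (hy : ∀ b, ContinuousOn (y b) (Icc 0 h₀)) (hΨ : ContinuousOn Ψ (Icc 0 h₀))
    (hy0 : ∀ b, y b 0 = 0) (hΨ0 : Ψ 0 = 0) (hneg : ∀ s ∈ Ioc 0 h₀, Ψ s < 0)
    (hk : ∀ σ b, 0 ≤ (σ b : ℝ) * k σ b)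
    (hinc : ∀ σ, IncrementsLE h₀ (MatchesSigns σ y) (fun r => ∑ b, k σ b * y b r) Ψ) : False := by
  have hzero := exists_pos_apply_eq_zero_of_incrementsLE hh₀ hy hy0 hΨ0 hneg hk hinc
  obtain ⟨s₁, hs₁, hs₁0⟩ := hzero false
  obtain ⟨s₂, hs₂, hs₂0⟩ := hzero true
  have hglob : IncrementsLE h₀ (fun _ => True) (fun r => ∑ b, k 0 b * y b r) Ψ :=
    (hinc 0).mono fun _ _ _ hb => absurd rfl hb
  have hne₁ := apply_zero_ne_zero_of_incrementsLE hy0 hΨ0 hs₁ (hneg s₁ hs₁) hglob (b := true) hs₁0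
  have hne₂ := apply_zero_ne_zero_of_incrementsLE hy0 hΨ0 hs₂ (hneg s₂ hs₂) hglob (b := false) hs₂0
  -- After reflecting the axes, the coefficients of the global form `k 0` are both negative.
  let ε : Bool → SignType := fun b => SignType.sign (-k 0 b)
  have hε : ∀ b, k 0 b ≠ 0 → ε b ≠ 0 := fun b hb => sign_ne_zero.2 (neg_ne_zero.2 hb)
  let σ₁ : Bool → SignType := fun b => bif b then ε true else 0
  let σ₂ : Bool → SignType := fun b => bif b then 0 else ε false
  refine false_of_planar_incrementsLE (y₁ := fun s => ε true * y true s)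
    (y₂ := fun s => ε false * y false s) (e₁ := |k 0 true|) (e₂ := |k 0 false|)
    (j₁ := k σ₁ true * ε true) (j₂ := k σ₁ false * ε false)
    (k₁ := k σ₂ true * ε true) (k₂ := k σ₂ false * ε false)
    (continuousOn_const.mul (hy _)) (continuousOn_const.mul (hy _)) hΨ (by simp [hy0])
    (by simp [hy0]) hΨ0 hneg (abs_pos.2 hne₁) (abs_pos.2 hne₂)
    ((hk σ₁ true).trans_eq (mul_comm _ _)) ((hk σ₂ false).trans_eq (mul_comm _ _))
    ?_ ?_ ?_ hs₁ (by simp [hs₁0]) hs₂ (by simp [hs₂0])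
  · simpa only [ε, neg_abs_mul_sign_neg_mul, Fintype.sum_bool] using hglob
  · have hinc₁ := (hinc σ₁).mono (Q := fun r => 0 < ε true * y true r) fun r hr b hb => by
      cases b
      · exact absurd rfl hb
      · exact sign_eq_of_coe_mul_pos hr
    simpa only [mul_coe_signType_mul_coe_mul (hε _ hne₁), mul_coe_signType_mul_coe_mul (hε _ hne₂),
      Fintype.sum_bool] using hinc₁
  · have hinc₂ := (hinc σ₂).mono (Q := fun r => 0 < ε false * y false r) fun r hr b hb => by
      cases b
      · exact sign_eq_of_coe_mul_pos hr
      · exact absurd rfl hb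
    simpa only [mul_coe_signType_mul_coe_mul (hε _ hne₁), mul_coe_signType_mul_coe_mul (hε _ hne₂),
      Fintype.sum_bool] using hinc₂

end SignPatterns

end PlanarCurves

/-! ### The local structure of the multi-domain -/

/-- The closed orthant of sign pattern `σ`: the points whose `b`-th coordinate is zero or has the
sign `σ b`. -/
def closedOrthant {ι : Type*} (σ : ι → SignType) : ProperCone ℝ (ι → ℝ) where
  carrier := {x | ∀ b, (σ b : ℝ) * x b = |x b|}
  add_mem' {x y} hx hy b := by
    refine le_antisymm ?_ ?_
    · rcases σ b with _ | _ | _ <;> simp [-neg_add_rev, le_abs_self, neg_le_abs]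
    · calc |x b + y b| ≤ |x b| + |y b| := abs_add_le _ _
        _ = σ b * (x b + y b) := by rw [← hx b, ← hy b, mul_add]
  zero_mem' b := by simp
  smul_mem' t x hx b := by
    change (σ b : ℝ) * (t * x b) = |(t : ℝ) * x b|
    rw [abs_mul, abs_of_nonneg t.2, ← hx b, mul_left_comm]
  isClosed' := by
    simp only [ofPred_forall]
    exact isClosed_iInter fun b => isClosed_eq (by fun_prop) (by fun_prop)

lemma mem_closedOrthant {ι : Type*} {σ : ι → SignType} {x : ι → ℝ} :
    x ∈ closedOrthant σ ↔ ∀ b, (σ b : ℝ) * x b = |x b| :=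
  Iff.rfl

lemma sign_add_pos_mul {ε : SignType} {a t : ℝ} (ht : 0 < t) (ha : (ε : ℝ) * a = |a|) :
    SignType.sign (a + t * ε) = ε := by
  have hnonneg : 0 ≤ (ε : ℝ) * a := ha ▸ abs_nonneg a
  cases ε
  · have ha0 : a = 0 := by simpa using ha.symm
    simp [ha0]
  · simp only [SignType.neg_eq_neg_one, SignType.coe_neg_one, neg_one_mul] at hnonneg
    simp only [SignType.neg_eq_neg_one, SignType.coe_neg_one, sign_eq_neg_one_iff]
    linarith
  · simp only [SignType.pos_eq_one, SignType.coe_one, one_mul] at hnonneg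
    simp only [SignType.pos_eq_one, SignType.coe_one, sign_eq_one_iff]
    linarith

lemma eventually_sign_eq_of_ne_zero {X : Type*} [TopologicalSpace X] {g : X → ℝ} {x : X}
    (hg : ContinuousAt g x) (hx : g x ≠ 0) :
    ∀ᶠ z in 𝓝 x, SignType.sign (g z) = SignType.sign (g x) := by
  have h := (continuousAt_sign_of_ne_zero hx).comp hg
  rwa [ContinuousAt, nhds_discrete SignType, tendsto_pure] at h

lemma sign_eq_of_isPreconnected {X : Type*} [TopologicalSpace X] {g : X → ℝ} {s : Set X}
    (hs : IsPreconnected s) (hg : ContinuousOn g s) (hne : ∀ x ∈ s, g x ≠ 0) {x y : X}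
    (hx : x ∈ s) (hy : y ∈ s) : SignType.sign (g x) = SignType.sign (g y) :=
  hs.constant (fun z hz =>
    (continuousAt_sign_of_ne_zero (hne z hz)).comp_continuousWithinAt (hg z hz)) hx hy

lemma tendsto_add_smul_nhdsGT_zero {E : Type*} [NormedAddCommGroup E] [NormedSpace ℝ E]
    (x v : E) : Tendsto (fun t : ℝ => x + t • v) (𝓝[>] 0) (𝓝 x) := by
  have hcont : Continuous fun t : ℝ => x + t • v := by fun_prop
  simpa using (hcont.tendsto 0).mono_left nhdsWithin_le_nhds

namespace MultiDomain

variable {d : ℕ} {P : MultiDomain d} {x₀ : Vec d}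

lemma inner_sub_offset {j : Fin P.q} (hj : x₀ ∈ P.hyperplane j) (z : Vec d) :
    inner ℝ (P.normal j) z - P.offset j = inner ℝ (P.normal j) (z - x₀) := by
  rw [inner_sub_right, show inner ℝ (P.normal j) x₀ = P.offset j from hj]

lemma H1.eq_of_parallel (hP : P.H1) {i j : Fin P.q} {x : Vec d} (hi : x ∈ P.hyperplane i)
    (hj : x ∈ P.hyperplane j) (hij : P.normal i = P.normal j ∨ P.normal i = -P.normal j) :
    i = j := by
  refine hP.hyperplane_injective (Set.ext fun z => ?_)
  change inner ℝ (P.normal i) z = P.offset i ↔ inner ℝ (P.normal j) z = P.offset j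
  rw [← sub_eq_zero, inner_sub_offset hi, ← sub_eq_zero (b := P.offset j), inner_sub_offset hj]
  obtain h | h := hij <;> simp [h, inner_neg_left]

lemma mem_face_self (z : Vec d) : z ∈ P.face z := fun _ => rfl

lemma convex_face (z : Vec d) : Convex ℝ (P.face z) := by
  have hface : P.face z = ⋂ j, {x | SignType.sign (inner ℝ (P.normal j) x - P.offset j)
      = SignType.sign (inner ℝ (P.normal j) z - P.offset j)} := by
    simp only [face, ofPred_forall]
  rw [hface]
  refine convex_iInter fun j => ?_
  have hlin := (innerₛₗ ℝ (P.normal j)).isLinear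
  rcases lt_trichotomy (inner ℝ (P.normal j) z - P.offset j) 0 with h | h | h
  · simp only [sign_neg h, sign_eq_neg_one_iff, sub_neg]
    exact convex_halfSpace_lt hlin _
  · simp only [h, sign_zero, sign_eq_zero_iff, sub_eq_zero]
    exact convex_hyperplane hlin _
  · simp only [sign_pos h, sign_eq_one_iff, sub_pos]
    exact convex_halfSpace_gt hlin _

lemma disjoint_face_interface {z : Vec d} (hz : z ∉ P.interface) :
    Disjoint (P.face z) P.interface := by
  refine disjoint_left.2 fun x hx hxI => ?_
  obtain ⟨j, hj : inner ℝ (P.normal j) x = P.offset j⟩ := mem_iUnion.1 hxI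
  have hzj := hx j
  rw [hj, sub_self, sign_zero, eq_comm, sign_eq_zero_iff, sub_eq_zero] at hzj
  exact hz (mem_iUnion.2 ⟨j, hzj⟩)

lemma H1.exists_mem_cell (hP : P.H1) {z : Vec d} (hz : z ∉ P.interface) : ∃ i, z ∈ P.cell i := by
  have hmem : z ∈ P.interface ∪ ⋃ i, P.cell i := hP.cover ▸ mem_univ z
  exact mem_iUnion.1 (hmem.resolve_left hz)

lemma H1.cell_subset_face (hP : P.H1) {i : Fin P.m} {z : Vec d} (hz : z ∈ P.cell i) :
    P.cell i ⊆ P.face z := fun x hx j => by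
  refine sign_eq_of_isPreconnected (g := fun x => inner ℝ (P.normal j) x - P.offset j)
    (hP.cell_isConnected i).isPreconnected (by fun_prop) (fun y hy h0 => ?_) hx hz
  have hmem : y ∈ P.interface ∩ P.cell i := ⟨mem_iUnion.2 ⟨j, sub_eq_zero.1 h0⟩, hy⟩
  rwa [hP.interface_inter_cell i] at hmem

lemma H1.exists_face_eq_cell (hP : P.H1) {z : Vec d} (hz : z ∉ P.interface) :
    ∃ i, P.face z = P.cell i := by
  obtain ⟨i, hi⟩ := hP.exists_mem_cell hz
  refine ⟨i, Subset.antisymm ?_ (hP.cell_subset_face hi)⟩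
  refine (convex_face z).isPreconnected.subset_left_of_subset_union (hP.cell_isOpen i)
    (isOpen_iUnion fun k => isOpen_iUnion fun _ : k ≠ i => hP.cell_isOpen k)
    (disjoint_iUnion₂_right.2 fun k hk => hP.cell_disjoint hk.symm) (fun x hx => ?_)
    ⟨z, mem_face_self z, hi⟩
  obtain ⟨k, hk⟩ := hP.exists_mem_cell (disjoint_left.1 (disjoint_face_interface hz) hx)
  obtain rfl | hki := eq_or_ne k i
  · exact Or.inl hk
  · exact Or.inr (mem_iUnion₂.2 ⟨k, hki, hk⟩)

lemma H1.isSubdomain_face (hP : P.H1) (z : Vec d) : P.IsSubdomain (P.face z) := by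
  by_cases hz : z ∈ P.interface
  · exact Or.inr ⟨z, hz, rfl⟩
  · exact Or.inl (hP.exists_face_eq_cell hz)

lemma eventually_sign_eq (x₀ : Vec d) : ∀ᶠ z in 𝓝 x₀, ∀ j, x₀ ∉ P.hyperplane j →
    SignType.sign (inner ℝ (P.normal j) z - P.offset j)
      = SignType.sign (inner ℝ (P.normal j) x₀ - P.offset j) := by
  refine eventually_all.2 fun j => ?_
  by_cases hj : x₀ ∈ P.hyperplane j
  · exact Eventually.of_forall fun _ h => absurd hj h
  · filter_upwards [eventually_sign_eq_of_ne_zero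
      (g := fun z => inner ℝ (P.normal j) z - P.offset j) (by fun_prop)
      fun h => hj (sub_eq_zero.1 h)] with z hz _ using hz

/-- `ν` lists the normals of the hyperplanes through `x₀`, one for each of the two families of
parallel hyperplanes; it is zero for a family without hyperplane through `x₀`. -/
structure IsNormalPair (P : MultiDomain d) (x₀ : Vec d) (ν : Bool → Vec d) : Prop where
  norm_eq_one : ∀ b, ν b ≠ 0 → ‖ν b‖ = 1
  inner_eq_zero : ∀ b, inner ℝ (ν b) (ν !b) = 0
  exists_eq : ∀ j, x₀ ∈ P.hyperplane j → ∃ b, ν b ≠ 0 ∧ P.normal j = ν b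
  exists_hyperplane : ∀ b, ν b ≠ 0 → ∃ j, x₀ ∈ P.hyperplane j ∧ P.normal j = ν b

lemma H1.exists_isNormalPair (hP : P.H1) (x₀ : Vec d) : ∃ ν, P.IsNormalPair x₀ ν := by
  classical
  obtain ⟨fam, hfam⟩ := hP.two_families
  let ν : Bool → Vec d := fun b =>
    if h : ∃ j, fam j = b ∧ x₀ ∈ P.hyperplane j then P.normal h.choose else 0
  have hν : ∀ b, ν b ≠ 0 → ∃ j, fam j = b ∧ x₀ ∈ P.hyperplane j ∧ P.normal j = ν b := by
    intro b hb
    by_cases h : ∃ j, fam j = b ∧ x₀ ∈ P.hyperplane j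
    · exact ⟨h.choose, h.choose_spec.1, h.choose_spec.2, by simp only [ν, dif_pos h]⟩
    · exact absurd (dif_neg h) hb
  have hnormal : ∀ j, x₀ ∈ P.hyperplane j → P.normal j = ν (fam j) := by
    intro j hj
    have h : ∃ i, fam i = fam j ∧ x₀ ∈ P.hyperplane i := ⟨j, rfl, hj⟩
    simp only [ν, dif_pos h]
    exact congrArg _ (hP.eq_of_parallel hj h.choose_spec.2 (hfam _ _ h.choose_spec.1.symm))
  refine ⟨ν, fun b hb => ?_, fun b => ?_, fun j hj => ⟨fam j, fun h0 => ?_, hnormal j hj⟩,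
    fun b hb => ?_⟩
  · obtain ⟨j, -, -, hj⟩ := hν b hb
    exact hj ▸ hP.unit_normal j
  · by_cases hb : ν b = 0
    · rw [hb, inner_zero_left]
    by_cases hb' : ν (!b) = 0
    · rw [hb', inner_zero_right]
    obtain ⟨i, rfl, hi, hiν⟩ := hν b hb
    obtain ⟨j, hj, hjx, hjν⟩ := hν _ hb'
    rw [← hiν, ← hjν]
    refine (hP.parallel_or_perp i j).resolve_left fun hpar => ?_
    rw [hP.eq_of_parallel hi hjx hpar] at hj
    exact Bool.not_ne_self _ hj.symm
  · have hunit := hP.unit_normal j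
    rw [hnormal j hj, h0, norm_zero] at hunit
    exact zero_ne_one hunit
  · obtain ⟨j, -, hj⟩ := hν b hb
    exact ⟨j, hj⟩

/-- The combination of the vectors `ν b` with the signs `σ b` as coefficients: for orthonormal `ν`,
a vector in the open orthant of sign pattern `σ`. -/
def signDir (ν : Bool → Vec d) (σ : Bool → SignType) : Vec d := ∑ b, (σ b : ℝ) • ν b

lemma IsNormalPair.inner_signDir {ν : Bool → Vec d} (hν : P.IsNormalPair x₀ ν)
    (σ : Bool → SignType) {b : Bool} (hb : ν b ≠ 0) : inner ℝ (ν b) (signDir ν σ) = (σ b : ℝ) := by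
  have hnorm := hν.norm_eq_one b hb
  have horth := hν.inner_eq_zero b
  cases b <;> simp_all [signDir, inner_add_right, real_inner_smul_right]

lemma IsNormalPair.mem_face_iff {ν : Bool → Vec d} (hν : P.IsNormalPair x₀ ν) {z w : Vec d}
    (hzw : ∀ j, x₀ ∉ P.hyperplane j → SignType.sign (inner ℝ (P.normal j) z - P.offset j)
      = SignType.sign (inner ℝ (P.normal j) w - P.offset j)) :
    z ∈ P.face w ↔ ∀ b, ν b ≠ 0 →
      SignType.sign (inner ℝ (ν b) (z - x₀)) = SignType.sign (inner ℝ (ν b) (w - x₀)) := by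
  refine ⟨fun h b hb => ?_, fun h j => ?_⟩
  · obtain ⟨j, hj, hjν⟩ := hν.exists_hyperplane b hb
    rw [← hjν, ← inner_sub_offset hj, ← inner_sub_offset hj]
    exact h j
  · by_cases hj : x₀ ∈ P.hyperplane j
    · obtain ⟨b, hb, hjν⟩ := hν.exists_eq j hj
      rw [inner_sub_offset hj, inner_sub_offset hj, hjν]
      exact h b hb
    · exact hzw j hj

/-- The local structure of the multi-domain at a point: normals `ν b` of the hyperplanes through
it, and the subdomains `M σ` described near the point by the signs of the coordinates along the
`ν b`. -/
structure LocalChart (P : MultiDomain d) (x₀ : Vec d) where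
  ν : Bool → Vec d
  M : (Bool → SignType) → Set (Vec d)
  isNormalPair : P.IsNormalPair x₀ ν
  isSubdomain : ∀ σ, P.IsSubdomain (M σ)
  mem_iff : ∀ᶠ z in 𝓝 x₀, ∀ σ, z ∈ M σ ↔
    ∀ b, ν b ≠ 0 → SignType.sign (inner ℝ (ν b) (z - x₀)) = σ b

lemma H1.nonempty_localChart (hP : P.H1) (x₀ : Vec d) : Nonempty (P.LocalChart x₀) := by
  obtain ⟨ν, hν⟩ := hP.exists_isNormalPair x₀
  have hnear := P.eventually_sign_eq x₀
  obtain ⟨ε, hε, hε0 : 0 < ε⟩ := ((eventually_all.2 fun σ =>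
    (tendsto_add_smul_nhdsGT_zero x₀ (signDir ν σ)).eventually hnear).and
      self_mem_nhdsWithin).exists
  refine ⟨⟨ν, fun σ => P.face (x₀ + ε • signDir ν σ), hν, fun σ => hP.isSubdomain_face _, ?_⟩⟩
  filter_upwards [hnear] with z hz σ
  rw [hν.mem_face_iff fun j hj => (hz j hj).trans (hε σ j hj).symm]
  refine forall₂_congr fun b hb => ?_
  have hsign : SignType.sign (ε * (σ b : ℝ)) = σ b := by
    simpa using sign_add_pos_mul (a := 0) hε0 (by simp)
  rw [add_sub_cancel_left, real_inner_smul_right, hν.inner_signDir σ hb, hsign]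

namespace LocalChart

variable (c : P.LocalChart x₀) {σ : Bool → SignType}

/-- The coordinates of a vector along the normals of the chart. -/
noncomputable def coord : Vec d →L[ℝ] (Bool → ℝ) :=
  ContinuousLinearMap.pi fun b => innerSL ℝ (c.ν b)

lemma coord_apply (v : Vec d) (b : Bool) : c.coord v b = inner ℝ (c.ν b) v := rfl

/-- The open star of `M σ`: it contains, near `x₀`, the subdomains having `M σ` in their
closure. -/
def star (σ : Bool → SignType) : Set (Vec d) :=
  {z | ∀ b, c.ν b ≠ 0 → σ b ≠ 0 → SignType.sign (c.coord (z - x₀) b) = σ b}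

lemma eventually_mem_closure : ∀ᶠ w in 𝓝 x₀, ∀ σ,
    c.coord (w - x₀) ∈ closedOrthant σ → w ∈ closure (c.M σ) := by
  filter_upwards [eventually_eventually_nhds.2 c.mem_iff] with w hw σ hσ
  have hlim := tendsto_add_smul_nhdsGT_zero w (signDir c.ν σ)
  refine mem_closure_of_tendsto hlim ?_
  filter_upwards [hlim.eventually hw, self_mem_nhdsWithin] with t ht ht0
  refine (ht σ).2 fun b hb => ?_
  rw [add_sub_right_comm, inner_add_right, real_inner_smul_right,
    c.isNormalPair.inner_signDir σ hb]
  exact sign_add_pos_mul ht0 (hσ b)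

lemma mem_closure (σ : Bool → SignType) : x₀ ∈ closure (c.M σ) :=
  c.eventually_mem_closure.self_of_nhds σ (by simp)

lemma mem_tangentConeOf {v : Vec d} (hv : c.coord v ∈ closedOrthant σ) :
    v ∈ tangentConeOf (closure (c.M σ)) x₀ := by
  have hzero : (fun t : ℝ => Metric.infDist (x₀ + t • v) (closure (c.M σ)) / t)
      =ᶠ[𝓝[>] 0] fun _ => 0 := by
    filter_upwards [(tendsto_add_smul_nhdsGT_zero x₀ v).eventually c.eventually_mem_closure,
      self_mem_nhdsWithin] with t ht ht0
    rw [Metric.infDist_zero_of_mem, zero_div]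
    refine ht σ ?_
    rw [add_sub_cancel_left, map_smul]
    exact (closedOrthant σ).smul_mem hv (le_of_lt ht0)
  change liminf _ _ = 0
  rw [liminf_congr hzero, liminf_const]

end LocalChart

end MultiDomain

/-! ### Essential velocities -/

/-- Near `x`, every value of `Φ` on `N` is approximated by the values of `Φ` at all the points of
`M` that are close enough to `x`. -/
def ApproximatedWithin {X E : Type*} [TopologicalSpace X] [PseudoMetricSpace E] (Φ : X → Set E)
    (N M : Set X) (x : X) : Prop :=
  ∀ ε > 0, ∀ᶠ y in 𝓝[N] x, ∀ᶠ z in 𝓝[M] x, ∀ v ∈ Φ y, ∃ w ∈ Φ z, dist v w < ε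

section ContExt

variable {d : ℕ} {E : Type*} [PseudoMetricSpace E] {Φ : Vec d → Set E} {M N : Set (Vec d)}
  {x : Vec d}

lemma mem_contExt_iff {p : E} :
    p ∈ contExt Φ M x ↔ ∀ ε > 0, ∃ᶠ z in 𝓝[M] x, ∃ v ∈ Φ z, dist v p < ε := by
  constructor
  · rintro ⟨z, v, hz, hv, hzx, hvp⟩ ε hε
    refine (tendsto_nhdsWithin_iff.2 ⟨hzx, Eventually.of_forall hz⟩).frequently
      ((Metric.tendsto_nhds.1 hvp ε hε).mono fun n hn => ⟨v n, hv n, hn⟩).frequently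
  · intro h
    have hone := tendsto_one_div_add_atTop_nhds_zero_nat (𝕜 := ℝ)
    have hex : ∀ n : ℕ, ∃ z ∈ M, dist z x < 1 / ((n : ℝ) + 1) ∧
        ∃ v ∈ Φ z, dist v p < 1 / ((n : ℝ) + 1) := fun n => by
      have hn : 0 < 1 / ((n : ℝ) + 1) := by positivity
      obtain ⟨z, hz, hzx, hzM⟩ := ((h _ hn).and_eventually
        ((Metric.eventually_nhds_iff_ball.2 ⟨_, hn, fun _ hz => hz⟩).filter_mono
          nhdsWithin_le_nhds |>.and self_mem_nhdsWithin)).exists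
      exact ⟨z, hzM, hzx, hz⟩
    choose z hz hzx v hv hvp using hex
    refine ⟨z, v, hz, hv, tendsto_iff_dist_tendsto_zero.2 ?_, tendsto_iff_dist_tendsto_zero.2 ?_⟩
    · exact squeeze_zero (fun _ => dist_nonneg) (fun n => (hzx n).le) hone
    · exact squeeze_zero (fun _ => dist_nonneg) (fun n => (hvp n).le) hone

lemma isClosed_contExt : IsClosed (contExt Φ M x) := by
  refine isClosed_of_closure_subset fun p hp => mem_contExt_iff.2 fun ε hε => ?_
  obtain ⟨p', hp', hpp'⟩ := Metric.mem_closure_iff.1 hp (ε / 2) (half_pos hε)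
  refine (mem_contExt_iff.1 hp' (ε / 2) (half_pos hε)).mono fun z ⟨v, hv, hvp'⟩ => ⟨v, hv, ?_⟩
  linarith [dist_triangle_right v p p']

lemma ApproximatedWithin.eventually_exists_dist_lt (h : ApproximatedWithin Φ M M x) {p : E}
    (hp : p ∈ contExt Φ M x) {ε : ℝ} (hε : 0 < ε) :
    ∀ᶠ z in 𝓝[M] x, ∃ v ∈ Φ z, dist v p < ε := by
  obtain ⟨y, ⟨v, hv, hvp⟩, hy⟩ :=
    ((mem_contExt_iff.1 hp _ (half_pos hε)).and_eventually (h _ (half_pos hε))).exists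
  filter_upwards [hy] with z hz
  obtain ⟨w, hw, hvw⟩ := hz v hv
  exact ⟨w, hw, by linarith [dist_triangle_left w p v]⟩

lemma ApproximatedWithin.mem_contExt (h : ApproximatedWithin Φ N M x)
    (hx : x ∈ closure M) {p : E} (hp : p ∈ contExt Φ N x) : p ∈ contExt Φ M x := by
  obtain ⟨z, v, hz, hv, hzx, hvp⟩ := hp
  refine mem_contExt_iff.2 fun ε hε => ?_
  have := mem_closure_iff_nhdsWithin_neBot.1 hx
  have hzN := tendsto_nhdsWithin_iff.2 ⟨hzx, Eventually.of_forall hz⟩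
  obtain ⟨i, hi, hip⟩ := ((hzN.eventually (h _ (half_pos hε))).and
    (Metric.tendsto_nhds.1 hvp _ (half_pos hε))).exists
  refine (hi.mono fun y hy => ?_).frequently
  obtain ⟨w, hw, hiw⟩ := hy (v i) (hv i)
  exact ⟨w, hw, by linarith [dist_triangle_left w p (v i)]⟩

lemma ApproximatedWithin.convex_contExt {E : Type*} [SeminormedAddCommGroup E] [NormedSpace ℝ E]
    {Φ : Vec d → Set E} (h : ApproximatedWithin Φ M M x) (hx : x ∈ closure M)
    (hΦ : ∀ z, Convex ℝ (Φ z)) : Convex ℝ (contExt Φ M x) := by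
  intro p hp p' hp' a b ha hb hab
  refine mem_contExt_iff.2 fun ε hε => ?_
  have := mem_closure_iff_nhdsWithin_neBot.1 hx
  refine Eventually.frequently ?_
  filter_upwards [h.eventually_exists_dist_lt hp hε, h.eventually_exists_dist_lt hp' hε]
    with z ⟨v, hv, hvp⟩ ⟨v', hv', hvp'⟩
  refine ⟨a • v + b • v', hΦ z hv hv' ha hb hab, ?_⟩
  have hconv := convex_ball (0 : E) ε (mem_ball_zero_iff.2 (dist_eq_norm v p ▸ hvp))
    (mem_ball_zero_iff.2 (dist_eq_norm v' p' ▸ hvp')) ha hb hab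
  rw [mem_ball_zero_iff] at hconv
  rwa [dist_eq_norm, show a • v + b • v' - (a • p + b • p') = a • (v - p) + b • (v' - p') by module]

lemma LocallyLipschitzUpTo.approximatedWithin (h : LocallyLipschitzUpTo Φ M)
    (hne : ∀ y, (Φ y).Nonempty) (hcomp : ∀ y, IsCompact (Φ y)) (hx : x ∈ closure M) :
    ApproximatedWithin Φ M M x := by
  intro ε hε
  obtain ⟨K, U, hU, hK⟩ := h x hx
  have hU : ∀ᶠ y in 𝓝[M] x, y ∈ U ∩ M :=
    (eventually_nhdsWithin_of_eventually_nhds hU).and self_mem_nhdsWithin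
  have hclose : ∀ᶠ y in 𝓝 x, ∀ᶠ z in 𝓝 x, K * dist y z < ε := by
    have hcont : ContinuousAt (fun w : Vec d × Vec d => K * dist w.1 w.2) (x, x) := by fun_prop
    exact (hcont.eventually_lt_const (by simpa using hε)).curry_nhds
  filter_upwards [hU, nhdsWithin_le_nhds hclose] with y hy hyε
  filter_upwards [hU, nhdsWithin_le_nhds hyε] with z hz hyz v hv
  exact Metric.exists_dist_lt_of_hausdorffDist_lt hv ((hK y hy z hz).trans_lt hyz)
    (Metric.hausdorffEDist_ne_top_of_nonempty_of_bounded (hne y) (hne z)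
      (hcomp y).isBounded (hcomp z).isBounded)

lemma ExtendsByContinuity.approximatedWithin (h : ExtendsByContinuity Φ M)
    (hne : ∀ y, (Φ y).Nonempty) (hcomp : ∀ y, IsCompact (Φ y)) (hx : x ∈ closure M) :
    ApproximatedWithin Φ M M x := by
  intro ε hε
  obtain ⟨C, hCne, hC, hlim⟩ := h x hx
  have hfin : ∀ y, Metric.hausdorffEDist (Φ y) C ≠ ⊤ := fun y =>
    Metric.hausdorffEDist_ne_top_of_nonempty_of_bounded (hne y) hCne
      (hcomp y).isBounded hC.isBounded
  have hclose : ∀ᶠ y in 𝓝[M] x, Metric.hausdorffDist (Φ y) C < ε / 2 :=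
    hlim.eventually_lt_const (half_pos hε)
  filter_upwards [hclose] with y hy
  filter_upwards [hclose] with z hz v hv
  obtain ⟨p, hp, hvp⟩ := Metric.exists_dist_lt_of_hausdorffDist_lt hv hy (hfin y)
  obtain ⟨w, hw, hwp⟩ := Metric.exists_dist_lt_of_hausdorffDist_lt' hp hz (hfin z)
  exact ⟨w, hw, by linarith [dist_triangle_right v w p]⟩

end ContExt

lemma exists_tendsto_subseq_of_upperHemicontinuous {X E : Type*} [TopologicalSpace X]
    [PseudoMetricSpace E] {Φ : X → Set E} (h : UpperHemicontinuous Φ) {x : X}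
    (hx : IsCompact (Φ x)) {z : ℕ → X} {v : ℕ → E} (hz : Tendsto z atTop (𝓝 x))
    (hv : ∀ N, v N ∈ Φ (z N)) :
    ∃ p ∈ Φ x, ∃ s : ℕ → ℕ, StrictMono s ∧ Tendsto (v ∘ s) atTop (𝓝 p) := by
  have hnear : ∀ ε > 0, ∀ᶠ N in atTop, v N ∈ Metric.thickening ε (Φ x) := fun ε hε =>
    (hz.eventually (eventually_subset_thickening_of_upperHemicontinuous h x hε)).mono
      fun N hN => hN (hv N)
  obtain ⟨N₀, hN₀⟩ := (hnear 1 one_pos).exists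
  obtain ⟨w₀, hw₀, -⟩ := Metric.mem_thickening_iff.1 hN₀
  choose w hw hdist using fun N => hx.exists_infDist_eq_dist ⟨w₀, hw₀⟩ (v N)
  have hlim : Tendsto (fun N => dist (v N) (w N)) atTop (𝓝 0) := by
    refine Metric.tendsto_nhds.2 fun ε hε => (hnear ε hε).mono fun N hN => ?_
    rwa [Real.dist_0_eq_abs, abs_dist, ← hdist, Metric.infDist_lt_iff ⟨w₀, hw₀⟩,
      ← Metric.mem_thickening_iff]
  obtain ⟨p, hp, s, hs, hws⟩ := hx.tendsto_subseq hw
  exact ⟨p, hp, s, hs, (tendsto_iff_of_dist (hlim.comp hs.tendsto_atTop)).2 hws⟩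

lemma exists_dual_forall_add_le {E : Type*} [NormedAddCommGroup E] [NormedSpace ℝ E]
    (C : ProperCone ℝ E) {K : Set (E × ℝ)} (hKconv : Convex ℝ K) (hK : IsCompact K)
    (hpos : ∀ w ∈ K, w.1 ∈ C → 0 < w.2) :
    ∃ k : StrongDual ℝ E, (∀ x ∈ C, 0 ≤ k x) ∧ ∃ δ > 0, ∀ w ∈ K, k w.1 + δ ≤ w.2 := by
  let D : ProperCone ℝ (E × ℝ) := C.comap (.fst ℝ E ℝ) ⊓
    (ProperCone.positive ℝ ℝ).comap (-.snd ℝ E ℝ)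
  have hD : ∀ {x : E} {r : ℝ}, (x, r) ∈ D ↔ x ∈ C ∧ r ≤ 0 := by simp [D]
  obtain ⟨f, hfD, hfK⟩ := D.hyperplane_separation hKconv hK <| disjoint_left.2 fun w hw hwD =>
    (hpos w hw (hD.1 hwD).1).not_ge (hD.1 hwD).2
  have hf : ∀ w : E × ℝ, f w = f (w.1, 0) + w.2 * f (0, 1) := fun w => by
    rw [← smul_eq_mul, ← map_smul, ← map_add]
    simp
  have hβ : f (0, 1) ≤ 0 := by
    have hneg : 0 ≤ f (-(0, 1)) := hfD _ (by simp [hD])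
    rwa [map_neg, neg_nonneg] at hneg
  obtain ⟨m, hm, hfm⟩ := hK.exists_forall_le' (f := fun w => -f w) (a := 0) (by fun_prop)
    fun w hw => neg_pos.2 (hfK w hw)
  obtain ⟨R, hR, hKR⟩ := (hK.image continuous_snd).isBounded.exists_pos_norm_le
  -- `f` need not involve the last coordinate; subtracting a small multiple of it makes it do so.
  obtain ⟨θ, hθ, hθR⟩ : ∃ θ > 0, θ * R < m := ⟨m / (2 * R), by positivity, by field_simp; norm_num⟩
  have hμ : 0 < θ - f (0, 1) := by linarith
  let k : StrongDual ℝ E := (θ - f (0, 1))⁻¹ • f.comp (.inl ℝ E ℝ)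
  have hlt : ∀ w ∈ K, 0 < w.2 - k w.1 := fun w hw => by
    have hθw : θ * -R ≤ θ * w.2 :=
      mul_le_mul_of_nonneg_left (abs_le.1 (hKR _ (mem_image_of_mem _ hw))).1 hθ.le
    have hfw := hfm w hw
    change 0 < w.2 - (θ - f (0, 1))⁻¹ * f (w.1, 0)
    rw [sub_pos, inv_mul_lt_iff₀ hμ]
    rw [hf] at hfw
    linarith
  obtain ⟨δ, hδ, hkδ⟩ := hK.exists_forall_le' (by fun_prop) hlt
  exact ⟨k, fun x hx => mul_nonneg (inv_nonneg.2 hμ.le) (hfD _ (hD.2 ⟨hx, le_rfl⟩)), δ, hδ,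
    fun w hw => by linarith [hkδ w hw]⟩

section EssentialVelocities

variable {d n : ℕ} {P : MultiDomain d} {S : ControlProblem d n} {cl lam : ℝ} {x₀ : Vec d}

lemma ControlProblem.HF.approximatedWithin (hF : S.HF P) {M : Set (Vec d)}
    (hM : P.IsSubdomain M) (hx : x₀ ∈ closure M) : ApproximatedWithin S.F M M x₀ := by
  rcases hM with ⟨i, rfl⟩ | hM
  · exact (hF.lipschitz i).approximatedWithin hF.nonempty hF.isCompact hx
  · exact (hF.extends_interface M hM).approximatedWithin hF.nonempty hF.isCompact hx

lemma ControlProblem.HF.eventually_exists_dist_lt (hF : S.HF P) (x : Vec d) {ε : ℝ} (hε : 0 < ε) :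
    ∀ᶠ z in 𝓝 x, ∀ v ∈ S.F z, ∃ w ∈ S.F x, dist v w < ε := by
  filter_upwards [eventually_subset_thickening_of_upperHemicontinuous hF.usc x hε] with z hz v hv
  exact Metric.mem_thickening_iff.1 (hz hv)

lemma ControlProblem.HG.convex_F (hL : S.HL P cl lam) (hG : S.HG cl lam) (x : Vec d) :
    Convex ℝ (S.F x) := by
  have hF : S.F x = LinearMap.fst ℝ (Vec d) ℝ '' S.G cl lam x := by
    ext p
    constructor
    · rintro ⟨a, ha, rfl⟩
      exact ⟨_, hL.augVelocity_mem ha, rfl⟩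
    · rintro ⟨w, ⟨a, ha, r, -, -, rfl⟩, rfl⟩
      exact ⟨a, ha, rfl⟩
  exact hF ▸ (hG.convex x).linear_image _

namespace MultiDomain.LocalChart

variable (c : P.LocalChart x₀)

lemma eventually_mem_sign : ∀ᶠ z in 𝓝 x₀, z ∈ c.M fun b => SignType.sign (c.coord (z - x₀) b) :=
  c.mem_iff.mono fun _ hz => (hz _).2 fun _ _ => rfl

lemma eventually_mem_closure_of_mem_star : ∀ᶠ w in 𝓝 x₀, ∀ σ, w ∈ c.M σ → ∀ z ∈ c.star σ,
    w ∈ closure (c.M fun b => SignType.sign (c.coord (z - x₀) b)) := by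
  filter_upwards [c.mem_iff, c.eventually_mem_closure] with w hw hcl σ hwσ z hz
  refine hcl _ fun b => ?_
  by_cases hν : c.ν b = 0
  · simp [coord_apply, hν]
  have hsign : SignType.sign (c.coord (w - x₀) b) = σ b := (hw σ).1 hwσ b hν
  by_cases hσ : σ b = 0
  · rw [sign_eq_zero_iff.1 (hsign.trans hσ), mul_zero, abs_zero]
  · rw [hz b hν hσ, ← hsign, sign_mul_self]

lemma approximatedWithin_star (hF : S.HF P) (σ : Bool → SignType) :
    ApproximatedWithin S.F (c.star σ) (c.M σ) x₀ := by
  intro ε hε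
  have happrox : ∀ᶠ z in 𝓝 x₀, ∀ σ', z ∈ c.M σ' → ∀ᶠ y in 𝓝[c.M σ'] x₀,
      ∀ v ∈ S.F z, ∃ w ∈ S.F y, dist v w < ε / 2 := eventually_all.2 fun σ' =>
    eventually_nhdsWithin_iff.1
      (hF.approximatedWithin (c.isSubdomain σ') (c.mem_closure σ') _ (half_pos hε))
  refine eventually_nhdsWithin_iff.2 ?_
  filter_upwards [happrox, c.eventually_mem_sign] with z hz hzσ hzstar
  refine eventually_nhdsWithin_iff.2 ?_
  filter_upwards [eventually_eventually_nhds.2 (eventually_nhdsWithin_iff.1 (hz _ hzσ)),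
    c.eventually_mem_closure_of_mem_star] with w hw hcl hwσ v hv
  obtain ⟨y, hyσ, hy, hyw⟩ := ((mem_closure_iff_frequently.1 (hcl σ hwσ z hzstar)).and_eventually
    (hw.and (hF.eventually_exists_dist_lt w (half_pos hε)))).exists
  obtain ⟨p', hp', hvp'⟩ := hy hyσ v hv
  obtain ⟨p, hp, hpp'⟩ := hyw p' hp'
  exact ⟨p, hp, by linarith [dist_triangle v p' p]⟩

end MultiDomain.LocalChart

end EssentialVelocities

/-! ### Necessity of the essential inequality -/

section Necessity

variable {d n : ℕ} {P : MultiDomain d} {S : ControlProblem d n} {T cl lam t τ : ℝ} {x q : Vec d}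

namespace MultiDomain.LocalChart

lemma eventually_pos_augVelocity (c : P.LocalChart x) (hF : S.HF P) (hL : S.HL P cl lam)
    (hG : S.HG cl lam) {σ : Bool → SignType} {g : Vec d × ℝ → ℝ} (hg : Continuous g)
    (hpos : ∀ w ∈ S.G cl lam x, w.1 ∈ contExt S.F (c.M σ) x → 0 < g w) :
    ∀ᶠ z in 𝓝 x, z ∈ c.star σ → ∀ a ∈ S.A, 0 < g (S.augVelocity z a) := by
  by_contra hcon
  obtain ⟨z, hz, hzσ⟩ := exists_seq_forall_of_frequently (not_eventually.1 hcon)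
  push Not at hzσ
  choose hzstar a ha hle using hzσ
  obtain ⟨w, hwG, s, hs, hlim⟩ := exists_tendsto_subseq_of_upperHemicontinuous hG.usc
    (hG.isCompact x) hz fun N => hL.augVelocity_mem (ha N)
  have hw : w.1 ∈ contExt S.F (c.star σ) x :=
    ⟨z ∘ s, fun N => (S.augVelocity (z (s N)) (a (s N))).1, fun N => hzstar _,
      fun N => mem_image_of_mem _ (ha _), hz.comp hs.tendsto_atTop,
      (continuous_fst.tendsto w).comp hlim⟩
  refine (hpos w hwG ((c.approximatedWithin_star hF σ).mem_contExt (c.mem_closure σ) hw)).not_ge ?_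
  exact le_of_tendsto' ((hg.tendsto w).comp hlim) fun N => hle (s N)

lemma exists_dual_nonneg_add_le (c : P.LocalChart x) (hF : S.HF P) (hL : S.HL P cl lam)
    (hG : S.HG cl lam) (hpos : ∀ a ∈ S.AE P x, 0 < τ + inner ℝ q (S.f x a) + S.ℓ x a)
    (σ : Bool → SignType) :
    ∃ k : StrongDual ℝ (Bool → ℝ), (∀ v ∈ closedOrthant σ, 0 ≤ k v) ∧ ∃ δ > 0,
      ∀ w ∈ S.G cl lam x, w.1 ∈ contExt S.F (c.M σ) x →
        k (c.coord w.1) + δ ≤ τ + inner ℝ q w.1 - w.2 := by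
  have hE : IsCompact (S.G cl lam x ∩ Prod.fst ⁻¹' contExt S.F (c.M σ) x) :=
    (hG.isCompact x).inter_right (isClosed_contExt.preimage continuous_fst)
  have hEconv : Convex ℝ (S.G cl lam x ∩ Prod.fst ⁻¹' contExt S.F (c.M σ) x) :=
    (hG.convex x).inter <| ((hF.approximatedWithin (c.isSubdomain σ)
      (c.mem_closure σ)).convex_contExt (c.mem_closure σ)
        (hG.convex_F hL)).linear_preimage (LinearMap.fst ℝ (Vec d) ℝ)
  let Λ : Vec d × ℝ →ᵃ[ℝ] (Bool → ℝ) × ℝ := (c.coord.toLinearMap.comp (.fst ℝ _ ℝ)).toAffineMap.prod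
    (((innerSL ℝ q).toLinearMap.comp (.fst ℝ _ ℝ) - .snd ℝ _ ℝ).toAffineMap + .const ℝ _ τ)
  have hΛ : ∀ w, Λ w = (c.coord w.1, inner ℝ q w.1 - w.2 + τ) := fun w => rfl
  have hΛcont : Continuous Λ := by
    have : Continuous fun w : Vec d × ℝ => (c.coord w.1, inner ℝ q w.1 - w.2 + τ) := by fun_prop
    exact this
  obtain ⟨k, hk, δ, hδ, hkδ⟩ := exists_dual_forall_add_le (closedOrthant σ)
    (hEconv.affine_image Λ) (hE.image hΛcont) (by
      rintro _ ⟨w, ⟨⟨a, ha, r, hr, -, rfl⟩, hwE⟩, rfl⟩ hw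
      have := hpos a ⟨ha, _, c.isSubdomain σ, c.mem_closure σ, hwE, c.mem_tangentConeOf hw⟩
      simp only [hΛ]
      linarith)
  refine ⟨k, hk, δ, hδ, fun w hwG hw => ?_⟩
  have hkw := hkδ _ (mem_image_of_mem _ ⟨hwG, hw⟩)
  simp only [hΛ] at hkw
  linarith

lemma exists_linear_minorant (c : P.LocalChart x) (hF : S.HF P) (hL : S.HL P cl lam)
    (hG : S.HG cl lam) (hpos : ∀ a ∈ S.AE P x, 0 < τ + inner ℝ q (S.f x a) + S.ℓ x a)
    (σ : Bool → SignType) :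
    ∃ k : Bool → ℝ, (∀ b, 0 ≤ (σ b : ℝ) * k b) ∧ ∃ δ > 0, ∀ᶠ z in 𝓝 x, z ∈ c.star σ →
      ∀ a ∈ S.A, inner ℝ (∑ b, k b • c.ν b) (S.f z a) + δ
        ≤ τ + inner ℝ q (S.f z a) + S.ℓ z a := by
  obtain ⟨k, hk, δ, hδ, hkδ⟩ := c.exists_dual_nonneg_add_le hF hL hG hpos σ
  have hcoord : ∀ v, k (c.coord v) = inner ℝ (∑ b, k (Pi.single b 1) • c.ν b) v := fun v => by
    rw [← Finset.univ_sum_single (c.coord v), map_sum, sum_inner]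
    refine Finset.sum_congr rfl fun b _ => ?_
    rw [real_inner_smul_left, ← coord_apply, mul_comm, ← smul_eq_mul, ← map_smul, ← Pi.single_smul,
      smul_eq_mul, mul_one]
  refine ⟨fun b => k (Pi.single b 1), fun b => ?_, δ / 2, half_pos hδ, ?_⟩
  · have hmem : (σ b : ℝ) • Pi.single b 1 ∈ closedOrthant σ := mem_closedOrthant.2 fun b' => by
      obtain rfl | hne := eq_or_ne b' b
      · rcases σ b' <;> simp
      · simp [hne]
    simpa using hk _ hmem
  · have hev := c.eventually_pos_augVelocity hF hL hG (σ := σ)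
      (g := fun w => τ + inner ℝ q w.1 - w.2 - k (c.coord w.1) - δ / 2) (by fun_prop)
      fun w hwG hw => by linarith [hkδ w hwG hw]
    filter_upwards [hev] with z hz hzσ a ha
    have hza := hz hzσ a ha
    simp only [ControlProblem.augVelocity] at hza
    rw [← hcoord]
    linarith

end MultiDomain.LocalChart

/-- The integral over `[t, s]` of `κ + ⟪q, f(y, α)⟫ + ℓ(y, α)` along `(y, α)`; its first two terms
are integrated out. -/
noncomputable def ControlProblem.runningIntegral (S : ControlProblem d n) (κ : ℝ) (q : Vec d)
    (t : ℝ) (y : ℝ → Vec d) (α : ℝ → Vec n) (s : ℝ) : ℝ :=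
  κ * (s - t) + inner ℝ q (y s - y t) + ∫ ρ in t..s, S.ℓ (y ρ) (α ρ)

namespace ControlProblem.IsTrajectory

variable {y : ℝ → Vec d} {α : ℝ → Vec n}

lemma apply_left (h : S.IsTrajectory T t x y α) (ht : t ≤ T) : y t = x := by
  simp [h.2.2 t (left_mem_Icc.2 ht)]

lemma continuousOn (h : S.IsTrajectory T t x y α) : ContinuousOn y (Icc t T) :=
  (continuousOn_const.add ((intervalIntegral.continuousOn_primitive_interval' h.2.1
    left_mem_uIcc).mono Icc_subset_uIcc)).congr h.2.2

lemma sub_eq_integral (h : S.IsTrajectory T t x y α) {r s : ℝ} (hr : r ∈ Icc t T)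
    (hs : s ∈ Icc t T) : y s - y r = ∫ ρ in r..s, S.f (y ρ) (α ρ) := by
  have hint : ∀ s ∈ Icc t T, IntervalIntegrable (fun ρ => S.f (y ρ) (α ρ)) volume t s := fun s hs =>
    h.2.1.mono_set (uIcc_subset_uIcc_left (Icc_subset_uIcc hs))
  rw [h.2.2 s hs, h.2.2 r hr, add_sub_add_left_eq_sub,
    intervalIntegral.integral_interval_sub_left (hint s hs) (hint r hr)]

lemma ae_mem (h : S.IsTrajectory T t x y α) (ht : 0 ≤ t) {r s : ℝ} (hr : t ≤ r) (hs : s ≤ T) :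
    ∀ᵐ ρ ∂volume.restrict (Ioo r s), α ρ ∈ S.A :=
  ae_restrict_of_ae_restrict_of_subset (Ioo_subset_Ioo (ht.trans hr) hs) h.1.2

lemma tendsto_nhdsGE (h : S.IsTrajectory T t x y α) (ht : t < T) :
    Tendsto y (𝓝[≥] t) (𝓝 x) := by
  have := h.continuousOn t (left_mem_Icc.2 ht.le)
  rwa [ContinuousWithinAt, h.apply_left ht.le, nhdsWithin_Icc_eq_nhdsGE ht] at this

lemma exists_eventually_norm_sub_le (hF : S.HF P) (h : S.IsTrajectory T t x y α)
    (ht : t ∈ Ico 0 T) : ∃ C, ∀ᶠ s in 𝓝[≥] t, ‖y s - x‖ ≤ C * (s - t) := by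
  obtain ⟨cf, hcf, hgrow⟩ := hF.growth
  obtain ⟨s₀, hs₀, hnear⟩ := mem_nhdsGE_iff_exists_Icc_subset.1
    (((h.tendsto_nhdsGE ht.2).norm.eventually_lt_const (lt_add_one ‖x‖)).and (Icc_mem_nhdsGE ht.2))
  refine ⟨cf * (1 + (‖x‖ + 1)), ?_⟩
  filter_upwards [Icc_mem_nhdsGE hs₀] with s hs
  have hsT := (hnear hs).2
  have hbound : ∀ᵐ ρ ∂volume.restrict (Ioo t s),
      ‖S.f (y ρ) (α ρ)‖ ≤ cf * (1 + (‖x‖ + 1)) := by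
    filter_upwards [h.ae_mem ht.1 le_rfl hsT.2, ae_restrict_mem measurableSet_Ioo] with ρ hρA hρ
    have hyρ := (hnear ⟨hρ.1.le, hρ.2.le.trans hs.2⟩).1
    exact (hgrow _ _ (mem_image_of_mem _ hρA)).trans (by gcongr)
  rw [restrict_Ioo_eq_restrict_Ioc, ae_restrict_iff' measurableSet_Ioc, ← uIoc_of_le hs.1] at hbound
  have hle := intervalIntegral.norm_integral_le_of_norm_le_const_ae hbound
  rwa [← h.sub_eq_integral (left_mem_Icc.2 ht.2.le) hsT, h.apply_left ht.2.le,
    abs_of_nonneg (sub_nonneg.2 hs.1)] at hle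

variable {κ r s s₀ : ℝ} {w : Vec d}

lemma runningIntegral_sub (h : S.IsTrajectory T t x y α)
    (hℓ : IntervalIntegrable (fun ρ => S.ℓ (y ρ) (α ρ)) volume t T) (hr : r ∈ Icc t T)
    (hs : s ∈ Icc t T) : S.runningIntegral κ q t y α s - S.runningIntegral κ q t y α r
      = ∫ ρ in r..s, (κ + inner ℝ q (S.f (y ρ) (α ρ)) + S.ℓ (y ρ) (α ρ)) := by
  have hsub : uIcc r s ⊆ uIcc t T := uIcc_subset_uIcc (Icc_subset_uIcc hr) (Icc_subset_uIcc hs)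
  have hf := h.2.1.mono_set hsub
  have hq : IntervalIntegrable (fun ρ => inner ℝ q (S.f (y ρ) (α ρ))) volume r s :=
    ⟨(innerSL ℝ q).integrable_comp hf.1, (innerSL ℝ q).integrable_comp hf.2⟩
  have hℓt : ∀ s ∈ Icc t T, IntervalIntegrable (fun ρ => S.ℓ (y ρ) (α ρ)) volume t s := fun s hs =>
    hℓ.mono_set (uIcc_subset_uIcc_left (Icc_subset_uIcc hs))
  have hqint : inner ℝ q (y s - y r) = ∫ ρ in r..s, inner ℝ q (S.f (y ρ) (α ρ)) := by
    rw [h.sub_eq_integral hr hs]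
    exact ((innerSL ℝ q).intervalIntegral_comp_comm hf).symm
  rw [intervalIntegral.integral_add (intervalIntegrable_const.add hq) (hℓ.mono_set hsub),
    intervalIntegral.integral_add intervalIntegrable_const hq, intervalIntegral.integral_const,
    ← hqint, ← intervalIntegral.integral_interval_sub_left (hℓt s hs) (hℓt r hr), smul_eq_mul,
    ← sub_sub_sub_cancel_right (y s) (y r) (y t), inner_sub_right]
  simp only [ControlProblem.runningIntegral]
  ring

lemma continuousOn_runningIntegral (h : S.IsTrajectory T t x y α)
    (hℓ : IntervalIntegrable (fun ρ => S.ℓ (y ρ) (α ρ)) volume t T) :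
    ContinuousOn (S.runningIntegral κ q t y α) (Icc t T) := by
  have hcost := (intervalIntegral.continuousOn_primitive_interval' hℓ left_mem_uIcc).mono
    Icc_subset_uIcc
  have hy := h.continuousOn
  unfold ControlProblem.runningIntegral
  fun_prop

lemma inner_sub_le_runningIntegral_sub (h : S.IsTrajectory T t x y α) (ht : 0 ≤ t)
    (hℓ : IntervalIntegrable (fun ρ => S.ℓ (y ρ) (α ρ)) volume t T) (hr : r ∈ Icc t T)
    (hs : s ∈ Icc t T) (hrs : r ≤ s) (hle : ∀ ρ ∈ Ioo r s, ∀ a ∈ S.A,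
      inner ℝ w (S.f (y ρ) a) ≤ κ + inner ℝ q (S.f (y ρ) a) + S.ℓ (y ρ) a) :
    inner ℝ w (y s - y r)
      ≤ S.runningIntegral κ q t y α s - S.runningIntegral κ q t y α r := by
  have hint : 0 ≤ ∫ ρ in r..s, (κ + inner ℝ (q - w) (S.f (y ρ) (α ρ)) + S.ℓ (y ρ) (α ρ)) := by
    refine intervalIntegral.integral_nonneg_of_ae_restrict hrs ?_
    rw [← restrict_Ioo_eq_restrict_Icc]
    filter_upwards [h.ae_mem ht hr.1 hs.2, ae_restrict_mem measurableSet_Ioo] with ρ hρA hρ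
    have := hle ρ hρ _ hρA
    simp only [inner_sub_left, Pi.zero_apply]
    linarith
  rw [← h.runningIntegral_sub hℓ hr hs] at hint
  simp only [ControlProblem.runningIntegral, inner_sub_left, inner_sub_right] at hint ⊢
  linarith

lemma incrementsLE_runningIntegral (h : S.IsTrajectory T t x y α) (ht : 0 ≤ t)
    (hℓ : IntervalIntegrable (fun ρ => S.ℓ (y ρ) (α ρ)) volume t T) (hs₀ : s₀ ≤ T)
    (c : P.LocalChart x) {σ : Bool → SignType} {k : Bool → ℝ}
    (hle : ∀ s ∈ Icc t s₀, y s ∈ c.star σ → ∀ a ∈ S.A, inner ℝ (∑ b, k b • c.ν b) (S.f (y s) a)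
      ≤ κ + inner ℝ q (S.f (y s) a) + S.ℓ (y s) a) :
    IncrementsLE (s₀ - t) (MatchesSigns σ fun b s => c.coord (y (t + s) - x) b)
      (fun s => ∑ b, k b * c.coord (y (t + s) - x) b)
      (fun s => S.runningIntegral κ q t y α (t + s)) := by
  intro r s hr hrs hs hσ
  have hinc := h.inner_sub_le_runningIntegral_sub ht hℓ (r := t + r) (s := t + s) (κ := κ) (q := q)
    (w := ∑ b, k b • c.ν b) ⟨by linarith, by linarith⟩ ⟨by linarith, by linarith⟩ (by linarith)
    fun ρ hρ => hle ρ ⟨by linarith [hρ.1], by linarith [hρ.2]⟩ fun b _ hb => by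
      simpa using hσ (ρ - t) ⟨by linarith [hρ.1], by linarith [hρ.2]⟩ b hb
  refine le_trans (le_of_eq ?_) hinc
  rw [← Finset.sum_sub_distrib, sum_inner]
  refine Finset.sum_congr rfl fun b _ => ?_
  rw [← mul_sub, ← Pi.sub_apply, ← map_sub, sub_sub_sub_cancel_right,
    MultiDomain.LocalChart.coord_apply, real_inner_smul_left]

lemma exists_runningIntegral_nonneg (h : S.IsTrajectory T t x y α) (ht : 0 ≤ t)
    (hℓ : IntervalIntegrable (fun ρ => S.ℓ (y ρ) (α ρ)) volume t T) (hts : t < s₀) (hs₀ : s₀ ≤ T)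
    (c : P.LocalChart x) {k : (Bool → SignType) → Bool → ℝ}
    (hk : ∀ σ b, 0 ≤ (σ b : ℝ) * k σ b)
    (hle : ∀ s ∈ Icc t s₀, ∀ σ, y s ∈ c.star σ → ∀ a ∈ S.A,
      inner ℝ (∑ b, k σ b • c.ν b) (S.f (y s) a)
        ≤ κ + inner ℝ q (S.f (y s) a) + S.ℓ (y s) a) :
    ∃ s ∈ Ioc t s₀, 0 ≤ S.runningIntegral κ q t y α s := by
  by_contra! hneg
  have hmaps : MapsTo (fun s => t + s) (Icc 0 (s₀ - t)) (Icc t T) := fun s hs =>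
    ⟨by linarith [hs.1], by linarith [hs.2]⟩
  have hshift : ContinuousOn (fun s => t + s) (Icc 0 (s₀ - t)) := by fun_prop
  have hy := h.continuousOn.comp hshift hmaps
  refine false_of_sign_pattern_incrementsLE (sub_pos.2 hts) (fun b => ?_)
    ((h.continuousOn_runningIntegral hℓ).comp hshift hmaps) (fun b => ?_) ?_ (fun s hs => ?_) hk
    fun σ => h.incrementsLE_runningIntegral ht hℓ hs₀ c fun s hs => hle s hs σ
  · exact (innerSL ℝ (c.ν b)).continuous.comp_continuousOn (hy.sub continuousOn_const)
  · simp [h.apply_left (hts.le.trans hs₀)]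
  · simp [ControlProblem.runningIntegral]
  · exact hneg _ ⟨by linarith [hs.1], by linarith [hs.2]⟩

end ControlProblem.IsTrajectory

lemma hasFDerivAt_apply_eq_deriv_add_inner_gradient {φ : ℝ × Vec d → ℝ}
    {φ' : ℝ × Vec d →L[ℝ] ℝ} (h : HasFDerivAt φ φ' (t, x)) (s : ℝ) (v : Vec d) :
    φ' (s, v) = deriv (fun t => φ (t, x)) t * s + inner ℝ (gradient (fun x => φ (t, x)) x) v := by
  have hfst : HasDerivAt (fun t => φ (t, x)) (φ' (1, 0)) t :=
    h.comp_hasDerivAt t ((hasDerivAt_id t).prodMk (hasDerivAt_const t x))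
  have hsnd : HasFDerivAt (fun x => φ (t, x)) (φ'.comp (.inr ℝ ℝ (Vec d))) x :=
    h.comp x (hasFDerivAt_prodMk_right t x)
  have hsplit : ((s, v) : ℝ × Vec d) = s • ((1 : ℝ), (0 : Vec d)) + (0, v) := by simp
  rw [hfst.deriv, gradient, hsnd.fderiv, InnerProductSpace.toDual_symm_apply, hsplit, map_add,
    map_smul, smul_eq_mul, mul_comm]
  rfl

lemma eventually_le_of_isLocalMin_sub {u : ℝ → Vec d → ℝ} {φ : ℝ × Vec d → ℝ}
    (hφ : DifferentiableAt ℝ φ (t, x))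
    (hmin : IsLocalMin (fun z : ℝ × Vec d => u z.1 z.2 - φ z) (t, x)) {y : ℝ → Vec d} {C : ℝ}
    (hy : ∀ᶠ s in 𝓝[≥] t, ‖y s - x‖ ≤ C * (s - t)) {δ : ℝ} (hδ : 0 < δ) :
    ∀ᶠ s in 𝓝[≥] t, deriv (fun t => φ (t, x)) t * (s - t)
      + inner ℝ (gradient (fun x => φ (t, x)) x) (y s - x) ≤ u s (y s) - u t x + δ * (s - t) := by
  have hsub : Tendsto (fun s => s - t) (𝓝[≥] t) (𝓝 0) := by
    simpa using (tendsto_id.sub_const t).mono_left (nhdsWithin_le_nhds (a := t))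
  have hlim : Tendsto (fun s => (s, y s)) (𝓝[≥] t) (𝓝 (t, x)) := by
    refine (tendsto_nhdsWithin_of_tendsto_nhds tendsto_id).prodMk_nhds ?_
    exact tendsto_iff_norm_sub_tendsto_zero.2
      (squeeze_zero' (.of_forall fun _ => norm_nonneg _) hy (by simpa using hsub.const_mul C))
  have hbig : (fun s => (s, y s) - (t, x)) =O[𝓝[≥] t] fun s => s - t := by
    refine .prod_left (Asymptotics.isBigO_refl _ _) (.of_bound C ?_)
    filter_upwards [hy, self_mem_nhdsWithin] with s hs hts
    rwa [Real.norm_of_nonneg (sub_nonneg.2 hts)]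
  filter_upwards [((hφ.hasFDerivAt.isLittleO.comp_tendsto hlim).trans_isBigO hbig).def hδ,
    hlim.eventually hmin, self_mem_nhdsWithin] with s hs hmins (hts : t ≤ s)
  simp only [Function.comp_apply, Prod.mk_sub_mk,
    hasFDerivAt_apply_eq_deriv_add_inner_gradient hφ.hasFDerivAt, Real.norm_eq_abs,
    abs_of_nonneg (sub_nonneg.2 hts)] at hs
  linarith [neg_le_of_abs_le hs]

lemma exists_frequently_le_runningIntegral (hP : P.H1) (hF : S.HF P) (hL : S.HL P cl lam)
    (hG : S.HG cl lam) (hpos : ∀ a ∈ S.AE P x, 0 < τ + inner ℝ q (S.f x a) + S.ℓ x a)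
    {y : ℝ → Vec d} {α : ℝ → Vec n} (h : S.IsTrajectory T t x y α) (ht : t ∈ Ico 0 T)
    (hℓ : IntervalIntegrable (fun s => S.ℓ (y s) (α s)) volume t T) :
    ∃ δ > 0, ∃ᶠ s in 𝓝[>] t, δ * (s - t) ≤ S.runningIntegral τ q t y α s := by
  obtain ⟨c⟩ := hP.nonempty_localChart x
  choose k hk δ hδ hkδ using c.exists_linear_minorant hF hL hG hpos
  obtain ⟨σ₀, hσ₀⟩ := Finite.exists_min δ
  refine ⟨δ σ₀, hδ σ₀, (nhdsGT_basis t).frequently_iff.2 fun s₁ hs₁ => ?_⟩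
  obtain ⟨s₀, hs₀ : t < s₀, hnear⟩ := mem_nhdsGE_iff_exists_Icc_subset.1
    (((h.tendsto_nhdsGE ht.2).eventually (eventually_all.2 hkδ)).and
      (inter_mem (Ico_mem_nhdsGE hs₁) (Icc_mem_nhdsGE ht.2)))
  have hs₀mem := (hnear (right_mem_Icc.2 hs₀.le)).2
  obtain ⟨s, hs, hnonneg⟩ := h.exists_runningIntegral_nonneg (κ := τ - δ σ₀) (q := q) ht.1 hℓ hs₀
    hs₀mem.2.2 c hk fun s hs σ hsσ a ha => by linarith [(hnear hs).1 σ hsσ a ha, hσ₀ σ]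
  refine ⟨s, ⟨hs.1, hs.2.trans_lt hs₀mem.1.2⟩, ?_⟩
  simp only [ControlProblem.runningIntegral] at hnonneg ⊢
  linarith

lemma ControlProblem.pos_of_not_nonneg_add_hamiltonian {B : Set (Vec n)}
    (h : ¬ 0 ≤ ((-τ : ℝ) : EReal) + S.hamiltonian B x q) {a : Vec n} (ha : a ∈ B) :
    0 < τ + inner ℝ q (S.f x a) + S.ℓ x a := by
  by_contra! hle
  refine h ?_
  calc (0 : EReal) ≤ ((-τ + (-inner ℝ q (S.f x a) - S.ℓ x a) : ℝ) : EReal) :=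
        EReal.coe_nonneg.2 (by linarith)
    _ ≤ ((-τ : ℝ) : EReal) + S.hamiltonian B x q := by
        rw [EReal.coe_add]
        gcongr
        exact le_iSup₂ (f := fun a (_ : a ∈ B) =>
          ((-inner ℝ q (S.f x a) - S.ℓ x a : ℝ) : EReal)) a ha

lemma isSupersolution_HamE_of_superOptimal (hP : P.H1) (hF : S.HF P) (hL : S.HL P cl lam)
    (hG : S.HG cl lam) {u : ℝ → Vec d → ℝ}
    (hu : LowerSemicontinuousOn (fun z : ℝ × Vec d => u z.1 z.2) (Ioc 0 T ×ˢ univ))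
    (hsup : S.SuperOptimal T (Ioc 0 T) u) : IsSupersolution T (S.HamE P) u := by
  refine ⟨hu, fun t ht x φ hφ hmin => ?_⟩
  by_contra hneg
  obtain ⟨y, α, hy, hℓ, hopt⟩ := hsup t ⟨ht.1, ht.2.le⟩ x
  have htT : t ∈ Ico 0 T := ⟨ht.1.le, ht.2⟩
  obtain ⟨δ, hδ, hfreq⟩ := exists_frequently_le_runningIntegral hP hF hL hG
    (fun a ha => S.pos_of_not_nonneg_add_hamiltonian hneg ha) hy htT hℓ
  obtain ⟨C, hC⟩ := hy.exists_eventually_norm_sub_le hF htT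
  have hdiff : DifferentiableAt ℝ φ (t, x) := (hφ.contDiffAt
    ((isOpen_Ioo.prod isOpen_univ).mem_nhds ⟨ht, mem_univ x⟩)).differentiableAt one_ne_zero
  have hexp := (eventually_le_of_isLocalMin_sub hdiff hmin hC (half_pos hδ)).filter_mono
    (nhdsWithin_mono t Ioi_subset_Ici_self)
  obtain ⟨s, hs, hle, hst, hsT⟩ := (hfreq.and_eventually (hexp.and (Ioo_mem_nhdsGT ht.2))).exists
  have hopts := hopt (s - t) ⟨by linarith, by linarith⟩
  rw [add_sub_cancel] at hopts
  simp only [ControlProblem.runningIntegral, hy.apply_left ht.2.le] at hs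
  have := mul_pos hδ (sub_pos.2 hst)
  linarith

end Necessity

theorem mainTheorem5 {d n : ℕ} (P : MultiDomain d) (S : ControlProblem d n)
    (T cl lam : ℝ) (hT : 0 < T)
    (hP : P.H1) (hS : S.Regular) (hF : S.HF P) (hL : S.HL P cl lam) (hG : S.HG cl lam)
    (u : ℝ → Vec d → ℝ)
    (hu : LowerSemicontinuousOn (fun z : ℝ × Vec d => u z.1 z.2) (Ioc 0 T ×ˢ univ)) :
    (S.SuperOptimal T (Ioc 0 T) u ↔ IsSupersolution T (S.HamE P) u) ∧
    (IsSupersolution T (S.HamE P) u ↔ IsSupersolution T S.HamF u) ∧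
    (InitialTimeRegular u →
      (S.SuperOptimal T (Icc 0 T) u ↔ IsSupersolution T (S.HamE P) u)) := by
  have h12 : S.SuperOptimal T (Ioc 0 T) u → IsSupersolution T (S.HamE P) u :=
    isSupersolution_HamE_of_superOptimal hP hF hL hG hu
  have h23 : IsSupersolution T (S.HamE P) u → IsSupersolution T S.HamF u := fun h =>
    h.mono fun x p => ControlProblem.HamE_le_HamF x p
  have h31 : IsSupersolution T S.HamF u → S.SuperOptimal T (Ioc 0 T) u :=
    superOptimal_Ioc_of_isSupersolution hS hF hL hG
  exact ⟨⟨h12, h31 ∘ h23⟩, ⟨h23, h12 ∘ h31⟩, fun hinit =>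
    ⟨fun h => h12 (h.mono Ioc_subset_Icc_self),
      fun h => superOptimal_Icc_of_isSupersolution hT hS hF hL hG (h23 h) hinit⟩⟩
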